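/- All algebras are complex algebras. For an algebra $A$ (not necessarily unital), $M(A)$ is its multiplier algebra. For maps $s,t$ from an algebra $B$ to $M(A)$ write ${}_{s}A\otimes A^{t}$ for $A\otimes A$ modulo $s(x)a\otimes b=a\otimes t(x)b$ and ${}^{t}A\otimes A_{s}$ for $A\otimes A$ modulo $a\,t(x)\otimes b=a\otimes b\,s(x)$. A *left multiplier bialgebroid* $(A,B,s,t,\Delta)$ consists of: an algebra $A$ with $A_A$ non-degenerate and idempotent; a homomorphism $s$ and an anti-homomorphism $t$ from an algebra $B$ to $M(A)$ with commuting images such that $A$ is faithful and idempotent as a $B$-module via left multiplication along $s$ and along $t$ and ${}_{s}A\otimes A^{t}$ is non-degenerate as a right module over $A\otimes1$ and over $1\otimes A$; and a homomorphism $\Delta$ from $A$ to the algebra of those endomorphisms $T$ of ${}_{s}A\otimes A^{t}$ for which there are elements $T(a\otimes1),T(1\otimes b)$ with $T(a\otimes b)=T(a\otimes1)(1\otimes b)=T(1\otimes b)(a\otimes1)$, such that $\Delta(s(x)a)=(1\otimes s(x))\Delta(a)$, $\Delta(t(x)a)=(t(x)\otimes1)\Delta(a)$, $\Delta(as(x))=\Delta(a)(1\otimes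 s(x))$, $\Delta(at(x))=\Delta(a)(t(x)\otimes1)$ and $(\Delta\otimes\iota)(\Delta(b)(1\otimes c))(a\otimes1\otimes1)=(\iota\otimes\Delta)(\Delta(b)(a\otimes1))(1\otimes1\otimes c)$. A *left counit* is a linear map $\varepsilon\colon A\to B$ with $\varepsilon(s(x)a)=x\varepsilon(a)$, $\varepsilon(t(x)a)=\varepsilon(a)x$ such that $a\otimes b\mapsto t(\varepsilon(a))b$ sends $\Delta(a)(1\otimes b)$ to $ab$ and $a\otimes b\mapsto s(\varepsilon(b))a$ sends $\Delta(b)(a\otimes1)$ to $ba$. *Right multiplier bialgebroids* $(A,C,s,t,\Delta)$ and *right counits* are defined analogously, with left and right multiplication exchanged: $\Delta(a)$ acts from the right on ${}^{t}A\otimes A_{s}$, $\Delta(s(y)a)=(s(y)\otimes1)\Delta(a)$, $\Delta(t(y)a)=(1\otimes t(y))\Delta(a)$, $\Delta(as(y))=\Delta(a)(s(y)\otimes1)$, $\Delta(at(y))=\Delta(a)(1\otimes t(y))$, $(a\otimes1\otimes1)(\Delta\otimes\iota)((1\otimes c)\Delta(b))=(1\otimes1\otimes c)(\iota\otimes\Delta)((a\otimes1)\Delta(b))$;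 and $\varepsilon\colon A\to C$ satisfies $\varepsilon(as(y))=\varepsilon(a)y$, $\varepsilon(at(y))=y\varepsilon(a)$, while $a\otimes b\mapsto b\,s(\varepsilon(a))$ sends $(1\otimes b)\Delta(a)$ to $ba$ and $a\otimes b\mapsto a\,t(\varepsilon(b))$ sends $(a\otimes1)\Delta(b)$ to $ab$. A *multiplier bialgebroid* $\mathcal A=(A,B,C,S_B,S_C,\Delta_B,\Delta_C)$ consists of subalgebras $B,C\subseteq M(A)$, anti-isomorphisms $S_B\colon B\to C$, $S_C\colon C\to B$ and maps $\Delta_B,\Delta_C$ such that $\mathcal A_B=(A,B,\iota_B,S_B,\Delta_B)$ and $\mathcal A_C=(A,C,\iota_C,S_C,\Delta_C)$ are a left and a right multiplier bialgebroid and, for all $a,b,c\in A$, $$(\Delta_B\otimes\iota)((1\otimes c)\Delta_C(b))(a\otimes1\otimes1)=(1\otimes1\otimes c)(\iota\otimes\Delta_C)(\Delta_B(b)(a\otimes1)),$$ $$(a\otimes1\otimes1)(\Delta_C\otimes\iota)(\Delta_B(b)(1\otimes c))=(\iota\otimes\Delta_B)((a\otimes1)\Delta_C(b))(1\otimes1\otimes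 c).$$ It is a *regular multiplier Hopf algebroid* if the canonical maps $a\otimes b\mapsto\Delta_B(b)(a\otimes1)$, $\Delta_B(a)(1\otimes b)$, $(a\otimes1)\Delta_C(b)$, $(1\otimes b)\Delta_C(a)$, defined on $A\otimes A$ modulo $ya\otimes b=a\otimes by$, $ax\otimes b=a\otimes xb$, $ay\otimes b=a\otimes yb$, $xa\otimes b=a\otimes bx$ ($x\in B$, $y\in C$), respectively, are bijective, and if $S_B(I)A=I'A=AS_C(J)=AJ'=A$, where $I,I'$ are the spans of the values of all linear $\omega\colon A\to B$ with $\omega(xa)=x\omega(a)$, respectively $\omega(S_B(x)a)=\omega(a)x$, and $J,J'$ are the spans of the values of all linear $\omega\colon A\to C$ with $\omega(ay)=\omega(a)y$, respectively $\omega(aS_C(y))=y\omega(a)$. An *(invertible) antipode* of $\mathcal A$ is an anti-automorphism $S$ of $A$ with $S(xyax'y')=S_C(y')S_B(x')S(a)S_C(y)S_B(x)$ ($x,x'\in B$, $y,y'\in C$) for which there are a left counit $\varepsilon_B$ and a right counit $\varepsilon_C$ such that $m(S\otimes\iota)(\Delta_B(a)(1\otimes b))=S_C(\varepsilon_C(a))b$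 and $m(\iota\otimes S)((a\otimes1)\Delta_C(b))=aS_B(\varepsilon_B(b))$. $\mathcal A$ is *unital* if $A$ is unital, $1_A\in B$, $1_A\in C$ (as $M(A)=A$), and $\Delta_B,\Delta_C$ are unital. A *Hopf algebroid* over unital algebras $L,R$ (in the sense of Böhm–Szlachányi) is a triple $(\mathcal H_L,\mathcal H_R,S)$ of a left bialgebroid $\mathcal H_L=(H,L,s_L,t_L,\Delta_L,\varepsilon_L)$, a right bialgebroid $\mathcal H_R=(H,R,s_R,t_R,\Delta_R,\varepsilon_R)$ with the same unital algebra $H$ (left and right bialgebroids in the usual sense, for the bimodule structures $l\cdot h\cdot l'=s_L(l)t_L(l')h$ and $r\cdot h\cdot r'=h\,s_R(r')t_R(r)$; $s_L,s_R$ are homomorphisms and $t_L,t_R$ anti-homomorphisms), and a linear map $S\colon H\to H$ such that: $s_L\varepsilon_Lt_R=t_R$, $t_L\varepsilon_Ls_R=s_R$, $s_R\varepsilon_Rt_L=t_L$, $t_R\varepsilon_Rs_L=s_L$; $(\Delta_L\otimes_R\iota)\Delta_R=(\iota\otimes_L\Delta_R)\Delta_L$ and $(\Delta_R\otimes_L\iota)\Delta_L=(\iota\otimes_R\Delta_L)\Delta_R$;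 $S(t_L(l)ht_R(r))=s_R(r)S(h)s_L(l)$; $m(S\otimes_L\iota)\Delta_L=s_R\varepsilon_R$ and $m(\iota\otimes_RS)\Delta_R=s_L\varepsilon_L$. **Proposition.** (1) Let $\mathcal A$ be a unital regular multiplier Hopf algebroid. Then $\mathcal A$ has a unique antipode $S$, a unique left counit $\varepsilon_B$ and a unique right counit $\varepsilon_C$. Put $L=B^{\mathrm{op}}$, $R=C^{\mathrm{op}}$, $s_L=S_B$, $t_L=\iota_B$, $\Delta_L(a)=\Delta_B(a)(1\otimes1)$, $\varepsilon_L=\varepsilon_B$ and $s_R=S_C$, $t_R=\iota_C$, $\Delta_R(a)=(1\otimes1)\Delta_C(a)$, $\varepsilon_R=\varepsilon_C$. Then $\mathcal A_L=(A,L,s_L,t_L,\Delta_L,\varepsilon_L)$ is a left bialgebroid, $\mathcal A_R=(A,R,s_R,t_R,\Delta_R,\varepsilon_R)$ is a right bialgebroid, and $(\mathcal A_L,\mathcal A_R,S)$ is a Hopf algebroid. (2) Conversely, for every Hopf algebroid $(\mathcal H_L,\mathcal H_R,S)$ with bijective $S$ there is a unital regular multiplier Hopf algebroid $\mathcal A$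 with total algebra $H$ and antipode $S$ from which it arises as in (1), up to isomorphisms $L\cong B^{\mathrm{op}}$ and $R\cong C^{\mathrm{op}}$ of the base algebras. -/

import Mathlib

open TensorProduct
open scoped MulOpposite

namespace MultHopf

/-! ### Balanced tensor products

All algebras are complex algebras, not assumed to be unital unless this is said.  Base algebras may be
non-unital and non-commutative, so the relative tensor products are built as explicit quotients of the
tensor product over `ℂ`. -/

section Balanced

variable {V : Type*} [AddCommGroup V] [Module ℂ V] {ι κ : Type*}

/-- The subspace of `V ⊗ V` spanned by all `f i a ⊗ b - a ⊗ g i b`. -/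
def balancedSub (f g : ι → Module.End ℂ V) : Submodule ℂ (V ⊗[ℂ] V) :=
  Submodule.span ℂ {u | ∃ (i : ι) (a b : V), u = f i a ⊗ₜ[ℂ] b - a ⊗ₜ[ℂ] g i b}

/-- The balanced tensor product: `V ⊗ V` modulo `f i a ⊗ b = a ⊗ g i b`. -/
abbrev Bal (f g : ι → Module.End ℂ V) : Type _ := (V ⊗[ℂ] V) ⧸ balancedSub f g

/-- The quotient map from `V ⊗ V` onto the balanced tensor product. -/
abbrev Bal.mk (f g : ι → Module.End ℂ V) : V ⊗[ℂ] V →ₗ[ℂ] Bal f g := (balancedSub f g).mkQ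

/-- The class of `a ⊗ b`. -/
def Bal.tmul (f g : ι → Module.End ℂ V) : V →ₗ[ℂ] V →ₗ[ℂ] Bal f g :=
  (TensorProduct.mk ℂ V V).compr₂ (Bal.mk f g)

theorem Bal.tmul_balanced (f g : ι → Module.End ℂ V) (i : ι) (a b : V) :
    Bal.tmul f g (f i a) b = Bal.tmul f g a (g i b) :=
  (Submodule.Quotient.eq _).2 (Submodule.subset_span ⟨i, a, b, rfl⟩)

/-- The endomorphism `a ⊗ b ↦ u a ⊗ v b`. -/
def Bal.map {f g : ι → Module.End ℂ V} (u v : Module.End ℂ V)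
    (hu : ∀ i, Commute u (f i)) (hv : ∀ i, Commute v (g i)) : Module.End ℂ (Bal f g) :=
  (balancedSub f g).mapQ (balancedSub f g) (TensorProduct.map u v) (by
    refine Submodule.span_le.2 ?_
    rintro _ ⟨i, a, b, rfl⟩
    refine Submodule.subset_span ⟨i, u a, v b, ?_⟩
    have h1 : u (f i a) = f i (u a) := LinearMap.congr_fun (hu i) a
    have h2 : v (g i b) = g i (v b) := LinearMap.congr_fun (hv i) b
    rw [map_sub, TensorProduct.map_tmul, TensorProduct.map_tmul, h1, h2])

theorem Bal.map_tmul {f g : ι → Module.End ℂ V} (u v : Module.End ℂ V)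
    (hu : ∀ i, Commute u (f i)) (hv : ∀ i, Commute v (g i)) (a b : V) :
    Bal.map u v hu hv (Bal.tmul f g a b) = Bal.tmul f g (u a) (v b) := rfl

theorem Bal.hom_ext {f g : ι → Module.End ℂ V} {W : Type*} [AddCommGroup W] [Module ℂ W]
    {P Q : Bal f g →ₗ[ℂ] W} (h : ∀ a b, P (Bal.tmul f g a b) = Q (Bal.tmul f g a b)) : P = Q :=
  Submodule.linearMap_qext _ (TensorProduct.ext' h)

/-- A bilinear map `φ` with `φ (f i a) b = φ a (g i b)` induces a linear map on the balanced tensor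
product. -/
def Bal.lift (f g : ι → Module.End ℂ V) {W : Type*} [AddCommGroup W] [Module ℂ W]
    (φ : V →ₗ[ℂ] V →ₗ[ℂ] W) (h : ∀ i a b, φ (f i a) b = φ a (g i b)) : Bal f g →ₗ[ℂ] W :=
  (balancedSub f g).liftQ (TensorProduct.lift φ) (by
    refine Submodule.span_le.2 ?_
    rintro _ ⟨i, a, b, rfl⟩
    simp [h])

theorem Bal.lift_tmul (f g : ι → Module.End ℂ V) {W : Type*} [AddCommGroup W] [Module ℂ W]
    (φ : V →ₗ[ℂ] V →ₗ[ℂ] W) (h : ∀ i a b, φ (f i a) b = φ a (g i b)) (a b : V) :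
    Bal.lift f g φ h (Bal.tmul f g a b) = φ a b :=
  TensorProduct.lift.tmul a b

/-- The subspace of `V ⊗ V ⊗ V` spanned by all `f i a ⊗ b ⊗ c - a ⊗ g i b ⊗ c` and all
`a ⊗ f' j b ⊗ c - a ⊗ b ⊗ g' j c`. -/
def balancedSub₃ (f g : ι → Module.End ℂ V) (f' g' : κ → Module.End ℂ V) :
    Submodule ℂ (V ⊗[ℂ] (V ⊗[ℂ] V)) :=
  Submodule.span ℂ
    ({u | ∃ (i : ι) (a b c : V),
        u = f i a ⊗ₜ[ℂ] (b ⊗ₜ[ℂ] c) - a ⊗ₜ[ℂ] (g i b ⊗ₜ[ℂ] c)} ∪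
      {u | ∃ (j : κ) (a b c : V),
        u = a ⊗ₜ[ℂ] (f' j b ⊗ₜ[ℂ] c) - a ⊗ₜ[ℂ] (b ⊗ₜ[ℂ] g' j c)})

/-- The threefold tensor product, balanced by `(f, g)` between the first two factors and by `(f', g')`
between the last two. -/
abbrev Bal₃ (f g : ι → Module.End ℂ V) (f' g' : κ → Module.End ℂ V) : Type _ :=
  (V ⊗[ℂ] (V ⊗[ℂ] V)) ⧸ balancedSub₃ f g f' g'

/-- The class of `a ⊗ b ⊗ c`. -/
def Bal₃.tmul (f g : ι → Module.End ℂ V) (f' g' : κ → Module.End ℂ V) :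
    V →ₗ[ℂ] V →ₗ[ℂ] V →ₗ[ℂ] Bal₃ f g f' g' :=
  LinearMap.mk₂ ℂ
    (fun a b => (balancedSub₃ f g f' g').mkQ ∘ₗ TensorProduct.mk ℂ V (V ⊗[ℂ] V) a ∘ₗ
      TensorProduct.mk ℂ V V b)
    (fun a a' b => by ext c; simp)
    (fun r a b => by
      ext c
      exact congrArg (balancedSub₃ f g f' g').mkQ (TensorProduct.smul_tmul' r a _))
    (fun a b b' => by ext c; simp [TensorProduct.tmul_add])
    (fun r a b => by
      ext c
      exact congrArg (balancedSub₃ f g f' g').mkQ (TensorProduct.tmul_smul r a (b ⊗ₜ[ℂ] c)))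

/-- The map `(a ⊗ b, c) ↦ a ⊗ b ⊗ c`. -/
def Bal₃.inl (f g : ι → Module.End ℂ V) (f' g' : κ → Module.End ℂ V) :
    Bal f g →ₗ[ℂ] V →ₗ[ℂ] Bal₃ f g f' g' :=
  Bal.lift f g (Bal₃.tmul f g f' g') (fun i a b => by
    ext c
    exact (Submodule.Quotient.eq _).2 (Submodule.subset_span (Or.inl ⟨i, a, b, c, rfl⟩)))

/-- The map `(a, b ⊗ c) ↦ a ⊗ b ⊗ c`. -/
def Bal₃.inr (f g : ι → Module.End ℂ V) (f' g' : κ → Module.End ℂ V) :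
    V →ₗ[ℂ] Bal f' g' →ₗ[ℂ] Bal₃ f g f' g' :=
  LinearMap.mk₂ ℂ
    (fun a w => Bal.lift f' g' (Bal₃.tmul f g f' g' a) (fun j b c =>
      (Submodule.Quotient.eq _).2 (Submodule.subset_span (Or.inr ⟨j, a, b, c, rfl⟩))) w)
    (fun a a' w => by
      rw [← LinearMap.add_apply]
      congr 1
      apply Bal.hom_ext
      intro b c
      change Bal₃.tmul f g f' g' (a + a') b c =
        Bal₃.tmul f g f' g' a b c + Bal₃.tmul f g f' g' a' b c
      simp only [map_add, LinearMap.add_apply])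
    (fun r a w => by
      rw [← LinearMap.smul_apply]
      congr 1
      apply Bal.hom_ext
      intro b c
      change Bal₃.tmul f g f' g' (r • a) b c = r • Bal₃.tmul f g f' g' a b c
      simp only [map_smul, LinearMap.smul_apply])
    (fun a w w' => map_add _ w w')
    (fun r a w => map_smul _ r w)

/-- For `T : V ⊗ V → Bal f g` and `T' : V ⊗ V → Bal f' g'`, the identity
`(T ⊗ id) (id ⊗ T') = (id ⊗ T') (T ⊗ id)` of maps from `V ⊗ V ⊗ V` to the threefold balanced tensor
product.  The outer maps are applied to representatives in `V ⊗ V` of the elements `T' (b ⊗ c)` and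
`T (a ⊗ b)`, and the identity is required for all representatives. -/
def CommuteOnLegs {f g : ι → Module.End ℂ V} {f' g' : κ → Module.End ℂ V}
    (T : V →ₗ[ℂ] V →ₗ[ℂ] Bal f g) (T' : V →ₗ[ℂ] V →ₗ[ℂ] Bal f' g') : Prop :=
  ∀ (a b c : V) (v w : V ⊗[ℂ] V), Bal.mk f g v = T a b → Bal.mk f' g' w = T' b c →
    TensorProduct.lift (Bal₃.inl f g f' g' ∘ₗ T a) w =
      TensorProduct.lift ((Bal₃.inr f g f' g').compl₂ (T'.flip c)) v

/-- For `D : V → Bal f g` and `D' : V → Bal f' g'`, the identity `(D ⊗ id) D' = (id ⊗ D') D` of maps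
from `V` to the threefold balanced tensor product, again required for all representatives in `V ⊗ V`
of the elements `D' h` and `D h`. -/
def Coassociative {f g : ι → Module.End ℂ V} {f' g' : κ → Module.End ℂ V}
    (D : V →ₗ[ℂ] Bal f g) (D' : V →ₗ[ℂ] Bal f' g') : Prop :=
  ∀ (h : V) (v w : V ⊗[ℂ] V), Bal.mk f g v = D h → Bal.mk f' g' w = D' h →
    TensorProduct.lift (Bal₃.inl f g f' g' ∘ₗ D) w =
      TensorProduct.lift ((Bal₃.inr f g f' g').compl₂ D') v

end Balanced

/-! ### Multiplier algebras -/

section Multipliers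

variable (A : Type*) [NonUnitalRing A] [Module ℂ A] [IsScalarTower ℂ A A] [SMulCommClass ℂ A A]

/-- The multiplier algebra `M(A)`, as the algebra of double centralizers: pairs of maps `a ↦ T a` and
`a ↦ a T` with `T (a b) = (T a) b`, `(a b) T = a (b T)` and `a (T b) = (a T) b`.  If `A` is
non-degenerate as a right (left) module over itself, then each such pair is determined by its first
(second) member, and one obtains the left multipliers `T` with `A T ⊆ A` (the right multipliers `T` with
`T A ⊆ A`). -/
def multiplierAlgebra : Subalgebra ℂ (Module.End ℂ A × (Module.End ℂ A)ᵐᵒᵖ) where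
  carrier := {T | (∀ a b, T.1 (a * b) = T.1 a * b) ∧
    (∀ a b, T.2.unop (a * b) = a * T.2.unop b) ∧ ∀ a b, a * T.1 b = T.2.unop a * b}
  mul_mem' := by
    rintro S T ⟨h1, h2, h3⟩ ⟨k1, k2, k3⟩
    refine ⟨fun a b => ?_, fun a b => ?_, fun a b => ?_⟩
    · simp [h1, k1]
    · simp [h2, k2]
    · simp [h3, k3]
  add_mem' := by
    rintro S T ⟨h1, h2, h3⟩ ⟨k1, k2, k3⟩
    refine ⟨fun a b => ?_, fun a b => ?_, fun a b => ?_⟩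
    · simp [h1, k1, add_mul]
    · simp [h2, k2, mul_add]
    · simp [h3, k3, add_mul, mul_add]
  algebraMap_mem' := by
    intro r
    refine ⟨fun a b => ?_, fun a b => ?_, fun a b => ?_⟩
    · simp [Algebra.algebraMap_eq_smul_one, smul_mul_assoc]
    · simp [Algebra.algebraMap_eq_smul_one, mul_smul_comm]
    · simp [Algebra.algebraMap_eq_smul_one, smul_mul_assoc, mul_smul_comm]

/-- The type of multipliers of `A`. -/
def Multiplier : Type _ := ↥(multiplierAlgebra A)

instance : Ring (Multiplier A) := inferInstanceAs (Ring ↥(multiplierAlgebra A))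

instance : Algebra ℂ (Multiplier A) := inferInstanceAs (Algebra ℂ ↥(multiplierAlgebra A))

variable {A}

/-- Left multiplication `a ↦ T a` by a multiplier. -/
def Multiplier.l (T : Multiplier A) : Module.End ℂ A := T.1.1

/-- Right multiplication `a ↦ a T` by a multiplier. -/
def Multiplier.r (T : Multiplier A) : Module.End ℂ A := T.1.2.unop

theorem Multiplier.l_mul (T : Multiplier A) (a b : A) : T.l (a * b) = T.l a * b := T.2.1 a b

theorem Multiplier.r_mul (T : Multiplier A) (a b : A) : T.r (a * b) = a * T.r b := T.2.2.1 a b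

theorem Multiplier.commute_l {S T : Multiplier A} (h : Commute S T) : Commute S.l T.l :=
  congrArg (fun U : Multiplier A => U.l) h

theorem Multiplier.commute_r {S T : Multiplier A} (h : Commute S T) : Commute S.r T.r :=
  congrArg (fun U : Multiplier A => U.r) h.symm

end Multipliers

/-! ### The target of a comultiplication -/

/-- A vector space with a bilinear action `ρ` on it and a pair of families of endomorphisms that commute
with this action. It is used with `ρ` given by right multiplication and `f`, `g` by left multiplication
with multipliers, or the other way around. -/
structure TensorSystem (A ι : Type*) [AddCommGroup A] [Module ℂ A] where
  f : ι → Module.End ℂ A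
  g : ι → Module.End ℂ A
  ρ : A →ₗ[ℂ] Module.End ℂ A
  comm_f : ∀ a i, Commute (ρ a) (f i)
  comm_g : ∀ a i, Commute (ρ a) (g i)

namespace TensorSystem

variable {A ι : Type*} [AddCommGroup A] [Module ℂ A] (D : TensorSystem A ι)

/-- `A ⊗ A` modulo `f i a ⊗ b = a ⊗ g i b`. -/
abbrev Tensor : Type _ := Bal D.f D.g

/-- The class of `a ⊗ b`. -/
abbrev tmul : A →ₗ[ℂ] A →ₗ[ℂ] D.Tensor := Bal.tmul D.f D.g

/-- The endomorphism `a ⊗ b ↦ u a ⊗ b`. -/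
def leg₁ (u : Module.End ℂ A) (hu : ∀ i, Commute u (D.f i)) : Module.End ℂ D.Tensor :=
  Bal.map u 1 hu (fun _ => Commute.one_left _)

/-- The endomorphism `a ⊗ b ↦ a ⊗ v b`. -/
def leg₂ (v : Module.End ℂ A) (hv : ∀ i, Commute v (D.g i)) : Module.End ℂ D.Tensor :=
  Bal.map 1 v (fun _ => Commute.one_left _) hv

/-- The action of `a ⊗ 1`. -/
def act₁ (a : A) : Module.End ℂ D.Tensor := D.leg₁ (D.ρ a) (D.comm_f a)

/-- The action of `1 ⊗ b`. -/
def act₂ (b : A) : Module.End ℂ D.Tensor := D.leg₂ (D.ρ b) (D.comm_g b)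

/-- The balanced tensor product is non-degenerate as a module over `A ⊗ 1` and over `1 ⊗ A`. -/
def Nondegenerate : Prop :=
  (∀ w : D.Tensor, (∀ a, D.act₁ a w = 0) → w = 0) ∧ ∀ w : D.Tensor, (∀ b, D.act₂ b w = 0) → w = 0

/-- The space of endomorphisms `T` of the balanced tensor product such that for all `a`, `b` there are
elements `T (a ⊗ 1)` and `T (1 ⊗ b)` for which `T (a ⊗ b)` is equal to `T (a ⊗ 1)` acted upon by `1 ⊗ b`
and to `T (1 ⊗ b)` acted upon by `a ⊗ 1`. -/
def multipliers : Submodule ℂ (Module.End ℂ D.Tensor) where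
  carrier := {T | (∀ a, ∃ u, ∀ b, T (D.tmul a b) = D.act₂ b u) ∧
    ∀ b, ∃ v, ∀ a, T (D.tmul a b) = D.act₁ a v}
  add_mem' := by
    rintro S T ⟨h1, h2⟩ ⟨k1, k2⟩
    refine ⟨fun a => ?_, fun b => ?_⟩
    · obtain ⟨u, hu⟩ := h1 a
      obtain ⟨u', hu'⟩ := k1 a
      exact ⟨u + u', fun b => by simp [hu, hu']⟩
    · obtain ⟨u, hu⟩ := h2 b
      obtain ⟨u', hu'⟩ := k2 b
      exact ⟨u + u', fun b => by simp [hu, hu']⟩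
  zero_mem' := ⟨fun a => ⟨0, fun b => by simp⟩, fun b => ⟨0, fun a => by simp⟩⟩
  smul_mem' := by
    rintro r T ⟨k1, k2⟩
    refine ⟨fun a => ?_, fun b => ?_⟩
    · obtain ⟨u, hu⟩ := k1 a
      exact ⟨r • u, fun b => by simp [hu]⟩
    · obtain ⟨u, hu⟩ := k2 b
      exact ⟨r • u, fun b => by simp [hu]⟩

variable {D}

theorem Nondegenerate.ext₁ (nd : D.Nondegenerate) {u v : D.Tensor}
    (h : ∀ a, D.act₁ a u = D.act₁ a v) : u = v :=
  sub_eq_zero.1 (nd.1 _ fun a => by rw [map_sub, h, sub_self])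

theorem Nondegenerate.ext₂ (nd : D.Nondegenerate) {u v : D.Tensor}
    (h : ∀ b, D.act₂ b u = D.act₂ b v) : u = v :=
  sub_eq_zero.1 (nd.2 _ fun a => by rw [map_sub, h, sub_self])

/-- The element `T (a ⊗ 1)`, which is unique by non-degeneracy, as a function of `T` and `a`. -/
noncomputable def slice₁ (nd : D.Nondegenerate) : D.multipliers →ₗ[ℂ] A →ₗ[ℂ] D.Tensor :=
  LinearMap.mk₂ ℂ (fun T a => (T.2.1 a).choose)
    (fun S T a => nd.ext₂ fun b => (((S + T).2.1 a).choose_spec b).symm.trans <|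
      (congrArg₂ (· + ·) ((S.2.1 a).choose_spec b) ((T.2.1 a).choose_spec b)).trans
        (map_add _ _ _).symm)
    (fun r T a => nd.ext₂ fun b => (((r • T).2.1 a).choose_spec b).symm.trans <|
      (congrArg (r • ·) ((T.2.1 a).choose_spec b)).trans (map_smul _ _ _).symm)
    (fun T a a' => nd.ext₂ fun b => ((T.2.1 (a + a')).choose_spec b).symm.trans <|
      Eq.trans (by simp) <| (congrArg₂ (· + ·) ((T.2.1 a).choose_spec b)
        ((T.2.1 a').choose_spec b)).trans (map_add _ _ _).symm)
    (fun r T a => nd.ext₂ fun b => ((T.2.1 (r • a)).choose_spec b).symm.trans <|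
      Eq.trans (by simp) <|
        (congrArg (r • ·) ((T.2.1 a).choose_spec b)).trans (map_smul _ _ _).symm)

/-- The element `T (1 ⊗ b)`, which is unique by non-degeneracy, as a function of `T` and `b`. -/
noncomputable def slice₂ (nd : D.Nondegenerate) : D.multipliers →ₗ[ℂ] A →ₗ[ℂ] D.Tensor :=
  LinearMap.mk₂ ℂ (fun T a => (T.2.2 a).choose)
    (fun S T a => nd.ext₁ fun b => (((S + T).2.2 a).choose_spec b).symm.trans <|
      (congrArg₂ (· + ·) ((S.2.2 a).choose_spec b) ((T.2.2 a).choose_spec b)).trans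
        (map_add _ _ _).symm)
    (fun r T a => nd.ext₁ fun b => (((r • T).2.2 a).choose_spec b).symm.trans <|
      (congrArg (r • ·) ((T.2.2 a).choose_spec b)).trans (map_smul _ _ _).symm)
    (fun T a a' => nd.ext₁ fun b => ((T.2.2 (a + a')).choose_spec b).symm.trans <|
      Eq.trans (by simp) <| (congrArg₂ (· + ·) ((T.2.2 a).choose_spec b)
        ((T.2.2 a').choose_spec b)).trans (map_add _ _ _).symm)
    (fun r T a => nd.ext₁ fun b => ((T.2.2 (r • a)).choose_spec b).symm.trans <|
      Eq.trans (by simp) <|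
        (congrArg (r • ·) ((T.2.2 a).choose_spec b)).trans (map_smul _ _ _).symm)

theorem act₂_slice₁ (nd : D.Nondegenerate) (T : D.multipliers) (a b : A) :
    D.act₂ b (slice₁ nd T a) = T.1 (D.tmul a b) := ((T.2.1 a).choose_spec b).symm

theorem act₁_slice₂ (nd : D.Nondegenerate) (T : D.multipliers) (a b : A) :
    D.act₁ a (slice₂ nd T b) = T.1 (D.tmul a b) := ((T.2.2 b).choose_spec a).symm

end TensorSystem

section OneSided

variable {A : Type*} [NonUnitalRing A] [Module ℂ A] [IsScalarTower ℂ A A] [SMulCommClass ℂ A A]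
variable {B : Type*} [NonUnitalRing B] [Module ℂ B]

/-- The left-handed tensor product: `A ⊗ A` modulo `s(x) a ⊗ b = a ⊗ t(x) b`, with `A ⊗ 1` and `1 ⊗ A`
acting by right multiplication. -/
def leftSystem (s t : B →ₗ[ℂ] Multiplier A) : TensorSystem A B where
  f x := (s x).l
  g x := (t x).l
  ρ := (LinearMap.mul ℂ A).flip
  comm_f a x := by ext b; exact ((s x).l_mul b a).symm
  comm_g a x := by ext b; exact ((t x).l_mul b a).symm

/-- The right-handed tensor product: `A ⊗ A` modulo `a t(y) ⊗ b = a ⊗ b s(y)`, with `A ⊗ 1` and `1 ⊗ A`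
acting by left multiplication. -/
def rightSystem (s t : B →ₗ[ℂ] Multiplier A) : TensorSystem A B where
  f y := (t y).r
  g y := (s y).r
  ρ := LinearMap.mul ℂ A
  comm_f a x := by ext b; exact ((t x).r_mul a b).symm
  comm_g a x := by ext b; exact ((s x).r_mul a b).symm

end OneSided

/-! ### Left multiplier bialgebroids -/

/-- A left multiplier bialgebroid `(A, B, s, t, Δ)`. -/
structure LeftMultiplierBialgebroid (A B : Type*)
    [NonUnitalRing A] [Module ℂ A] [IsScalarTower ℂ A A] [SMulCommClass ℂ A A]
    [NonUnitalRing B] [Module ℂ B] where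
  s : B →ₗ[ℂ] Multiplier A
  t : B →ₗ[ℂ] Multiplier A
  s_mul : ∀ x y, s (x * y) = s x * s y
  t_mul : ∀ x y, t (x * y) = t y * t x
  comm : ∀ x y, Commute (s x) (t y)
  /-- the right module `A` over `A` is non-degenerate and idempotent -/
  nondeg : ∀ a : A, (∀ b, a * b = 0) → a = 0
  idem : Submodule.span ℂ {c : A | ∃ a b, c = a * b} = ⊤
  /-- `A` is faithful and idempotent as a `B`-module via left multiplication along `s` and along `t` -/
  s_faithful : ∀ x, (∀ a, (s x).l a = 0) → x = 0
  t_faithful : ∀ x, (∀ a, (t x).l a = 0) → x = 0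
  s_idem : Submodule.span ℂ {c : A | ∃ x a, c = (s x).l a} = ⊤
  t_idem : Submodule.span ℂ {c : A | ∃ x a, c = (t x).l a} = ⊤
  tensor_nondeg : (leftSystem s t).Nondegenerate
  /-- the left comultiplication -/
  Δ : A →ₗ[ℂ] (leftSystem s t).multipliers
  Δ_mul : ∀ a b, (Δ (a * b)).1 = (Δ a).1 * (Δ b).1
  /-- `Δ(s(x) a) = (1 ⊗ s(x)) Δ(a)` -/
  Δ_s_left : ∀ x a, (Δ ((s x).l a)).1 = ((leftSystem s t).leg₂ (s x).l
    (fun y => Multiplier.commute_l (comm x y))) * (Δ a).1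
  /-- `Δ(t(y) a) = (t(y) ⊗ 1) Δ(a)` -/
  Δ_t_left : ∀ y a, (Δ ((t y).l a)).1 = ((leftSystem s t).leg₁ (t y).l
    (fun x => Multiplier.commute_l (comm x y).symm)) * (Δ a).1
  /-- `Δ(a s(x)) = Δ(a) (1 ⊗ s(x))` -/
  Δ_s_right : ∀ x a, (Δ ((s x).r a)).1 = (Δ a).1 * ((leftSystem s t).leg₂ (s x).l
    (fun y => Multiplier.commute_l (comm x y)))
  /-- `Δ(a t(y)) = Δ(a) (t(y) ⊗ 1)` -/
  Δ_t_right : ∀ y a, (Δ ((t y).r a)).1 = (Δ a).1 * ((leftSystem s t).leg₁ (t y).l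
    (fun x => Multiplier.commute_l (comm x y).symm))
  /-- `(Δ ⊗ id)(Δ(b)(1 ⊗ c)) (a ⊗ 1 ⊗ 1) = (id ⊗ Δ)(Δ(b)(a ⊗ 1)) (1 ⊗ 1 ⊗ c)` -/
  coassoc : CommuteOnLegs (TensorSystem.slice₁ tensor_nondeg ∘ₗ Δ).flip
    (TensorSystem.slice₂ tensor_nondeg ∘ₗ Δ)

namespace LeftMultiplierBialgebroid

variable {A B : Type*} [NonUnitalRing A] [Module ℂ A] [IsScalarTower ℂ A A] [SMulCommClass ℂ A A]
  [NonUnitalRing B] [Module ℂ B] (𝓛 : LeftMultiplierBialgebroid A B)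

/-- `A ⊗ A` modulo `s(x) a ⊗ b = a ⊗ t(x) b`, with the right multiplications by `A ⊗ 1` and `1 ⊗ A`. -/
abbrev sys : TensorSystem A B := leftSystem 𝓛.s 𝓛.t

/-- `(a, b) ↦ Δ(b) (a ⊗ 1)`. -/
noncomputable def preTlam : A →ₗ[ℂ] A →ₗ[ℂ] 𝓛.sys.Tensor :=
  (TensorSystem.slice₁ 𝓛.tensor_nondeg ∘ₗ 𝓛.Δ).flip

/-- `(a, b) ↦ Δ(a) (1 ⊗ b)`. -/
noncomputable def preTrho : A →ₗ[ℂ] A →ₗ[ℂ] 𝓛.sys.Tensor :=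
  TensorSystem.slice₂ 𝓛.tensor_nondeg ∘ₗ 𝓛.Δ

/-- The canonical map `a ⊗ b ↦ Δ(b) (a ⊗ 1)`, defined on `A ⊗ A` modulo `t(x) a ⊗ b = a ⊗ b t(x)`. -/
noncomputable def Tlam :
    Bal (fun x => (𝓛.t x).l) (fun x => (𝓛.t x).r) →ₗ[ℂ] 𝓛.sys.Tensor :=
  Bal.lift _ _ 𝓛.preTlam (fun x a b => 𝓛.tensor_nondeg.ext₂ fun c => by
    refine (TensorSystem.act₂_slice₁ 𝓛.tensor_nondeg _ _ _).trans
      (Eq.trans ?_ (TensorSystem.act₂_slice₁ 𝓛.tensor_nondeg _ _ _).symm)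
    rw [𝓛.Δ_t_right]; rfl)

/-- The canonical map `a ⊗ b ↦ Δ(a) (1 ⊗ b)`, defined on `A ⊗ A` modulo `a s(x) ⊗ b = a ⊗ s(x) b`. -/
noncomputable def Trho :
    Bal (fun x => (𝓛.s x).r) (fun x => (𝓛.s x).l) →ₗ[ℂ] 𝓛.sys.Tensor :=
  Bal.lift _ _ 𝓛.preTrho (fun x a b => 𝓛.tensor_nondeg.ext₁ fun c => by
    refine (TensorSystem.act₁_slice₂ 𝓛.tensor_nondeg _ _ _).trans
      (Eq.trans ?_ (TensorSystem.act₁_slice₂ 𝓛.tensor_nondeg _ _ _).symm)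
    rw [𝓛.Δ_s_right]; rfl)

/-- A left counit: a linear map `ε : A → B` with `ε(s(x) a) = x ε(a)` and `ε(t(y) a) = ε(a) y`, for which
the slice maps `ε ⊗ id : a ⊗ b ↦ t(ε(a)) b` and `id ⊗ ε : a ⊗ b ↦ s(ε(b)) a` send `Δ(a) (1 ⊗ b)` to `a b`
and `Δ(b) (a ⊗ 1)` to `b a`.  The slice maps are evaluated on representatives in `A ⊗ A`. -/
structure IsCounit (ε : A →ₗ[ℂ] B) : Prop where
  map_s : ∀ x a, ε ((𝓛.s x).l a) = x * ε a
  map_t : ∀ y a, ε ((𝓛.t y).l a) = ε a * y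
  slice_rho : ∀ (a b : A) (n : ℕ) (c d : Fin n → A),
    𝓛.preTrho a b = ∑ i, 𝓛.sys.tmul (c i) (d i) → ∑ i, (𝓛.t (ε (c i))).l (d i) = a * b
  slice_lam : ∀ (a b : A) (n : ℕ) (c d : Fin n → A),
    𝓛.preTlam a b = ∑ i, 𝓛.sys.tmul (c i) (d i) → ∑ i, (𝓛.s (ε (d i))).l (c i) = b * a

end LeftMultiplierBialgebroid

/-! ### Right multiplier bialgebroids -/

/-- A right multiplier bialgebroid `(A, C, s, t, Δ)`.  The elements of the target of `Δ` act on the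
right-handed tensor product from the right, so that products are reversed when they are written as
compositions of endomorphisms. -/
structure RightMultiplierBialgebroid (A C : Type*)
    [NonUnitalRing A] [Module ℂ A] [IsScalarTower ℂ A A] [SMulCommClass ℂ A A]
    [NonUnitalRing C] [Module ℂ C] where
  s : C →ₗ[ℂ] Multiplier A
  t : C →ₗ[ℂ] Multiplier A
  s_mul : ∀ x y, s (x * y) = s x * s y
  t_mul : ∀ x y, t (x * y) = t y * t x
  comm : ∀ x y, Commute (s x) (t y)
  /-- the left module `A` over `A` is non-degenerate and idempotent -/
  nondeg : ∀ a : A, (∀ b, b * a = 0) → a = 0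
  idem : Submodule.span ℂ {c : A | ∃ a b, c = a * b} = ⊤
  /-- `A` is faithful and idempotent as a `C`-module via right multiplication along `s` and along `t` -/
  s_faithful : ∀ y, (∀ a, (s y).r a = 0) → y = 0
  t_faithful : ∀ y, (∀ a, (t y).r a = 0) → y = 0
  s_idem : Submodule.span ℂ {c : A | ∃ y a, c = (s y).r a} = ⊤
  t_idem : Submodule.span ℂ {c : A | ∃ y a, c = (t y).r a} = ⊤
  tensor_nondeg : (rightSystem s t).Nondegenerate
  /-- the right comultiplication -/
  Δ : A →ₗ[ℂ] (rightSystem s t).multipliers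
  Δ_mul : ∀ a b, (Δ (a * b)).1 = (Δ b).1 * (Δ a).1
  /-- `Δ(s(y) a) = (s(y) ⊗ 1) Δ(a)` -/
  Δ_s_left : ∀ y a, (Δ ((s y).l a)).1 = (Δ a).1 * ((rightSystem s t).leg₁ (s y).r
    (fun x => Multiplier.commute_r (comm y x)))
  /-- `Δ(t(x) a) = (1 ⊗ t(x)) Δ(a)` -/
  Δ_t_left : ∀ x a, (Δ ((t x).l a)).1 = (Δ a).1 * ((rightSystem s t).leg₂ (t x).r
    (fun y => Multiplier.commute_r (comm y x).symm))
  /-- `Δ(a s(y)) = Δ(a) (s(y) ⊗ 1)` -/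
  Δ_s_right : ∀ y a, (Δ ((s y).r a)).1 = ((rightSystem s t).leg₁ (s y).r
    (fun x => Multiplier.commute_r (comm y x))) * (Δ a).1
  /-- `Δ(a t(x)) = Δ(a) (1 ⊗ t(x))` -/
  Δ_t_right : ∀ x a, (Δ ((t x).r a)).1 = ((rightSystem s t).leg₂ (t x).r
    (fun y => Multiplier.commute_r (comm y x).symm)) * (Δ a).1
  /-- `(a ⊗ 1 ⊗ 1) (Δ ⊗ id)((1 ⊗ c)Δ(b)) = (1 ⊗ 1 ⊗ c) (id ⊗ Δ)((a ⊗ 1)Δ(b))` -/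
  coassoc : CommuteOnLegs (TensorSystem.slice₁ tensor_nondeg ∘ₗ Δ).flip
    (TensorSystem.slice₂ tensor_nondeg ∘ₗ Δ)

namespace RightMultiplierBialgebroid

variable {A C : Type*} [NonUnitalRing A] [Module ℂ A] [IsScalarTower ℂ A A] [SMulCommClass ℂ A A]
  [NonUnitalRing C] [Module ℂ C] (𝓡 : RightMultiplierBialgebroid A C)

/-- `A ⊗ A` modulo `a t(y) ⊗ b = a ⊗ b s(y)`, with the left multiplications by `A ⊗ 1` and `1 ⊗ A`. -/
abbrev sys : TensorSystem A C := rightSystem 𝓡.s 𝓡.t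

/-- `(a, b) ↦ (a ⊗ 1) Δ(b)`. -/
noncomputable def preTlam : A →ₗ[ℂ] A →ₗ[ℂ] 𝓡.sys.Tensor :=
  (TensorSystem.slice₁ 𝓡.tensor_nondeg ∘ₗ 𝓡.Δ).flip

/-- `(a, b) ↦ (1 ⊗ b) Δ(a)`. -/
noncomputable def preTrho : A →ₗ[ℂ] A →ₗ[ℂ] 𝓡.sys.Tensor :=
  TensorSystem.slice₂ 𝓡.tensor_nondeg ∘ₗ 𝓡.Δ

/-- The canonical map `a ⊗ b ↦ (a ⊗ 1) Δ(b)`, defined on `A ⊗ A` modulo `a s(y) ⊗ b = a ⊗ s(y) b`. -/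
noncomputable def Tlam :
    Bal (fun y => (𝓡.s y).r) (fun y => (𝓡.s y).l) →ₗ[ℂ] 𝓡.sys.Tensor :=
  Bal.lift _ _ 𝓡.preTlam (fun x a b => 𝓡.tensor_nondeg.ext₂ fun c => by
    refine (TensorSystem.act₂_slice₁ 𝓡.tensor_nondeg _ _ _).trans
      (Eq.trans ?_ (TensorSystem.act₂_slice₁ 𝓡.tensor_nondeg _ _ _).symm)
    rw [𝓡.Δ_s_left]; rfl)

/-- The canonical map `a ⊗ b ↦ (1 ⊗ b) Δ(a)`, defined on `A ⊗ A` modulo `t(y) a ⊗ b = a ⊗ b t(y)`. -/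
noncomputable def Trho :
    Bal (fun y => (𝓡.t y).l) (fun y => (𝓡.t y).r) →ₗ[ℂ] 𝓡.sys.Tensor :=
  Bal.lift _ _ 𝓡.preTrho (fun x a b => 𝓡.tensor_nondeg.ext₁ fun c => by
    refine (TensorSystem.act₁_slice₂ 𝓡.tensor_nondeg _ _ _).trans
      (Eq.trans ?_ (TensorSystem.act₁_slice₂ 𝓡.tensor_nondeg _ _ _).symm)
    rw [𝓡.Δ_t_left]; rfl)

/-- A right counit: a linear map `ε : A → C` with `ε(a s(y)) = ε(a) y` and `ε(a t(x)) = x ε(a)`, for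
which the slice maps `ε ⊗ id : a ⊗ b ↦ b s(ε(a))` and `id ⊗ ε : a ⊗ b ↦ a t(ε(b))` send `(1 ⊗ b) Δ(a)`
to `b a` and `(a ⊗ 1) Δ(b)` to `a b`. -/
structure IsCounit (ε : A →ₗ[ℂ] C) : Prop where
  map_s : ∀ y a, ε ((𝓡.s y).r a) = ε a * y
  map_t : ∀ x a, ε ((𝓡.t x).r a) = x * ε a
  slice_rho : ∀ (a b : A) (n : ℕ) (c d : Fin n → A),
    𝓡.preTrho a b = ∑ i, 𝓡.sys.tmul (c i) (d i) → ∑ i, (𝓡.s (ε (c i))).r (d i) = b * a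
  slice_lam : ∀ (a b : A) (n : ℕ) (c d : Fin n → A),
    𝓡.preTlam a b = ∑ i, 𝓡.sys.tmul (c i) (d i) → ∑ i, (𝓡.t (ε (d i))).r (c i) = a * b

end RightMultiplierBialgebroid

/-! ### Multiplier Hopf algebroids -/

/-- A multiplier bialgebroid `(A, B, C, S_B, S_C, Δ_B, Δ_C)`; the comultiplications are those of `left` and
`right`.  The algebra `A` is non-degenerate and idempotent by the conditions in `left` and `right`. -/
structure MultiplierBialgebroid (A : Type*)
    [NonUnitalRing A] [Module ℂ A] [IsScalarTower ℂ A A] [SMulCommClass ℂ A A] where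
  B : NonUnitalSubalgebra ℂ (Multiplier A)
  C : NonUnitalSubalgebra ℂ (Multiplier A)
  SB : B ≃ₗ[ℂ] C
  SC : C ≃ₗ[ℂ] B
  SB_mul : ∀ x x', SB (x * x') = SB x' * SB x
  SC_mul : ∀ y y', SC (y * y') = SC y' * SC y
  left : LeftMultiplierBialgebroid A B
  right : RightMultiplierBialgebroid A C
  left_s : ∀ x : B, left.s x = x
  left_t : ∀ x : B, left.t x = SB x
  right_s : ∀ y : C, right.s y = y
  right_t : ∀ y : C, right.t y = SC y
  /-- `(Δ_B ⊗ id)((1 ⊗ c)Δ_C(b)) (a ⊗ 1 ⊗ 1) = (1 ⊗ 1 ⊗ c) (id ⊗ Δ_C)(Δ_B(b)(a ⊗ 1))` -/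
  mixed₁ : CommuteOnLegs left.preTlam right.preTrho
  /-- `(a ⊗ 1 ⊗ 1) (Δ_C ⊗ id)(Δ_B(b)(1 ⊗ c)) = (id ⊗ Δ_B)((a ⊗ 1)Δ_C(b)) (1 ⊗ 1 ⊗ c)` -/
  mixed₂ : CommuteOnLegs right.preTlam left.preTrho

namespace MultiplierBialgebroid

section General

variable {A : Type*} [NonUnitalRing A] [Module ℂ A] [IsScalarTower ℂ A A] [SMulCommClass ℂ A A]
  (𝒜 : MultiplierBialgebroid A)

/-- A multiplier bialgebroid is a regular multiplier Hopf algebroid if its four canonical maps are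
bijective and if `S_B(I) A = A`, `I' A = A`, `A S_C(J) = A`, `A J' = A`, where `I`, `I'`, `J`, `J'` are
spanned by the values of the module maps from `A` to `B` or `C` that are homogeneous with respect to left
multiplication by `B`, left multiplication along `S_B`, right multiplication by `C`, right multiplication
along `S_C`, respectively. -/
structure IsRegularHopf : Prop where
  full_B_left : Submodule.span ℂ {c : A | ∃ (ω : A →ₗ[ℂ] 𝒜.B) (a b : A),
    (∀ (x : 𝒜.B) (a : A), ω ((x : Multiplier A).l a) = x * ω a) ∧
      c = (𝒜.SB (ω a) : Multiplier A).l b} = ⊤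
  full_B_right : Submodule.span ℂ {c : A | ∃ (ω : A →ₗ[ℂ] 𝒜.B) (a b : A),
    (∀ (x : 𝒜.B) (a : A), ω ((𝒜.SB x : Multiplier A).l a) = ω a * x) ∧
      c = (ω a : Multiplier A).l b} = ⊤
  full_C_right : Submodule.span ℂ {c : A | ∃ (ω : A →ₗ[ℂ] 𝒜.C) (a b : A),
    (∀ (y : 𝒜.C) (a : A), ω ((y : Multiplier A).r a) = ω a * y) ∧
      c = (𝒜.SC (ω a) : Multiplier A).r b} = ⊤
  full_C_left : Submodule.span ℂ {c : A | ∃ (ω : A →ₗ[ℂ] 𝒜.C) (a b : A),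
    (∀ (y : 𝒜.C) (a : A), ω ((𝒜.SC y : Multiplier A).r a) = y * ω a) ∧
      c = (ω a : Multiplier A).r b} = ⊤
  left_Tlam : Function.Bijective 𝒜.left.Tlam
  left_Trho : Function.Bijective 𝒜.left.Trho
  right_Tlam : Function.Bijective 𝒜.right.Tlam
  right_Trho : Function.Bijective 𝒜.right.Trho

/-- An invertible antipode: an anti-automorphism `S` of `A` with
`S(x y a x' y') = S_C(y') S_B(x') S(a) S_C(y) S_B(x)` for which there are a left counit `ε_B` and a right
counit `ε_C` such that `m (S ⊗ id) (Δ_B(a)(1 ⊗ b)) = S_C(ε_C(a)) b` and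
`m (id ⊗ S) ((a ⊗ 1)Δ_C(b)) = a S_B(ε_B(b))`.  The maps `m (S ⊗ id)` and `m (id ⊗ S)` are evaluated on
representatives in `A ⊗ A`. -/
structure IsInvertibleAntipode (S : A ≃ₗ[ℂ] A) : Prop where
  map_mul : ∀ a b, S (a * b) = S b * S a
  bimodule : ∀ (x x' : 𝒜.B) (y y' : 𝒜.C) (a : A),
    S ((x : Multiplier A).l ((y : Multiplier A).l
        ((y' : Multiplier A).r ((x' : Multiplier A).r a)))) =
      (𝒜.SC y' : Multiplier A).l ((𝒜.SB x' : Multiplier A).l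
        ((𝒜.SB x : Multiplier A).r ((𝒜.SC y : Multiplier A).r (S a))))
  counits : ∃ (εB : A →ₗ[ℂ] 𝒜.B) (εC : A →ₗ[ℂ] 𝒜.C),
    𝒜.left.IsCounit εB ∧ 𝒜.right.IsCounit εC ∧
    (∀ (a b : A) (n : ℕ) (c d : Fin n → A),
      𝒜.left.preTrho a b = ∑ i, 𝒜.left.sys.tmul (c i) (d i) →
        ∑ i, S (c i) * d i = (𝒜.SC (εC a) : Multiplier A).l b) ∧
    (∀ (a b : A) (n : ℕ) (c d : Fin n → A),
      𝒜.right.preTlam a b = ∑ i, 𝒜.right.sys.tmul (c i) (d i) →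
        ∑ i, c i * S (d i) = (𝒜.SB (εB b) : Multiplier A).r a)

end General

/-- A multiplier bialgebroid over a unital algebra `A` is unital if `B` and `C` contain the unit of
`M(A) = A` and the comultiplications are unital. -/
structure IsUnital {A : Type*} [Ring A] [Algebra ℂ A] (𝒜 : MultiplierBialgebroid A) : Prop where
  one_mem_B : 1 ∈ 𝒜.B
  one_mem_C : 1 ∈ 𝒜.C
  Δ_left_one : (𝒜.left.Δ 1).1 = 1
  Δ_right_one : (𝒜.right.Δ 1).1 = 1

end MultiplierBialgebroid

/-! ### Hopf algebroids -/

section Unital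

variable {H L : Type*} [Ring H] [Algebra ℂ H] [Ring L] [Algebra ℂ L]

/-- `H ⊗_L H` for the `L`-bimodule structure `l h l' = s(l) t(l') h`: the tensor product modulo
`t(l) h ⊗ h' = h ⊗ s(l) h'`. -/
abbrev LeftBimoduleTensor (s : L →ₐ[ℂ] H) (t : Lᵐᵒᵖ →ₐ[ℂ] H) : Type _ :=
  Bal (fun l : L => LinearMap.mulLeft ℂ (t (.op l))) (fun l : L => LinearMap.mulLeft ℂ (s l))

/-- `H ⊗_R H` for the `R`-bimodule structure `r h r' = h s(r') t(r)`: the tensor product modulo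
`h s(r) ⊗ h' = h ⊗ h' t(r)`. -/
abbrev RightBimoduleTensor (s : L →ₐ[ℂ] H) (t : Lᵐᵒᵖ →ₐ[ℂ] H) : Type _ :=
  Bal (fun l : L => LinearMap.mulRight ℂ (s l)) (fun l : L => LinearMap.mulRight ℂ (t (.op l)))

end Unital

/-- A left bialgebroid over `L`: an `L ⊗ Lᵒᵖ`-ring `(H, s, t)` and an `L`-coring `(H, Δ, ε)` for the
bimodule structure `l h l' = s(l) t(l') h` such that `Δ` is a unital homomorphism into the Takeuchi
product and `ε` is unital with `ε(g s(ε(h))) = ε(g h) = ε(g t(ε(h)))`.  Conditions on `Δ(h)` are stated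
for all representatives in `H ⊗ H`. -/
structure LeftBialgebroid (H L : Type*) [Ring H] [Algebra ℂ H] [Ring L] [Algebra ℂ L] where
  s : L →ₐ[ℂ] H
  t : Lᵐᵒᵖ →ₐ[ℂ] H
  comm : ∀ l l', Commute (s l) (t l')
  Δ : H →ₗ[ℂ] LeftBimoduleTensor s t
  ε : H →ₗ[ℂ] L
  /-- `Δ` and `ε` are bimodule maps -/
  Δ_bimod : ∀ (l l' : L) (h : H) (w : H ⊗[ℂ] H), Bal.mk _ _ w = Δ h →
    Bal.mk _ _ ((s l ⊗ₜ[ℂ] t (.op l')) * w) = Δ (s l * t (.op l') * h)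
  ε_bimod : ∀ (l l' : L) (h : H), ε (s l * t (.op l') * h) = l * ε h * l'
  coassoc : Coassociative Δ Δ
  /-- `s(ε(h₁)) h₂ = h = t(ε(h₂)) h₁` -/
  counit_left : ∀ (h : H) (n : ℕ) (c d : Fin n → H), Δ h = ∑ i, Bal.tmul _ _ (c i) (d i) →
    ∑ i, s (ε (c i)) * d i = h
  counit_right : ∀ (h : H) (n : ℕ) (c d : Fin n → H), Δ h = ∑ i, Bal.tmul _ _ (c i) (d i) →
    ∑ i, t (.op (ε (d i))) * c i = h
  /-- `h₁ t(l) ⊗ h₂ = h₁ ⊗ h₂ s(l)` -/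
  takeuchi : ∀ (l : L) (h : H) (w : H ⊗[ℂ] H), Bal.mk _ _ w = Δ h →
    Bal.mk (fun l : L => LinearMap.mulLeft ℂ (t (.op l))) (fun l : L => LinearMap.mulLeft ℂ (s l))
      (w * (t (.op l) ⊗ₜ[ℂ] 1)) = Bal.mk _ _ (w * (1 ⊗ₜ[ℂ] s l))
  Δ_one : Δ 1 = Bal.tmul _ _ 1 1
  Δ_mul : ∀ (g h : H) (v w : H ⊗[ℂ] H), Bal.mk _ _ v = Δ g → Bal.mk _ _ w = Δ h →
    Δ (g * h) = Bal.mk _ _ (v * w)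
  ε_one : ε 1 = 1
  ε_mul_s : ∀ g h, ε (g * s (ε h)) = ε (g * h)
  ε_mul_t : ∀ g h, ε (g * t (.op (ε h))) = ε (g * h)

/-- A right bialgebroid over `R`: an `R ⊗ Rᵒᵖ`-ring `(H, s, t)` and an `R`-coring `(H, Δ, ε)` for the
bimodule structure `r h r' = h s(r') t(r)` such that `Δ` is a unital homomorphism into the Takeuchi
product and `ε` is unital with `ε(s(ε(g)) h) = ε(g h) = ε(t(ε(g)) h)`. -/
structure RightBialgebroid (H R : Type*) [Ring H] [Algebra ℂ H] [Ring R] [Algebra ℂ R] where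
  s : R →ₐ[ℂ] H
  t : Rᵐᵒᵖ →ₐ[ℂ] H
  comm : ∀ r r', Commute (s r) (t r')
  Δ : H →ₗ[ℂ] RightBimoduleTensor s t
  ε : H →ₗ[ℂ] R
  /-- `Δ` and `ε` are bimodule maps -/
  Δ_bimod : ∀ (r r' : R) (h : H) (w : H ⊗[ℂ] H), Bal.mk _ _ w = Δ h →
    Bal.mk _ _ (w * (t (.op r) ⊗ₜ[ℂ] s r')) = Δ (h * s r' * t (.op r))
  ε_bimod : ∀ (r r' : R) (h : H), ε (h * s r' * t (.op r)) = r * ε h * r'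
  coassoc : Coassociative Δ Δ
  /-- `h₂ t(ε(h₁)) = h = h₁ s(ε(h₂))` -/
  counit_left : ∀ (h : H) (n : ℕ) (c d : Fin n → H), Δ h = ∑ i, Bal.tmul _ _ (c i) (d i) →
    ∑ i, d i * t (.op (ε (c i))) = h
  counit_right : ∀ (h : H) (n : ℕ) (c d : Fin n → H), Δ h = ∑ i, Bal.tmul _ _ (c i) (d i) →
    ∑ i, c i * s (ε (d i)) = h
  /-- `s(r) h₁ ⊗ h₂ = h₁ ⊗ t(r) h₂` -/
  takeuchi : ∀ (r : R) (h : H) (w : H ⊗[ℂ] H), Bal.mk _ _ w = Δ h →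
    Bal.mk (fun l : R => LinearMap.mulRight ℂ (s l)) (fun l : R => LinearMap.mulRight ℂ (t (.op l)))
      ((s r ⊗ₜ[ℂ] 1) * w) = Bal.mk _ _ ((1 ⊗ₜ[ℂ] t (.op r)) * w)
  Δ_one : Δ 1 = Bal.tmul _ _ 1 1
  Δ_mul : ∀ (g h : H) (v w : H ⊗[ℂ] H), Bal.mk _ _ v = Δ g → Bal.mk _ _ w = Δ h →
    Δ (g * h) = Bal.mk _ _ (v * w)
  ε_one : ε 1 = 1
  ε_mul_s : ∀ g h, ε (s (ε g) * h) = ε (g * h)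
  ε_mul_t : ∀ g h, ε (t (.op (ε g)) * h) = ε (g * h)

/-- A Hopf algebroid `(H_L, H_R, S)` over the base algebras `L` and `R`. -/
structure HopfAlgebroid (H L R : Type*) [Ring H] [Algebra ℂ H] [Ring L] [Algebra ℂ L]
    [Ring R] [Algebra ℂ R] where
  left : LeftBialgebroid H L
  right : RightBialgebroid H R
  S : H →ₗ[ℂ] H
  sL_εL_tR : ∀ r : R, left.s (left.ε (right.t (.op r))) = right.t (.op r)
  tL_εL_sR : ∀ r : R, left.t (.op (left.ε (right.s r))) = right.s r
  sR_εR_tL : ∀ l : L, right.s (right.ε (left.t (.op l))) = left.t (.op l)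
  tR_εR_sL : ∀ l : L, right.t (.op (right.ε (left.s l))) = left.s l
  /-- `(Δ_L ⊗_R H) Δ_R = (H ⊗_L Δ_R) Δ_L` -/
  mixed₁ : Coassociative left.Δ right.Δ
  /-- `(Δ_R ⊗_L H) Δ_L = (H ⊗_R Δ_L) Δ_R` -/
  mixed₂ : Coassociative right.Δ left.Δ
  S_bimod : ∀ (l : L) (r : R) (h : H),
    S (left.t (.op l) * h * right.t (.op r)) = right.s r * S h * left.s l
  /-- `S(h₁) h₂ = s_R(ε_R(h))` for `Δ_L(h) = h₁ ⊗ h₂` -/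
  antipode_left : ∀ (h : H) (n : ℕ) (c d : Fin n → H),
    left.Δ h = ∑ i, Bal.tmul _ _ (c i) (d i) → ∑ i, S (c i) * d i = right.s (right.ε h)
  /-- `h₁ S(h₂) = s_L(ε_L(h))` for `Δ_R(h) = h₁ ⊗ h₂` -/
  antipode_right : ∀ (h : H) (n : ℕ) (c d : Fin n → H),
    right.Δ h = ∑ i, Bal.tmul _ _ (c i) (d i) → ∑ i, c i * S (d i) = left.s (left.ε h)

/-! ### The passage from unital multiplier bialgebroids to bialgebroids -/

namespace MultiplierBialgebroid

variable {A : Type*} [Ring A] [Algebra ℂ A] {𝒜 : MultiplierBialgebroid A}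

/-- The unital algebra `L = Bᵒᵖ` of a unital multiplier bialgebroid. -/
abbrev IsUnital.L (hu : 𝒜.IsUnital) : Type _ := (𝒜.B.toSubalgebra hu.one_mem_B)ᵐᵒᵖ

/-- The unital algebra `R = Cᵒᵖ` of a unital multiplier bialgebroid. -/
abbrev IsUnital.R (hu : 𝒜.IsUnital) : Type _ := (𝒜.C.toSubalgebra hu.one_mem_C)ᵐᵒᵖ

/-- The left bialgebroid `𝓛` is the one associated with `(A, B, id, S_B, Δ_B)` and the left counit `εB`,
where `M(A)` is identified with `A` via `T ↦ T 1` and `L` with `Bᵒᵖ` via `φ`: one has `t_L(x) = x`,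
`s_L(x) = S_B(x)`, `ε_L = εB` and `Δ_L(a) = Δ_B(a)(1 ⊗ 1)`.  Both sides of the last equation are classes
of elements of `A ⊗ A`, and they are required to have the same representatives. -/
structure IsUnital.IsAssociatedLeft (hu : 𝒜.IsUnital) (εB : A →ₗ[ℂ] 𝒜.B)
    {L : Type*} [Ring L] [Algebra ℂ L] (φ : L ≃ₐ[ℂ] hu.L) (𝓛 : LeftBialgebroid A L) : Prop where
  target : ∀ l : L, 𝓛.t (.op l) = Multiplier.l (φ l).unop.1 1
  source : ∀ (l : L) (x : 𝒜.B), (x : Multiplier A) = (φ l).unop.1 →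
    𝓛.s l = Multiplier.l (𝒜.SB x : Multiplier A) 1
  counit : ∀ a : A, ((φ (𝓛.ε a)).unop.1 : Multiplier A) = εB a
  comul : ∀ (a : A) (w : A ⊗[ℂ] A),
    Bal.mk _ _ w = 𝓛.Δ a ↔ Bal.mk _ _ w = (𝒜.left.Δ a).1 (𝒜.left.sys.tmul 1 1)

/-- The right bialgebroid `𝓡` is the one associated with `(A, C, id, S_C, Δ_C)` and the right counit `εC`:
one has `t_R(y) = y`, `s_R(y) = S_C(y)`, `ε_R = εC` and `Δ_R(a) = (1 ⊗ 1)Δ_C(a)`. -/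
structure IsUnital.IsAssociatedRight (hu : 𝒜.IsUnital) (εC : A →ₗ[ℂ] 𝒜.C)
    {R : Type*} [Ring R] [Algebra ℂ R] (ψ : R ≃ₐ[ℂ] hu.R) (𝓡 : RightBialgebroid A R) : Prop where
  target : ∀ r : R, 𝓡.t (.op r) = Multiplier.r (ψ r).unop.1 1
  source : ∀ (r : R) (y : 𝒜.C), (y : Multiplier A) = (ψ r).unop.1 →
    𝓡.s r = Multiplier.r (𝒜.SC y : Multiplier A) 1
  counit : ∀ a : A, ((ψ (𝓡.ε a)).unop.1 : Multiplier A) = εC a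
  comul : ∀ (a : A) (w : A ⊗[ℂ] A),
    Bal.mk _ _ w = 𝓡.Δ a ↔ Bal.mk _ _ w = (𝒜.right.Δ a).1 (𝒜.right.sys.tmul 1 1)

end MultiplierBialgebroid

end MultHopf

open MultHopf

universe u v w

/-! For unital `A` one has `M(A) = A`, and a multiplier of a balanced tensor product is determined
by its value at `1 ⊗ 1`. So `Δ_B` and `Δ_C` are ordinary comultiplications with values in quotients
of `A ⊗ A`, and both kinds of structure in the theorem can be encoded by the same data. `Comult` is
a one-sided comultiplication; the right-handed structures are instances of it for the opposite
multiplication, and `BiComult` is a compatible pair. Identities in quotients are expressed by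
Sweedler sums `sw` over representatives and tested on balanced functions, so that they do not depend
on how a quotient is presented. The structures `Realizes` and `Over` are the dictionaries to
multiplier bialgebroids and to bialgebroids, and the mathematics takes place in `Comult` and
`BiComult`.

In (1), bijectivity of `p ⊗ q ↦ d(p)(1 ⊗ q)` supplies an element `κ(a) = p ⊗ q`, the preimage of `a
⊗ 1` (`Translation`). In a Hopf algebroid this would be `a₁ ⊗ S(a₂)` with respect to the right
comultiplication; its formal properties can be proved before an antipode is available. The product
`E(a) = p q` plays the role of `a₁ S(a₂) = S_B(ε_B(a))`: one has `u ⊗ E(v) = a ⊗ 1` for `d(a) = u ⊗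
v` (`comul_E`), and fullness forces `E(a)` into the base algebra (`E_mem_range`). Each canonical map
thereby yields half of the counit axioms, and the two halves fit together (`exists_counit`). Every
counit satisfies `b' ε = E`, which gives uniqueness and the identities for `ε(a b)` that a
bialgebroid requires.

Applying the right counit `η` to the first leg of `κ` gives `S(a) = c(η(p)) q`, where `c` is the map
`b` of the right comultiplication. Every antipode has this form (`eq_sw`), and the formula defines
one (`exists_antipode`) because `κ` is compatible with the right comultiplication (`comul_κ`). The
rule for `κ(a a')` makes `S` anti-multiplicative (`map_m`), and the antipode of the co-opposite pair
is the inverse of `S` (`leftInverse`).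

In (2) the argument is reversed: `(id ⊗ S) Δ_R` inverts the canonical map
(`IsAntipode.translation`). This first yields anti-multiplicativity of `S`, which is not an axiom.
It follows that `S⁻¹` is an antipode of the co-opposite, and passing to opposites and co-opposites
makes all four canonical maps bijective (`nonempty_translations`). Fullness is clear because counits
are unital. For `B` and `C` one takes the images of `t_L` and `t_R`. -/

namespace MultHopf

/-! ### Sweedler sums and balanced functions -/

section Sweedler

variable {V : Type u} [AddCommGroup V] [Module ℂ V]
variable {W W' : Type*} [AddCommGroup W] [Module ℂ W] [AddCommGroup W'] [Module ℂ W']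

/-- The sum of `f p q` over the terms `p ⊗ q` of a chosen representation of a tensor as a sum of
elementary tensors. -/
noncomputable def sw (t : V ⊗[ℂ] V) (f : V → V → W) : W :=
  ((TensorProduct.exists_multiset t).choose.map fun p => f p.1 p.2).sum

theorem map_sw (l : W →ₗ[ℂ] W') (t : V ⊗[ℂ] V) (f : V → V → W) :
    l (sw t f) = sw t fun p q => l (f p q) := by
  simp [sw, map_multiset_sum, Multiset.map_map]

-- Both sides are finite sums over two fixed multisets, so no linearity is needed.
omit [Module ℂ W] in
theorem sw_comm (s t : V ⊗[ℂ] V) (f : V → V → V → V → W) :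
    (sw s fun p q => sw t fun p' q' => f p q p' q') =
      sw t fun p' q' => sw s fun p q => f p q p' q' :=
  Multiset.sum_map_sum_map _ _

omit [Module ℂ W] in
@[simp]
theorem sw_fun_add (t : V ⊗[ℂ] V) (f g : V → V → W) :
    (sw t fun p q => f p q + g p q) = sw t f + sw t g := by
  simp [sw]

@[simp]
theorem sw_fun_smul (t : V ⊗[ℂ] V) (r : ℂ) (f : V → V → W) :
    (sw t fun p q => r • f p q) = r • sw t f :=
  (map_sw (LinearMap.lsmul ℂ W r) t f).symm

/-- For bilinear summands the chosen representation no longer matters. This is the only place where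
the defining property of that choice is used. -/
theorem sw_lift (t : V ⊗[ℂ] V) (φ : V →ₗ[ℂ] V →ₗ[ℂ] W) :
    (sw t fun p q => φ p q) = TensorProduct.lift φ t := by
  conv_rhs => rw [(TensorProduct.exists_multiset t).choose_spec]
  simp [sw, map_multiset_sum, Multiset.map_map, Function.comp_def]

/-- Bilinearity of a function of two variables. -/
structure IsBil (φ : V → V → W) : Prop where
  add_left : ∀ u u' v, φ (u + u') v = φ u v + φ u' v
  smul_left : ∀ (r : ℂ) u v, φ (r • u) v = r • φ u v
  add_right : ∀ u v v', φ u (v + v') = φ u v + φ u v'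
  smul_right : ∀ (r : ℂ) u v, φ u (r • v) = r • φ u v

namespace IsBil

variable {φ : V → V → W}

/-- The bundled form of a bilinear function. -/
def toLin (h : IsBil φ) : V →ₗ[ℂ] V →ₗ[ℂ] W :=
  LinearMap.mk₂ ℂ φ h.add_left h.smul_left h.add_right h.smul_right

theorem sw_eq (h : IsBil φ) (t : V ⊗[ℂ] V) : sw t φ = TensorProduct.lift h.toLin t :=
  sw_lift t h.toLin

theorem sw_add (h : IsBil φ) (s t : V ⊗[ℂ] V) : sw (s + t) φ = sw s φ + sw t φ := by
  simp [h.sw_eq]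

theorem sw_smul (h : IsBil φ) (r : ℂ) (t : V ⊗[ℂ] V) : sw (r • t) φ = r • sw t φ := by
  simp [h.sw_eq]

theorem sw_tmul (h : IsBil φ) (u v : V) : sw (u ⊗ₜ[ℂ] v) φ = φ u v := by
  simp [h.sw_eq, toLin]

theorem sw_sw (h : IsBil φ) (t : V ⊗[ℂ] V) (F : V → V → V ⊗[ℂ] V) :
    sw (sw t F) φ = sw t fun p q => sw (F p q) φ := by
  simp only [h.sw_eq, map_sw]

theorem sw_sw_tmul (h : IsBil φ) (t : V ⊗[ℂ] V) (F G : V → V → V) :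
    sw (sw t fun p q => F p q ⊗ₜ[ℂ] G p q) φ = sw t fun p q => φ (F p q) (G p q) := by
  rw [h.sw_sw]; simp only [h.sw_tmul]

theorem flip (h : IsBil φ) : IsBil fun u v => φ v u :=
  ⟨fun _ _ _ => h.add_right _ _ _, fun _ _ _ => h.smul_right _ _ _,
    fun _ _ _ => h.add_left _ _ _, fun _ _ _ => h.smul_left _ _ _⟩

theorem sw_swap (h : IsBil φ) (t : V ⊗[ℂ] V) :
    sw (TensorProduct.comm ℂ V V t) φ = sw t fun u v => φ v u := by
  rw [h.sw_eq, h.flip.sw_eq, ← LinearEquiv.coe_coe, ← LinearMap.comp_apply]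
  congr 1
  ext; rfl

theorem sw_map (h : IsBil φ) (l : V →ₗ[ℂ] V) (t : V ⊗[ℂ] V) :
    sw (TensorProduct.map LinearMap.id l t) φ = sw t fun u v => φ u (l v) := by
  have h' : IsBil fun u v => φ u (l v) := ⟨fun _ _ _ => h.add_left _ _ _,
    fun _ _ _ => h.smul_left _ _ _, fun _ _ _ => by rw [map_add, h.add_right],
    fun _ _ _ => by rw [map_smul, h.smul_right]⟩
  rw [h.sw_eq, h'.sw_eq, ← LinearMap.comp_apply]
  congr 1
  ext; rfl

theorem comp {F G : V → V} (h : IsBil φ) (hF : IsLinearMap ℂ F) (hG : IsLinearMap ℂ G) :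
    IsBil fun u v => φ (F u) (G v) := by
  constructor <;> intros <;>
    simp [hF.map_add, hF.map_smul, hG.map_add, hG.map_smul, h.add_left, h.add_right, h.smul_left,
      h.smul_right]

end IsBil

theorem isBil_tmul : IsBil fun u v : V => u ⊗ₜ[ℂ] v :=
  ⟨fun _ _ _ => TensorProduct.add_tmul _ _ _, fun _ _ _ => rfl,
    fun _ _ _ => TensorProduct.tmul_add _ _ _, fun _ _ _ => TensorProduct.tmul_smul _ _ _⟩

theorem sw_tmul_self (t : V ⊗[ℂ] V) : (sw t fun u v => u ⊗ₜ[ℂ] v) = t := by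
  have h := sw_lift t (TensorProduct.mk ℂ V V)
  rw [show TensorProduct.lift (TensorProduct.mk ℂ V V) = LinearMap.id from by ext; rfl] at h
  exact h

variable {X Y : Type*}

/-- Bilinear functions `φ` with `φ (F x u) v = φ u (G x v)`. -/
structure IsBal (F G : X → V → V) (φ : V → V → W) : Prop extends IsBil φ where
  bal : ∀ x u v, φ (F x u) v = φ u (G x v)

theorem IsBal.flip {F G : X → V → V} {φ : V → V → W} (h : IsBal F G φ) :
    IsBal G F fun u v => φ v u :=
  ⟨h.toIsBil.flip, fun _ _ _ => (h.bal _ _ _).symm⟩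

/-- Trilinear functions that are balanced in the first two and in the last two variables. -/
structure IsTri (F G : X → V → V) (F' G' : Y → V → V) (χ : V → V → V → W) : Prop where
  fst : ∀ w, IsBal F G fun u v => χ u v w
  snd : ∀ u, IsBal F' G' (χ u)

theorem IsTri.flip {F G : X → V → V} {F' G' : Y → V → V} {χ : V → V → V → W}
    (h : IsTri F G F' G' χ) : IsTri G' F' G F fun u v w => χ w v u :=
  ⟨fun w => (h.snd w).flip, fun u => (h.fst u).flip⟩

end Sweedler

end MultHopf

/-! ### Comultiplications on unital algebras and their co-opposites -/

namespace MultHopf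

/-- A unital algebra `V` with multiplication `m`, a homomorphism `b` and an anti-homomorphism `b'` into it
with commuting images. -/
structure BasedAlgebra (V : Type u) (X : Type v) [AddCommGroup V] [Module ℂ V] [AddCommGroup X]
    [Module ℂ X] where
  m : V →ₗ[ℂ] V →ₗ[ℂ] V
  e : V
  assoc : ∀ u v w, m (m u v) w = m u (m v w)
  e_m : ∀ u, m e u = u
  m_e : ∀ u, m u e = u
  b : X →ₗ[ℂ] V
  b' : X →ₗ[ℂ] V
  μ : X → X → X
  o : X
  b_inj : Function.Injective b
  b'_inj : Function.Injective b'
  b_o : b o = e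
  b'_o : b' o = e
  b_μ : ∀ x y, b (μ x y) = m (b x) (b y)
  b'_μ : ∀ x y, b' (μ x y) = m (b' y) (b' x)
  b_comm : ∀ x y, m (b x) (b' y) = m (b' y) (b x)

/-- A multiplicative coassociative comultiplication `d` with values in `V ⊗ V` modulo
`b x u ⊗ v = u ⊗ b' x v`, given by representatives.  All identities are tested against
balanced bilinear or trilinear functions. -/
structure Comult (V : Type u) (X : Type v) [AddCommGroup V] [Module ℂ V] [AddCommGroup X]
    [Module ℂ X] extends BasedAlgebra V X where
  d : V →ₗ[ℂ] V ⊗[ℂ] V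
  d_e : ∀ {W : Type u} [AddCommGroup W] [Module ℂ W] {φ : V → V → W},
    IsBal (fun x u => m (b x) u) (fun x u => m (b' x) u) φ → sw (d e) φ = φ e e
  d_m : ∀ {W : Type u} [AddCommGroup W] [Module ℂ W] {φ : V → V → W},
    IsBal (fun x u => m (b x) u) (fun x u => m (b' x) u) φ → ∀ a a', sw (d (m a a')) φ =
      sw (d a) fun u v => sw (d a') fun u' v' => φ (m u u') (m v v')
  takeuchi : ∀ {W : Type u} [AddCommGroup W] [Module ℂ W] {φ : V → V → W},
    IsBal (fun x u => m (b x) u) (fun x u => m (b' x) u) φ → ∀ a x,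
      (sw (d a) fun u v => φ (m u (b x)) v) = sw (d a) fun u v => φ u (m v (b' x))
  d_bl : ∀ {W : Type u} [AddCommGroup W] [Module ℂ W] {φ : V → V → W},
    IsBal (fun x u => m (b x) u) (fun x u => m (b' x) u) φ → ∀ x a,
      sw (d (m (b x) a)) φ = sw (d a) fun u v => φ u (m (b x) v)
  d_b'l : ∀ {W : Type u} [AddCommGroup W] [Module ℂ W] {φ : V → V → W},
    IsBal (fun x u => m (b x) u) (fun x u => m (b' x) u) φ → ∀ x a,
      sw (d (m (b' x) a)) φ = sw (d a) fun u v => φ (m (b' x) u) v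
  d_br : ∀ {W : Type u} [AddCommGroup W] [Module ℂ W] {φ : V → V → W},
    IsBal (fun x u => m (b x) u) (fun x u => m (b' x) u) φ → ∀ x a,
      sw (d (m a (b x))) φ = sw (d a) fun u v => φ u (m v (b x))
  d_b'r : ∀ {W : Type u} [AddCommGroup W] [Module ℂ W] {φ : V → V → W},
    IsBal (fun x u => m (b x) u) (fun x u => m (b' x) u) φ → ∀ x a,
      sw (d (m a (b' x))) φ = sw (d a) fun u v => φ (m u (b' x)) v
  coassoc : ∀ {W : Type u} [AddCommGroup W] [Module ℂ W] {χ : V → V → V → W},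
    IsTri (fun x u => m (b x) u) (fun x u => m (b' x) u) (fun x u => m (b x) u)
      (fun x u => m (b' x) u) χ → ∀ a,
      (sw (d a) fun u v => sw (d u) fun u' u'' => χ u' u'' v) =
        sw (d a) fun u v => sw (d v) fun v' v'' => χ u v' v''

namespace Comult

variable {V : Type u} {X : Type v} [AddCommGroup V] [Module ℂ V] [AddCommGroup X] [Module ℂ X]
  (D : Comult V X) {W : Type u} [AddCommGroup W] [Module ℂ W]

/-- Functions balanced like the target of `d`. -/
abbrev LBal (φ : V → V → W) : Prop :=
  IsBal (fun x u => D.m (D.b x) u) (fun x u => D.m (D.b' x) u) φ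

/-- Functions `ψ` with `ψ (u b(x)) v = ψ u (b(x) v)`. -/
abbrev MBal (ψ : V → V → W) : Prop :=
  IsBal (fun x u => D.m u (D.b x)) (fun x u => D.m (D.b x) u) ψ

theorem sw_m (t : V ⊗[ℂ] V) (f : V → V → V) (q : V) :
    D.m (sw t f) q = sw t fun u v => D.m (f u v) q :=
  map_sw (D.m.flip q) t f

theorem m_sw (t : V ⊗[ℂ] V) (f : V → V → V) (q : V) :
    D.m q (sw t f) = sw t fun u v => D.m q (f u v) :=
  map_sw (D.m q) t f

/-- The co-opposite: the roles of `b` and `b'` are exchanged. -/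
noncomputable def cop : Comult V X where
  m := D.m
  e := D.e
  assoc := D.assoc
  e_m := D.e_m
  m_e := D.m_e
  b := D.b'
  b' := D.b
  μ x y := D.μ y x
  o := D.o
  b_o := D.b'_o
  b'_o := D.b_o
  b_inj := D.b'_inj
  b'_inj := D.b_inj
  b_μ _ _ := D.b'_μ _ _
  b'_μ _ _ := D.b_μ _ _
  b_comm _ _ := (D.b_comm _ _).symm
  d := (TensorProduct.comm ℂ V V).toLinearMap ∘ₗ D.d
  d_e h := by
    simp only [LinearMap.comp_apply, LinearEquiv.coe_coe, h.sw_swap, D.d_e h.flip]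
  d_m h a a' := by
    simp only [LinearMap.comp_apply, LinearEquiv.coe_coe, h.sw_swap, D.d_m h.flip]
    have h1 : ∀ t : V ⊗[ℂ] V, ∀ u v,
        (sw (TensorProduct.comm ℂ V V t) fun u' v' => _) = sw t fun u' v' => _ := fun t u v =>
      IsBil.sw_swap (h.toIsBil.comp (F := D.m u) (G := D.m v) (D.m u).isLinear (D.m v).isLinear) t
    simp only [h1]
    rw [IsBil.sw_swap]
    constructor <;> intros <;> simp [h.add_left, h.add_right, h.smul_left, h.smul_right]
  takeuchi h a x := by
    have h1 := h.toIsBil.comp (F := fun u => D.m u (D.b' x)) (G := id) (D.m.flip _).isLinear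
      LinearMap.id.isLinear
    have h2 := h.toIsBil.comp (G := fun u => D.m u (D.b x)) (F := id) LinearMap.id.isLinear
      (D.m.flip _).isLinear
    exact (h1.sw_swap _).trans ((D.takeuchi h.flip a x).symm.trans (h2.sw_swap _).symm)
  d_bl h x a := by
    have h2 := h.toIsBil.comp (G := fun u => D.m (D.b' x) u) (F := id) LinearMap.id.isLinear
      (D.m _).isLinear
    exact (h.sw_swap _).trans ((D.d_b'l h.flip x a).trans (h2.sw_swap _).symm)
  d_b'l h x a := by
    have h2 := h.toIsBil.comp (F := fun u => D.m (D.b x) u) (G := id) (D.m _).isLinear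
      LinearMap.id.isLinear
    exact (h.sw_swap _).trans ((D.d_bl h.flip x a).trans (h2.sw_swap _).symm)
  d_br h x a := by
    have h2 := h.toIsBil.comp (G := fun u => D.m u (D.b' x)) (F := id) LinearMap.id.isLinear
      (D.m.flip _).isLinear
    exact (h.sw_swap _).trans ((D.d_b'r h.flip x a).trans (h2.sw_swap _).symm)
  d_b'r h x a := by
    have h2 := h.toIsBil.comp (F := fun u => D.m u (D.b x)) (G := id) (D.m.flip _).isLinear
      LinearMap.id.isLinear
    exact (h.sw_swap _).trans ((D.d_br h.flip x a).trans (h2.sw_swap _).symm)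
  coassoc {W} _ _ χ h a := by
    have h1 : ∀ t v, (sw (TensorProduct.comm ℂ V V t) fun u' u'' => χ u' u'' v) =
      sw t fun u' u'' => χ u'' u' v := fun t v => (h.fst v).sw_swap t
    have h2 : ∀ t u, (sw (TensorProduct.comm ℂ V V t) fun v' v'' => χ u v' v'') =
      sw t fun v' v'' => χ u v'' v' := fun t u => (h.snd u).sw_swap t
    simp only [LinearMap.comp_apply, LinearEquiv.coe_coe, h1, h2]
    rw [IsBil.sw_swap, IsBil.sw_swap]
    · exact (D.coassoc h.flip a).symm
    · constructor <;> intros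
      · simp [(h.fst _).add_left]
      · simp [(h.fst _).smul_left]
      · rw [map_add, (h.snd _).flip.sw_add]
      · rw [map_smul, (h.snd _).flip.sw_smul]
    · constructor <;> intros
      · rw [map_add, (h.fst _).flip.sw_add]
      · rw [map_smul, (h.fst _).flip.sw_smul]
      · simp [(h.snd _).add_right]
      · simp [(h.snd _).smul_right]

/-- The flip of `V ⊗ V` is an involution, so this is an equality of structures. Statements about `D`
can be transported along it to the double co-opposite. -/
theorem cop_cop : D.cop.cop = D := by
  have h : (TensorProduct.comm ℂ V V).toLinearMap ∘ₗ (TensorProduct.comm ℂ V V).toLinearMap ∘ₗ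
      D.d = D.d := by ext; simp
  rcases D with ⟨⟨⟩, d⟩
  simp only [cop] at h ⊢
  congr 1

theorem cop_m : D.cop.m = D.m := rfl

theorem cop_e : D.cop.e = D.e := rfl

theorem cop_b : D.cop.b = D.b' := rfl

theorem cop_b' : D.cop.b' = D.b := rfl

theorem cop_μ (x y : X) : D.cop.μ x y = D.μ y x := rfl

theorem sw_cop_d (a : V) {φ : V → V → W} (h : IsBil φ) :
    sw (D.cop.d a) φ = sw (D.d a) fun u v => φ v u :=
  h.sw_swap _

end Comult

end MultHopf

/-! ### Inverses of canonical maps -/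

namespace MultHopf

namespace Comult

variable {V : Type u} {X : Type v} [AddCommGroup V] [Module ℂ V] [AddCommGroup X] [Module ℂ X]
  {D : Comult V X} {W : Type u} [AddCommGroup W] [Module ℂ W] {φ : V → V → W}

local notation:70 u:70 " ⋆ " v:71 => BasedAlgebra.m (Comult.toBasedAlgebra D) u v

/-- The target of `d` is balanced by left multiplications. By associativity, right multiplication in
either leg preserves balanced functions. -/
theorem LBal.mul_right (h : D.LBal φ) (q : V) : D.LBal fun u v => φ u (v ⋆ q) :=
  ⟨h.toIsBil.comp (F := id) LinearMap.id.isLinear (D.m.flip q).isLinear,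
    fun x u v => by simp only [D.assoc]; exact h.bal _ _ _⟩

theorem LBal.mul_left (h : D.LBal φ) (q : V) : D.LBal fun u v => φ (u ⋆ q) v :=
  ⟨h.toIsBil.comp (G := id) (D.m.flip q).isLinear LinearMap.id.isLinear,
    fun x u v => by simp only [D.assoc]; exact h.bal _ _ _⟩

/-- Here the commutation of the images of `b` and `b'` enters: left multiplication by `b'(x)` in the
first leg commutes with the multiplications by `b(y)` that define the balancing. -/
theorem LBal.b'_mul (h : D.LBal φ) (x : X) : D.LBal fun u v => φ (D.b' x ⋆ u) v :=
  ⟨h.toIsBil.comp (G := id) (D.m _).isLinear LinearMap.id.isLinear,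
    fun y u v => by simp only [← D.assoc, ← D.b_comm]; simp only [D.assoc]; exact h.bal _ _ _⟩

theorem LBal.b_mul (h : D.LBal φ) (x : X) : D.LBal fun u v => φ u (D.b x ⋆ v) :=
  ⟨h.toIsBil.comp (F := id) LinearMap.id.isLinear (D.m _).isLinear,
    fun y u v => by simp only [← D.assoc, D.b_comm]; simp only [D.assoc]; exact h.bal _ _ _⟩

theorem MBal.mul_right (h : D.MBal φ) (q : V) : D.MBal fun u v => φ u (v ⋆ q) :=
  ⟨h.toIsBil.comp (F := id) LinearMap.id.isLinear (D.m.flip q).isLinear,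
    fun x u v => by simp only [D.assoc]; exact h.bal _ _ _⟩

theorem isBil_canonical (h : IsBil φ) :
    IsBil fun p q => sw (D.d p) fun u v => φ u (v ⋆ q) := by
  have h' : ∀ q, IsBil fun u v => φ u (v ⋆ q) := fun q =>
    h.comp (F := id) LinearMap.id.isLinear (D.m.flip q).isLinear
  constructor <;> intros
  · rw [map_add, (h' _).sw_add]
  · rw [map_smul, (h' _).sw_smul]
  · simp [h.add_right]
  · simp [h.smul_right]

end Comult

/-- A representative `κ a` of the inverse image of `a ⊗ 1` under the canonical map
`p ⊗ q ↦ d(p) (1 ⊗ q)`, for a comultiplication for which this map is bijective. -/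
structure Translation {V : Type u} {X : Type v} [AddCommGroup V] [Module ℂ V] [AddCommGroup X]
    [Module ℂ X] (D : Comult V X) where
  κ : V →ₗ[ℂ] V ⊗[ℂ] V
  right_inv : ∀ {W : Type u} [AddCommGroup W] [Module ℂ W] {φ : V → V → W}, D.LBal φ → ∀ a,
    (sw (κ a) fun p q => sw (D.d p) fun u v => φ u (D.m v q)) = φ a D.e
  left_inv : ∀ {W : Type u} [AddCommGroup W] [Module ℂ W] {ψ : V → V → W}, D.MBal ψ → ∀ a,
    (sw (D.d a) fun u v => sw (κ u) fun p q => ψ p (D.m q v)) = ψ a D.e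
  κ_b : ∀ {W : Type u} [AddCommGroup W] [Module ℂ W] {ψ : V → V → W}, D.MBal ψ → ∀ x a,
    sw (κ (D.m (D.b x) a)) ψ = sw (κ a) fun p q => ψ p (D.m q (D.b' x))

namespace Translation

variable {V : Type u} {X : Type v} [AddCommGroup V] [Module ℂ V] [AddCommGroup X] [Module ℂ X]
  {D : Comult V X} (K : Translation D) {W : Type u} [AddCommGroup W] [Module ℂ W]

local notation:70 u:70 " ⋆ " v:71 => BasedAlgebra.m (Comult.toBasedAlgebra D) u v

variable {ψ : V → V → W}

/-- The inverse of the canonical map ought to be `u ⊗ v ↦ κ(u)(1 ⊗ v)`. The field `κ_b` is exactly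
what makes this respect the relation `b(x) u ⊗ v = u ⊗ b'(x) v`. -/
theorem lbal_κ (hψ : D.MBal ψ) : D.LBal fun u v => sw (K.κ u) fun p q => ψ p (q ⋆ v) := by
  refine ⟨⟨fun u u' v => ?_, fun r u v => ?_, ?_, ?_⟩, fun x u v => ?_⟩
  · rw [map_add, (hψ.mul_right v).sw_add]
  · rw [map_smul, (hψ.mul_right v).sw_smul]
  · simp [hψ.add_right]
  · simp [hψ.smul_right]
  · rw [K.κ_b (hψ.mul_right v)]; simp only [D.assoc]

/-- `d(p) (1 ⊗ q)` determines the class of `p ⊗ q`. -/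
theorem unique {t : V ⊗[ℂ] V} {a c : V}
    (h : ∀ φ : V → V → W, D.LBal φ →
      (sw t fun p q => sw (D.d p) fun u v => φ u (v ⋆ q)) = φ a c)
    (hψ : D.MBal ψ) : sw t ψ = sw (K.κ a) fun p q => ψ p (q ⋆ c) := by
  -- The hypothesis is tested on the function that belongs to the inverse map. Then `left_inv`
  -- collapses the sum for each term `p ⊗ q` separately.
  rw [← h _ (K.lbal_κ hψ)]
  congr 1
  funext p q
  have := K.left_inv (hψ.mul_right q) p
  simp only [D.assoc, D.e_m] at this
  exact this.symm

/-- The rules below for `κ` are obtained by guessing the value and comparing images under the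
canonical map. This form admits guesses that modify the legs of a given tensor. -/
theorem unique_sum {s : V ⊗[ℂ] V} {F G : V → V → V} {a c : V}
    (h : ∀ φ : V → V → W, D.LBal φ →
      (sw s fun p q => sw (D.d (F p q)) fun u v => φ u (v ⋆ G p q)) = φ a c)
    (hψ : D.MBal ψ) :
    (sw s fun p q => ψ (F p q) (G p q)) = sw (K.κ a) fun p q => ψ p (q ⋆ c) := by
  rw [← K.unique (t := sw s fun p q => F p q ⊗ₜ[ℂ] G p q) _ hψ, hψ.sw_sw_tmul]
  intro φ hφ
  rw [(Comult.isBil_canonical hφ.toIsBil).sw_sw_tmul]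
  exact h φ hφ

theorem κ_eq {s : V ⊗[ℂ] V} {F G : V → V → V} {a : V}
    (h : ∀ φ : V → V → W, D.LBal φ →
      (sw s fun p q => sw (D.d (F p q)) fun u v => φ u (v ⋆ G p q)) = φ a D.e)
    (hψ : D.MBal ψ) : sw (K.κ a) ψ = sw s fun p q => ψ (F p q) (G p q) := by
  rw [K.unique_sum h hψ]
  simp only [D.m_e]

theorem κ_b'_mul (hψ : D.MBal ψ) (x : X) (a : V) :
    sw (K.κ (D.b' x ⋆ a)) ψ = sw (K.κ a) fun p q => ψ (D.b' x ⋆ p) q := by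
  refine K.κ_eq (F := fun p _ => D.b' x ⋆ p) (G := fun _ q => q) (fun φ hφ => ?_) hψ
  · simp only [D.d_b'l (Comult.LBal.mul_right hφ _)]
    exact K.right_inv (Comult.LBal.b'_mul hφ x) a

theorem κ_mul_b' (hψ : D.MBal ψ) (x : X) (a : V) :
    sw (K.κ (a ⋆ D.b' x)) ψ = sw (K.κ a) fun p q => ψ (p ⋆ D.b' x) q := by
  refine K.κ_eq (F := fun p _ => p ⋆ D.b' x) (G := fun _ q => q) (fun φ hφ => ?_) hψ
  · simp only [D.d_b'r (Comult.LBal.mul_right hφ _)]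
    exact K.right_inv (Comult.LBal.mul_left hφ (D.b' x)) a

/-- By the Takeuchi condition, `d(p)(1 ⊗ b'(x) q) = d(p)(b(x) ⊗ q)`. Summed over `κ(a) = p ⊗ q` this
is `a b(x) ⊗ 1`. -/
theorem κ_mul_b (hψ : D.MBal ψ) (x : X) (a : V) :
    sw (K.κ (a ⋆ D.b x)) ψ = sw (K.κ a) fun p q => ψ p (D.b' x ⋆ q) := by
  refine K.κ_eq (F := fun p _ => p) (G := fun _ q => D.b' x ⋆ q) (fun φ hφ => ?_) hψ
  · have h := fun p q => (D.takeuchi (Comult.LBal.mul_right hφ q) p x).symm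
    simp only [D.assoc] at h
    simp only [h]
    exact K.right_inv (Comult.LBal.mul_left hφ (D.b x)) a

/-- The canonical map sends both sides to `a ⊗ b(x)`, since `d(b(x) p)(1 ⊗ q) = u ⊗ b(x) v q` for
`d(p) = u ⊗ v`. -/
theorem b_mul_κ (hψ : D.MBal ψ) (x : X) (a : V) :
    (sw (K.κ a) fun p q => ψ (D.b x ⋆ p) q) = sw (K.κ a) fun p q => ψ p (q ⋆ D.b x) := by
  refine K.unique_sum (fun φ hφ => ?_) hψ
  simp only [D.d_bl (Comult.LBal.mul_right hφ _), D.assoc]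
  simpa only [D.m_e] using K.right_inv (Comult.LBal.b_mul hφ x) a

theorem κ_e (hψ : D.MBal ψ) : sw (K.κ D.e) ψ = ψ D.e D.e := by
  rw [← hψ.sw_tmul, K.unique (t := D.e ⊗ₜ[ℂ] D.e) (a := D.e) (c := D.e) (fun φ hφ => ?_) hψ]
  · simp only [D.m_e]
  · rw [(Comult.isBil_canonical hφ.toIsBil).sw_tmul]
    simp only [D.m_e]
    exact D.d_e hφ

/-- The guess is suggested by `κ(a) = a₁ ⊗ S(a₂)` with `S` anti-multiplicative. In its canonical
image, the inner sum over `κ(a')` collapses to multiplication by `a'` in the first leg, and then the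
sum over `κ(a)` collapses. -/
theorem κ_m (hψ : D.MBal ψ) (a a' : V) : sw (K.κ (a ⋆ a')) ψ =
    sw (K.κ a) fun p q => sw (K.κ a') fun p' q' => ψ (p ⋆ p') (q' ⋆ q) := by
  have h := K.unique (t := sw (K.κ a) fun p q => sw (K.κ a') fun p' q' =>
    (p ⋆ p') ⊗ₜ[ℂ] (q' ⋆ q)) (a := a ⋆ a') (c := D.e) (fun φ hφ => ?_) hψ
  · rw [hψ.sw_sw] at h
    simp only [hψ.sw_sw_tmul, D.m_e] at h
    exact h.symm
  · rw [(Comult.isBil_canonical hφ.toIsBil).sw_sw]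
    simp only [(Comult.isBil_canonical hφ.toIsBil).sw_sw_tmul,
      D.d_m (Comult.LBal.mul_right hφ _)]
    have h1 : ∀ p q, (sw (K.κ a') fun p' q' => sw (D.d p) fun u v => sw (D.d p') fun u' v' =>
        φ (u ⋆ u') (v ⋆ v' ⋆ (q' ⋆ q))) = sw (D.d p) fun u v => φ (u ⋆ a') (v ⋆ q) := by
      intro p q
      -- The Takeuchi condition for `d(p)` makes this function balanced in the inner variables.
      have h2 : D.LBal fun u' v' => sw (D.d p) fun u v => φ (u ⋆ u') (v ⋆ v' ⋆ q) := by
        refine ⟨by constructor <;> simp [hφ.add_left, hφ.add_right, hφ.smul_left, hφ.smul_right],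
          fun x u' v' => ?_⟩
        have := D.takeuchi (Comult.LBal.mul_right (Comult.LBal.mul_left hφ u') (v' ⋆ q)) p x
        simpa only [D.assoc] using this
      have h3 := K.right_inv h2 a'
      simp only [D.m_e] at h3
      rw [← h3]
      simp only [sw_comm (D.d _) (D.d p), D.assoc]
    simp only [h1]
    exact K.right_inv (Comult.LBal.mul_left hφ a') a

/-- `u ⊗ κ(v) = d'(p) ⊗ q` for `d'(a) = u ⊗ v` and `κ(a) = p ⊗ q`, whenever `d'` is a comultiplication
compatible with `d`. -/
theorem comul_κ {Z : Type*} {F G : Z → V → V} (d' : V →ₗ[ℂ] V ⊗[ℂ] V)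
    (coassoc : ∀ {W : Type u} [AddCommGroup W] [Module ℂ W] {χ : V → V → V → W},
      IsTri F G (fun x u => D.b x ⋆ u) (fun x u => D.b' x ⋆ u) χ → ∀ a,
      (sw (D.d a) fun u v => sw (d' u) fun u' u'' => χ u' u'' v) =
        sw (d' a) fun u v => sw (D.d v) fun v' v'' => χ u v' v'')
    (hb : ∀ {W : Type u} [AddCommGroup W] [Module ℂ W] {φ : V → V → W}, IsBal F G φ → ∀ x a,
      sw (d' (D.b x ⋆ a)) φ = sw (d' a) fun u v => φ u (D.b x ⋆ v))
    (hG : ∀ {W : Type u} [AddCommGroup W] [Module ℂ W] {ψ : V → V → W}, D.MBal ψ → ∀ z v,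
      sw (K.κ (G z v)) ψ = sw (K.κ v) fun p q => ψ (G z p) q) {χ : V → V → V → W}
    (h : IsTri F G (fun x u => u ⋆ D.b x) (fun x u => D.b x ⋆ u) χ) (a : V) :
    (sw (d' a) fun u v => sw (K.κ v) fun p q => χ u p q) =
      sw (K.κ a) fun p q => sw (d' p) fun u v => χ u v q := by
  have hs : ∀ u, D.MBal (χ u) := h.snd
  have h1 : IsTri F G (fun x u => D.b x ⋆ u) (fun x u => D.b' x ⋆ u)
      fun u v w => sw (K.κ v) fun p q => χ u p (q ⋆ w) := by
    refine ⟨fun w => ⟨⟨?_, ?_, fun u v v' => ?_, fun r u v => ?_⟩, fun x u v => ?_⟩,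
      fun u => K.lbal_κ (h.snd u)⟩
    · simp [(h.fst _).add_left]
    · simp [(h.fst _).smul_left]
    · rw [map_add, ((hs _).mul_right w).sw_add]
    · rw [map_smul, ((hs _).mul_right w).sw_smul]
    · simp only [(h.fst _).bal, hG ((hs u).mul_right w)]
  -- The trivial expression `v ⊗ q` is expanded by `left_inv`, and coassociativity moves `d` to the
  -- outside. The right-hand side thus depends only on `d(p)(1 ⊗ q)`.
  have h2 : ∀ p q, (sw (d' p) fun u v => χ u v q) = sw (D.d p) fun u v => sw (d' u) fun u' u'' =>
      sw (K.κ u'') fun p' q' => χ u' p' (q' ⋆ (v ⋆ q)) := by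
    intro p q
    have h3 := coassoc (χ := fun u v w => sw (K.κ v) fun p' q' => χ u p' (q' ⋆ (w ⋆ q)))
      ⟨fun w => h1.fst (w ⋆ q), fun u => Comult.LBal.mul_right (h1.snd u) q⟩ p
    rw [h3]
    congr 1
    funext u v
    have h4 := K.left_inv ((hs u).mul_right q) v
    simp only [D.e_m, D.assoc] at h4
    exact h4.symm
  simp only [h2]
  -- Balancedness in the outer variables allows `right_inv` to replace the sum of the `d(p)(1 ⊗ q)`
  -- by `a ⊗ 1`.
  have h5 : D.LBal fun u v => sw (d' u) fun u' u'' => sw (K.κ u'') fun p' q' =>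
      χ u' p' (q' ⋆ v) := by
    refine ⟨⟨fun u u' v => ?_, fun r u v => ?_, fun u v v' => ?_, fun r u v => ?_⟩,
      fun x u v => ?_⟩
    · rw [map_add, (h1.fst v).sw_add]
    · rw [map_smul, (h1.fst v).sw_smul]
    · simp [(h.snd _).add_right]
    · simp [(h.snd _).smul_right]
    · rw [hb (h1.fst v)]
      simp only [(h1.snd _).bal]
  have h6 := K.right_inv h5 a
  simp only [D.m_e] at h6
  exact h6.symm

end Translation

end MultHopf

/-! ### Construction and uniqueness of counits -/

namespace MultHopf

section Counits

variable {V : Type u} {X : Type v} [AddCommGroup V] [Module ℂ V] [AddCommGroup X] [Module ℂ X]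
  {D : Comult V X}

local notation:70 u:70 " ⋆ " v:71 => BasedAlgebra.m (Comult.toBasedAlgebra D) u v

/-- Counits of a comultiplication. -/
structure Comult.IsCounit (D : Comult V X) (ε : V →ₗ[ℂ] X) : Prop where
  map_b : ∀ x a, ε (D.m (D.b x) a) = D.μ x (ε a)
  map_b' : ∀ x a, ε (D.m (D.b' x) a) = D.μ (ε a) x
  left : ∀ a, (sw (D.d a) fun u v => D.m (D.b' (ε u)) v) = a
  right : ∀ a, (sw (D.d a) fun u v => D.m (D.b (ε v)) u) = a

namespace Comult

variable {ε : V →ₗ[ℂ] X}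

theorem IsCounit.lbal_left (h : D.IsCounit ε) : D.LBal fun u v => D.b' (ε u) ⋆ v :=
  ⟨by constructor <;> simp, fun x u v => by simp only [h.map_b, D.b'_μ, D.assoc]⟩

theorem IsCounit.lbal_right (h : D.IsCounit ε) : D.LBal fun u v => D.b (ε v) ⋆ u :=
  ⟨by constructor <;> simp, fun x u v => by simp only [h.map_b', D.b_μ, D.assoc]⟩

theorem IsCounit.cop (h : D.IsCounit ε) : D.cop.IsCounit ε :=
  ⟨h.map_b', h.map_b, fun a => (sw_cop_d D a h.lbal_right.flip.toIsBil).trans (h.right a),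
    fun a => (sw_cop_d D a h.lbal_left.flip.toIsBil).trans (h.left a)⟩

theorem mbal_m : D.MBal fun p q => p ⋆ q :=
  ⟨by constructor <;> simp, fun x u v => D.assoc _ _ _⟩

theorem IsCounit.b'_e (h : D.IsCounit ε) : D.b' (ε D.e) = D.e := by
  have := h.left D.e
  rwa [D.d_e h.lbal_left, D.m_e] at this

end Comult

namespace Translation

variable (K : Translation D) {W : Type u} [AddCommGroup W] [Module ℂ W]

/-- The map `a ↦ p q` for `κ(a) = p ⊗ q`. -/
noncomputable def E : V →ₗ[ℂ] V := TensorProduct.lift D.m ∘ₗ K.κ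

theorem E_apply (a : V) : K.E a = sw (K.κ a) fun p q => p ⋆ q := (sw_lift _ _).symm

theorem E_e : K.E D.e = D.e := by
  rw [E_apply, K.κ_e Comult.mbal_m, D.m_e]

theorem E_b'_mul (x : X) (a : V) : K.E (D.b' x ⋆ a) = D.b' x ⋆ K.E a := by
  simp only [E_apply, K.κ_b'_mul Comult.mbal_m, map_sw, D.assoc]

theorem E_mul_b' (x : X) (a : V) :
    K.E (a ⋆ D.b' x) = sw (K.κ a) fun p q => p ⋆ (D.b' x ⋆ q) := by
  simp only [E_apply, K.κ_mul_b' Comult.mbal_m, D.assoc]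

/-- For `κ(a) = p ⊗ q`, right multiplication of `a` by `b(x)` puts `b'(x)` to the left of `q`, and
right multiplication by `b'(x)` puts it to the right of `p`. After multiplication of the legs both
become `p b'(x) q`. -/
theorem E_mul_b (x : X) (a : V) : K.E (a ⋆ D.b x) = K.E (a ⋆ D.b' x) := by
  rw [E_mul_b', E_apply, K.κ_mul_b Comult.mbal_m]

theorem E_mul (a a' : V) : K.E (a ⋆ a') = sw (K.κ a) fun p q => p ⋆ (K.E a' ⋆ q) := by
  simp only [E_apply, K.κ_m Comult.mbal_m, D.assoc]
  congr 1
  funext p q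
  simp only [D.sw_m, D.m_sw, D.assoc]

/-- Multiplying the last two legs in `u ⊗ κ(v) = d(p) ⊗ q` gives `u ⊗ E(v) = d(p)(1 ⊗ q) = a ⊗ 1`.
This is the germ of a counit axiom, available before `E` is known to take values in the base
algebra. -/
theorem comul_E {φ : V → V → W} (hφ : D.LBal φ) (a : V) :
    (sw (D.d a) fun u v => φ u (K.E v)) = φ a D.e := by
  have h := K.comul_κ (F := fun x u => D.b x ⋆ u) (G := fun x u => D.b' x ⋆ u) D.d D.coassoc
    D.d_bl (fun h z v => K.κ_b'_mul h z v)
    (χ := fun u v w => φ u (v ⋆ w)) ⟨fun w => Comult.LBal.mul_right hφ w, fun u => ⟨by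
      constructor <;> simp [hφ.add_right, hφ.smul_right], fun x v w => by simp only [D.assoc]⟩⟩ a
  rw [K.right_inv hφ] at h
  rw [← h]
  congr 1
  funext u v
  rw [E_apply]
  exact map_sw (hφ.toLin u) _ _

/-- Apply `b' ε` to the first leg of `u ⊗ E(v) = a ⊗ 1` and multiply. Since `E` commutes with left
multiplication by `b'`, the result is `E(b'(ε(u)) v) = b'(ε(a))`, and the left counit axiom
simplifies the argument of `E` to `a`. As `E` does not involve `ε` and `b'` is injective, counits
are unique. -/
theorem E_eq_of_isCounit {ε : V →ₗ[ℂ] X} (h : D.IsCounit ε) (a : V) : K.E a = D.b' (ε a) := by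
  have h1 := K.comul_E h.lbal_left a
  simp only [D.m_e, ← K.E_b'_mul] at h1
  rw [← h1, ← map_sw, h.left]

include K in
theorem counit_unique {ε ε' : V →ₗ[ℂ] X} (h : D.IsCounit ε) (h' : D.IsCounit ε') : ε = ε' :=
  LinearMap.ext fun a => D.b'_inj <| by
    rw [← K.E_eq_of_isCounit h, ← K.E_eq_of_isCounit h']

include K in
theorem counit_mul_b {ε : V →ₗ[ℂ] X} (h : D.IsCounit ε) (x : X) (a : V) :
    ε (a ⋆ D.b x) = ε (a ⋆ D.b' x) :=
  D.b'_inj <| by simp only [← K.E_eq_of_isCounit h, K.E_mul_b]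

-- Together with `counit_mul_b` this gives the two multiplicativity axioms of a bialgebroid counit.
-- They are not part of the definition of a counit here, but follow from bijectivity of the
-- canonical map by computing `E(a a')` from the rule for `κ(a a')`.
include K in
theorem counit_mul_b'_counit {ε : V →ₗ[ℂ] X} (h : D.IsCounit ε) (a a' : V) :
    ε (a ⋆ D.b' (ε a')) = ε (a ⋆ a') :=
  D.b'_inj <| by
    rw [← K.E_eq_of_isCounit h (a ⋆ a'), ← K.E_eq_of_isCounit h, K.E_mul_b', K.E_mul,
      K.E_eq_of_isCounit h]

/-- The values of `E` belong to the image of `b'`. -/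
theorem E_mem_range (K' : Translation D.cop)
    (full : Submodule.span ℂ {c : V | ∃ (ω : V →ₗ[ℂ] X) (u v : V),
      (∀ x a, ω (D.b x ⋆ a) = D.μ x (ω a)) ∧ c = D.b' (ω u) ⋆ v} = ⊤) (a : V) :
    K.E a ∈ LinearMap.range D.b' := by
  have h : Submodule.span ℂ {c : V | ∃ (ω : V →ₗ[ℂ] X) (u v : V),
      (∀ x a, ω (D.b x ⋆ a) = D.μ x (ω a)) ∧ c = D.b' (ω u) ⋆ v} ≤
      (LinearMap.range D.b').comap K.E := by
    rw [Submodule.span_le]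
    rintro _ ⟨ω, u, v, hω, rfl⟩
    have h1 : D.LBal fun s t => D.b' (ω (s ⋆ u)) ⋆ t :=
      ⟨by constructor <;> simp, fun x s t => by simp only [D.assoc, hω, D.b'_μ]⟩
    have h2 : D.cop.LBal fun t s => K.E (D.b' (ω (s ⋆ u)) ⋆ t) := by
      simp only [K.E_b'_mul]
      exact ⟨by constructor <;> simp, fun x t s => by
        simp only [Comult.cop_b, Comult.cop_b', Comult.cop_m, K.E_b'_mul, D.assoc, hω, D.b'_μ]⟩
    -- The other canonical map allows one to write `1 ⊗ v` as a sum of terms `d(p)(q ⊗ 1)`. With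
    -- `d(p) = s ⊗ t`, the element `b'(ω(u)) v` becomes a sum of terms `b'(ω(s q u)) t`.
    have h3 := K'.right_inv h2 v
    simp only [Comult.cop_e, Comult.cop_m, D.e_m] at h3
    rw [SetLike.mem_coe, Submodule.mem_comap]
    rw [← h3]
    -- By `comul_E`, applying `E` replaces `s ⊗ t` by `p ⊗ 1`. What remains is visibly in the range
    -- of `b'`.
    have h4 : ∀ p q, (sw (D.cop.d p) fun t s => K.E (D.b' (ω (s ⋆ q ⋆ u)) ⋆ t)) =
        D.b' (ω (p ⋆ q ⋆ u)) := by
      intro p q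
      rw [Comult.sw_cop_d]
      · have h5 := K.comul_E (Comult.LBal.mul_left h1 q) p
        simp only [D.m_e, ← K.E_b'_mul] at h5
        exact h5
      · constructor <;> simp
    simp only [h4]
    rw [← map_sw D.b' (K'.κ v) fun p q => ω (p ⋆ q ⋆ u)]
    exact ⟨_, rfl⟩
  rw [full] at h
  exact h trivial

/-- Since `b'` is injective and `E` takes values in its range, `ε` can be defined by `b' ε = E`.
Applying `b ε` to the second leg of `u ⊗ E(v) = a ⊗ 1` gives one counit axiom, because `ε(E(v)) =
ε(v)`. The other axiom and linearity along `b` are not accessible from this side. -/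
theorem exists_half_counit (K' : Translation D.cop)
    (full : Submodule.span ℂ {c : V | ∃ (ω : V →ₗ[ℂ] X) (u v : V),
      (∀ x a, ω (D.b x ⋆ a) = D.μ x (ω a)) ∧ c = D.b' (ω u) ⋆ v} = ⊤) :
    ∃ ε : V →ₗ[ℂ] X, (∀ a, D.b' (ε a) = K.E a) ∧ (∀ x a, ε (D.b' x ⋆ a) = D.μ (ε a) x) ∧
      ∀ a, (sw (D.d a) fun u v => D.b (ε v) ⋆ u) = a := by
  have h : ∀ a, ∃ x, D.b' x = K.E a := fun a => K.E_mem_range K' full a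
  choose f hf using h
  let ε : V →ₗ[ℂ] X := ⟨⟨f, fun a a' => D.b'_inj (by simp [hf])⟩,
    fun r a => D.b'_inj (by simp [hf])⟩
  have hε : ∀ a, D.b' (ε a) = K.E a := hf
  have map_b' : ∀ x a, ε (D.b' x ⋆ a) = D.μ (ε a) x := fun x a => D.b'_inj <| by
    rw [hε, K.E_b'_mul, D.b'_μ, hε]
  have hr : D.LBal fun u v => D.b (ε v) ⋆ u :=
    ⟨by constructor <;> simp, fun x u v => by simp only [map_b', D.b_μ, D.assoc]⟩
  have ε_e : ε D.e = D.o := D.b'_inj <| by rw [hε, K.E_e, D.b'_o]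
  refine ⟨ε, hε, map_b', fun a => ?_⟩
  have h := K.comul_E hr a
  have h1 : ∀ v, D.b (ε (K.E v)) = D.b (ε v) := fun v => by
    rw [← hε, ← D.m_e (D.b' _), map_b', D.b_μ, ε_e, D.b_o, D.e_m]
  simpa only [h1, ε_e, D.b_o, D.e_m] using h

include K in
/-- A counit exists if the canonical maps are bijective and there are enough module maps. -/
theorem exists_counit (K' : Translation D.cop)
    (full : Submodule.span ℂ {c : V | ∃ (ω : V →ₗ[ℂ] X) (u v : V),
      (∀ x a, ω (D.b x ⋆ a) = D.μ x (ω a)) ∧ c = D.b' (ω u) ⋆ v} = ⊤)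
    (full' : Submodule.span ℂ {c : V | ∃ (ω : V →ₗ[ℂ] X) (u v : V),
      (∀ x a, ω (D.b' x ⋆ a) = D.μ (ω a) x) ∧ c = D.b (ω u) ⋆ v} = ⊤) :
    ∃ ε : V →ₗ[ℂ] X, D.IsCounit ε := by
  obtain ⟨ε, hε, map_b', right⟩ := K.exists_half_counit K' full
  obtain ⟨ε', hε', map_b, left⟩ := K'.exists_half_counit (D.cop_cop.symm ▸ K) full'
  simp only [Comult.cop_b, Comult.cop_b', Comult.cop_m, Comult.cop_μ] at hε' map_b left
  have hl : D.LBal fun u v => D.b' (ε' u) ⋆ v :=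
    ⟨by constructor <;> simp, fun x u v => by simp only [map_b, D.b'_μ, D.assoc]⟩
  simp only [D.sw_cop_d _ hl.flip.toIsBil] at left
  -- With `d(a) = u ⊗ v` one computes `b'(ε(a)) = E(b'(ε'(u)) v) = b'(ε'(u)) b'(ε(v)) =
  -- b'(ε'(b(ε(v)) u)) = b'(ε'(a))`. This uses the left axiom for `ε'` and the right axiom for `ε`.
  have h : ε = ε' := LinearMap.ext fun a => D.b'_inj <| by
    conv_lhs => rw [hε, ← left a, map_sw]
    simp only [K.E_b'_mul, ← hε, ← D.b'_μ, ← map_b]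
    rw [← map_sw D.b', ← map_sw ε', right]
  subst h
  exact ⟨ε, map_b, map_b', left, right⟩

end Translation

end Counits

end MultHopf

/-! ### Compatible pairs of comultiplications and antipodes -/

namespace MultHopf

/-- Two comultiplications on the same algebra, the second one with respect to the opposite multiplication,
that are compatible with each other. -/
structure BiComult (V : Type u) (X : Type v) (Y : Type w) [AddCommGroup V] [Module ℂ V]
    [AddCommGroup X] [Module ℂ X] [AddCommGroup Y] [Module ℂ Y] where
  L : Comult V X
  R : Comult V Y
  R_m : ∀ u v, R.m u v = L.m v u
  R_e : R.e = L.e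
  range_b : LinearMap.range L.b = LinearMap.range R.b
  range_b' : LinearMap.range L.b' = LinearMap.range R.b'
  mixed₁ : ∀ {W : Type u} [AddCommGroup W] [Module ℂ W] {χ : V → V → V → W},
    IsTri (fun x u => L.m (L.b x) u) (fun x u => L.m (L.b' x) u) (fun x u => R.m (R.b x) u)
      (fun x u => R.m (R.b' x) u) χ → ∀ a,
      (sw (R.d a) fun u v => sw (L.d u) fun u' u'' => χ u' u'' v) =
        sw (L.d a) fun u v => sw (R.d v) fun v' v'' => χ u v' v''
  mixed₂ : ∀ {W : Type u} [AddCommGroup W] [Module ℂ W] {χ : V → V → V → W},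
    IsTri (fun x u => R.m (R.b x) u) (fun x u => R.m (R.b' x) u) (fun x u => L.m (L.b x) u)
      (fun x u => L.m (L.b' x) u) χ → ∀ a,
      (sw (L.d a) fun u v => sw (R.d u) fun u' u'' => χ u' u'' v) =
        sw (R.d a) fun u v => sw (L.d v) fun v' v'' => χ u v' v''

namespace Comult

variable {V : Type u} {X : Type v} {Y : Type w} [AddCommGroup V] [Module ℂ V] [AddCommGroup X]
  [Module ℂ X] [AddCommGroup Y] [Module ℂ Y] {W : Type u} [AddCommGroup W] [Module ℂ W]

theorem mixed_cop {D : Comult V X} {D' : Comult V Y} {χ : V → V → V → W}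
    (h : IsTri (fun x u => D.cop.m (D.cop.b x) u) (fun x u => D.cop.m (D.cop.b' x) u)
      (fun x u => D'.cop.m (D'.cop.b x) u) (fun x u => D'.cop.m (D'.cop.b' x) u) χ) (a : V)
    (mixed : (sw (D.d a) fun u v => sw (D'.d u) fun u' u'' => χ v u'' u') =
      sw (D'.d a) fun u v => sw (D.d v) fun v' v'' => χ v'' v' u) :
    (sw (D'.cop.d a) fun u v => sw (D.cop.d u) fun u' u'' => χ u' u'' v) =
        sw (D.cop.d a) fun u v => sw (D'.cop.d v) fun v' v'' => χ u v' v'' := by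
  have h1 := fun u v => sw_cop_d D u (h.fst v).toIsBil
  have h2 := fun v u => sw_cop_d D' v (h.snd u).toIsBil
  simp only [h1, h2]
  rw [sw_cop_d, sw_cop_d]
  · exact mixed.symm
  · constructor <;> intros
    · simp [(h.fst _).add_left]
    · simp [(h.fst _).smul_left]
    · rw [map_add, (h.snd _).flip.sw_add]
    · rw [map_smul, (h.snd _).flip.sw_smul]
  · constructor <;> intros
    · rw [map_add, (h.fst _).flip.sw_add]
    · rw [map_smul, (h.fst _).flip.sw_smul]
    · simp [(h.snd _).add_right]
    · simp [(h.snd _).smul_right]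

end Comult

namespace BiComult

variable {V : Type u} {X : Type v} {Y : Type w} [AddCommGroup V] [Module ℂ V] [AddCommGroup X]
  [Module ℂ X] [AddCommGroup Y] [Module ℂ Y] (P : BiComult V X Y)
  {W : Type u} [AddCommGroup W] [Module ℂ W]

local notation:70 u:70 " ⋆ " v:71 => BasedAlgebra.m (Comult.toBasedAlgebra (BiComult.L P)) u v

/-- The opposite, with the two comultiplications exchanged. -/
def op : BiComult V Y X where
  L := P.R
  R := P.L
  R_m u v := (P.R_m v u).symm
  R_e := P.R_e.symm
  range_b := P.range_b.symm
  range_b' := P.range_b'.symm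
  mixed₁ := P.mixed₂
  mixed₂ := P.mixed₁

/-- The co-opposite. -/
noncomputable def cop : BiComult V X Y where
  L := P.L.cop
  R := P.R.cop
  R_m := P.R_m
  R_e := P.R_e
  range_b := P.range_b'
  range_b' := P.range_b
  mixed₁ h a := Comult.mixed_cop h a (P.mixed₂ h.flip a)
  mixed₂ h a := Comult.mixed_cop h a (P.mixed₁ h.flip a)

theorem cop_cop : P.cop.cop = P := by
  have h1 := P.L.cop_cop
  have h2 := P.R.cop_cop
  cases P
  simp only [cop] at h1 h2 ⊢
  congr 1

theorem exists_b (y : Y) : ∃ x, P.L.b x = P.R.b y := P.range_b.symm.le ⟨y, rfl⟩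

theorem exists_b' (y : Y) : ∃ x, P.L.b' x = P.R.b' y := P.range_b'.symm.le ⟨y, rfl⟩

theorem exists_c (x : X) : ∃ y, P.R.b y = P.L.b x := P.range_b.le ⟨x, rfl⟩

theorem exists_c' (x : X) : ∃ y, P.R.b' y = P.L.b' x := P.range_b'.le ⟨x, rfl⟩

/-- Antipodes with respect to given counits. -/
structure IsAntipode (ε : V →ₗ[ℂ] X) (η : V →ₗ[ℂ] Y) (S : V →ₗ[ℂ] V) : Prop where
  map_b : ∀ x a, S (P.L.m (P.L.b x) a) = P.L.m (S a) (P.L.b' x)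
  map_c' : ∀ y a, S (P.L.m a (P.R.b' y)) = P.L.m (P.R.b y) (S a)
  left : ∀ a, (sw (P.L.d a) fun u v => P.L.m (S u) v) = P.R.b (η a)
  right : ∀ a, (sw (P.R.d a) fun u v => P.L.m u (S v)) = P.L.b' (ε a)

variable {P} {ε : V →ₗ[ℂ] X} {η : V →ₗ[ℂ] Y} {S : V →ₗ[ℂ] V}

namespace IsAntipode

theorem lbal_left (h : P.IsAntipode ε η S) : P.L.LBal fun u v => S u ⋆ v :=
  ⟨by constructor <;> simp, fun x u v => by simp only [h.map_b, P.L.assoc]⟩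

theorem lbal_right (h : P.IsAntipode ε η S) : P.R.LBal fun u v => u ⋆ S v :=
  ⟨by constructor <;> simp, fun x u v => by simp only [P.R_m, h.map_c', P.L.assoc]⟩

/-- The opposite exchanges the two comultiplications and reverses products, and the co-opposite
flips the legs. The combined effect is to exchange the two antipode identities without changing `S`.
-/
theorem op_cop (h : P.IsAntipode ε η S) : P.op.cop.IsAntipode η ε S where
  map_b y a := by
    have := h.map_c' y a
    rw [← P.R_m, ← P.R_m] at this
    exact this
  map_c' x a := by
    have := h.map_b x a
    rw [← P.R_m, ← P.R_m] at this
    exact this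
  left a := by
    have h1 := P.R.sw_cop_d a h.lbal_right.flip.toIsBil
    rw [h.right] at h1
    simp only [← P.R_m] at h1
    exact h1
  right a := by
    have h1 := P.L.sw_cop_d a h.lbal_left.flip.toIsBil
    rw [h.left] at h1
    simp only [← P.R_m] at h1
    exact h1

end IsAntipode

section CounitR

variable (hη : P.R.IsCounit η)
include hη

theorem counit_mul_c (a : V) (y : Y) : η (a ⋆ P.R.b y) = P.R.μ y (η a) := by
  rw [← P.R_m, hη.map_b]

theorem counit_mul_c' (a : V) (y : Y) : η (a ⋆ P.R.b' y) = P.R.μ (η a) y := by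
  rw [← P.R_m, hη.map_b']

theorem sw_counit (a : V) : (sw (P.R.d a) fun u v => u ⋆ P.R.b (η v)) = a := by
  simp only [← P.R_m, hη.right]

end CounitR

theorem c_μ (y z : Y) : P.R.b (P.R.μ y z) = P.R.b z ⋆ P.R.b y := by
  rw [P.R.b_μ, P.R_m]

/-- Well-definedness of the formula `S(a) = c(η(p)) q`. An element `b(x)` equals some `c(y)`, and
`c(η(p c(y))) = c(η(p)) c(y)` because `c` is an anti-homomorphism for the multiplication of `P.L`.
-/
theorem mbal_counit (hη : P.R.IsCounit η) : P.L.MBal fun p q => P.R.b (η p) ⋆ q := by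
  refine ⟨by constructor <;> simp, fun x p q => ?_⟩
  obtain ⟨y, hy⟩ := P.exists_c x
  simp only [← hy, counit_mul_c hη, P.c_μ, P.L.assoc]

theorem _root_.MultHopf.Comult.IsCounit.map_e {D : Comult V X} (h : D.IsCounit ε) :
    ε D.e = D.o := D.b'_inj <| by rw [h.b'_e, D.b'_o]

theorem _root_.MultHopf.Comult.IsCounit.map_b'_apply {D : Comult V X} (h : D.IsCounit ε) (x : X) :
    ε (D.b' x) = x := D.b'_inj <| by
  rw [← D.m_e (D.b' x), h.map_b', D.b'_μ, h.b'_e, D.m_e]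

theorem _root_.MultHopf.Comult.IsCounit.map_b_apply {D : Comult V X} (h : D.IsCounit ε) (x : X) :
    ε (D.b x) = x := h.cop.map_b'_apply x

/-- `S(a) = c(η(p)) q` for `κ(a) = p ⊗ q`. -/
theorem IsAntipode.eq_sw (h : P.IsAntipode ε η S) (K : Translation P.L) (a : V) :
    S a = sw (K.κ a) fun p q => P.R.b (η p) ⋆ q := by
  -- Apply `u ⊗ v ↦ S(u) v` to `d(p)(1 ⊗ q) = a ⊗ 1`. The antipode identity turns `S(u) v` into
  -- `c(η(p))`.
  have h1 := K.right_inv h.lbal_left a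
  rw [P.L.m_e] at h1
  rw [← h1]
  congr 1
  funext p q
  simp only [← h.left, P.L.sw_m, P.L.assoc]

/-- Existence of the antipode. -/
theorem exists_antipode (K : Translation P.L) (hε : P.L.IsCounit ε) (hη : P.R.IsCounit η) :
    ∃ S, P.IsAntipode ε η S := by
  have hm := mbal_counit hη
  let S : V →ₗ[ℂ] V := TensorProduct.lift hm.toLin ∘ₗ K.κ
  have hS : ∀ a, S a = sw (K.κ a) fun p q => P.R.b (η p) ⋆ q := fun a => (hm.sw_eq _).symm
  have map_b : ∀ x a, S (P.L.b x ⋆ a) = S a ⋆ P.L.b' x := fun x a => by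
    simp only [hS, K.κ_b hm, P.L.sw_m, P.L.assoc]
  have map_c' : ∀ y a, S (a ⋆ P.R.b' y) = P.R.b y ⋆ S a := fun y a => by
    obtain ⟨x, hx⟩ := P.exists_b' y
    simp only [hS, ← hx, K.κ_mul_b' hm, P.L.m_sw]
    simp only [hx, counit_mul_c' hη, P.c_μ, P.L.assoc]
  refine ⟨S, map_b, map_c', fun a => ?_, fun a => ?_⟩
  · have h1 := K.left_inv hm a
    rw [P.L.m_e] at h1
    rw [← h1]
    congr 1
    funext u v
    simp only [hS, P.L.sw_m, P.L.assoc]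
  -- Here `comul_κ` is used for the second comultiplication: `u ⊗ κ(v) = d_R(p) ⊗ q`. On the left
  -- this yields `u S(v)`; on the right the counit axiom for `η` leaves `p q = E(a) = b'(ε(a))`.
  · have h2 := K.comul_κ (F := fun y u => P.R.m (P.R.b y) u) (G := fun y u => P.R.m (P.R.b' y) u)
      P.R.d P.mixed₂ ?_ ?_ (χ := fun u p q => u ⋆ (P.R.b (η p) ⋆ q))
      ⟨fun w => ⟨by constructor <;> simp, fun y u v => ?_⟩,
        fun u => ⟨by constructor <;> simp, fun x p q => congrArg _ (hm.bal x p q)⟩⟩ a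
    · simp only [← map_sw, ← hS] at h2
      rw [h2, ← K.E_eq_of_isCounit hε, K.E_apply]
      congr 1
      funext p q
      simp only [← P.L.assoc, ← P.L.sw_m, sw_counit hη]
    · intro W _ _ φ hφ x a
      obtain ⟨y, hy⟩ := P.exists_c x
      simp only [← hy, ← P.R_m]
      exact P.R.d_br hφ y a
    · intro W _ _ ψ hψ y v
      obtain ⟨x, hx⟩ := P.exists_b' y
      simp only [P.R_m, ← hx]
      exact K.κ_mul_b' hψ x v
    · simp only [P.R_m, counit_mul_c' hη, P.c_μ, P.L.assoc]

/-- The antipode reverses products. -/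
theorem IsAntipode.map_m (h : P.IsAntipode ε η S) (K : Translation P.L) (hη : P.R.IsCounit η)
    (h₁ : ∀ a a', η (P.R.m a (P.R.b (η a'))) = η (P.R.m a a'))
    (h₂ : ∀ a a', η (P.R.m a (P.R.b' (η a'))) = η (P.R.m a a')) (a a' : V) :
    S (a ⋆ a') = S a' ⋆ S a := by
  have hm := mbal_counit hη
  -- The antipode axioms only control `c'(y)` on the right. On the left one needs `η(c'(y) p) =
  -- η(c(y) p)`, after which `b_mul_κ` moves `c(y)` through `κ(a)`.
  have h3 : ∀ y a, S (P.R.b' y ⋆ a) = S a ⋆ P.R.b y := fun y a => by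
    obtain ⟨x, hx⟩ := P.exists_b' y
    obtain ⟨x', hx'⟩ := P.exists_b y
    have h4 : ∀ p, η (P.R.b' y ⋆ p) = η (P.R.b y ⋆ p) := fun p => by
      rw [← P.R_m, ← P.R_m, ← hη.map_b'_apply y, h₂, h₁]
    simp only [h.eq_sw K, P.L.sw_m, ← hx, K.κ_b'_mul hm]
    simp only [P.L.assoc, hx, h4]
    rw [← hx']
    exact K.b_mul_κ hm x' a
  rw [h.eq_sw K, K.κ_m hm, h.eq_sw K a, map_sw]
  congr 1
  funext p q
  -- Inside `η`, the factor `p` may be replaced by the base element `c'(η(p))`. The rule for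
  -- `S(c'(y) a')` then separates the two factors.
  have h5 : ∀ p', η (p ⋆ p') = η (P.R.b' (η p) ⋆ p') := fun p' => by
    rw [← P.R_m, ← P.R_m, h₂]
  obtain ⟨x, hx⟩ := P.exists_b' (η p)
  simp only [h5, ← P.L.assoc, ← h3, ← hx]
  simp only [h.eq_sw K, P.L.sw_m, K.κ_b'_mul hm]

theorem IsAntipode.map_e (h : P.IsAntipode ε η S) (hη : P.R.IsCounit η) : S P.L.e = P.L.e := by
  have h1 := h.left P.L.e
  rw [P.L.d_e h.lbal_left, P.L.m_e, ← P.R_e, hη.map_e, P.R.b_o] at h1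
  rw [← P.R_e, h1]

theorem IsAntipode.apply_b (h : P.IsAntipode ε η S) (hη : P.R.IsCounit η) (x : X) :
    S (P.L.b x) = P.L.b' x := by
  rw [← P.L.m_e (P.L.b x), h.map_b, h.map_e hη, P.L.e_m]

theorem IsAntipode.apply_c' (h : P.IsAntipode ε η S) (hη : P.R.IsCounit η) (y : Y) :
    S (P.R.b' y) = P.R.b y := by
  rw [← P.L.e_m (P.R.b' y), h.map_c', h.map_e hη, P.L.m_e]

/-- The antipode of the co-opposite is a left inverse of the antipode. -/
theorem IsAntipode.leftInverse (h : P.IsAntipode ε η S) {T : V →ₗ[ℂ] V}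
    (h' : P.cop.IsAntipode ε η T) (hε : P.L.IsCounit ε) (hη : P.R.IsCounit η)
    (hS : ∀ a a', S (a ⋆ a') = S a' ⋆ S a) (hT : ∀ a a', T (a ⋆ a') = T a' ⋆ T a) (a : V) :
    T (S a) = a := by
  have T_b' : ∀ x, T (P.L.b' x) = P.L.b x := h'.apply_b hη.cop
  have T_c : ∀ y, T (P.R.b y) = P.R.b' y := h'.apply_c' hη.cop
  have T_b'_mul : ∀ x a, T (P.L.b' x ⋆ a) = T a ⋆ P.L.b x := h'.map_b
  have T_mul_c : ∀ y a, T (a ⋆ P.R.b y) = P.R.b' y ⋆ T a := h'.map_c'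
  have h1 : ∀ a, (sw (P.R.d a) fun u v => T (S v) ⋆ T u) = P.L.b (ε a) := fun a => by
    simp only [← hT]
    rw [← map_sw, h.right, T_b']
  have h2 : ∀ a, (sw (P.L.d a) fun u v => T v ⋆ u) = P.R.b' (η a) := fun a => by
    rw [← P.L.sw_cop_d a (φ := fun u v => T u ⋆ v) (by constructor <;> simp)]
    exact h'.left a
  have F_mul : ∀ a a', T (S (a ⋆ a')) = T (S a) ⋆ T (S a') := fun a a' => by rw [hS, hT]
  -- Both sides of mixed coassociativity are evaluated on `T(S(w)) T(v) u`. Contracting `T(v) u`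
  -- first leaves `T(S(a))` by the counit axiom for `η`. Contracting `T(S(w)) T(v)` first leaves
  -- `b(ε(v)) u` with `d(a) = u ⊗ v`, which is `a`.
  have h3 := P.mixed₁ (χ := fun u v w => T (S w) ⋆ T v ⋆ u)
    ⟨fun w => ⟨by constructor <;> simp, fun x u v => ?_⟩,
      fun u => ⟨by constructor <;> simp, fun y v w => ?_⟩⟩ a
  · simp only [P.L.assoc] at h3
    simp only [← map_sw, h2] at h3
    simp only [← P.L.assoc] at h3
    have h4 : ∀ u v, T (S v) ⋆ P.R.b' (η u) = T (S (v ⋆ P.R.b' (η u))) := fun u v => by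
      rw [F_mul, h.apply_c' hη, T_c]
    have h5 : (sw (P.R.d a) fun u v => v ⋆ P.R.b' (η u)) = a := by
      simp only [← P.R_m, hη.left]
    simp only [h4, ← P.L.sw_m, h1, hε.right] at h3
    rwa [← map_sw T, ← map_sw S, h5] at h3
  · simp only [T_b'_mul, P.L.assoc]
  · simp only [P.R_m, T_mul_c, F_mul, h.apply_c' hη, T_c, P.L.assoc]

/-- The inverse of a bijective anti-multiplicative antipode is an antipode of the co-opposite. -/
theorem IsAntipode.symm (h : P.IsAntipode ε η S) (hη : P.R.IsCounit η)
    (hS : ∀ a a', S (a ⋆ a') = S a' ⋆ S a) {T : V →ₗ[ℂ] V} (hST : ∀ a, S (T a) = a)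
    (hTS : ∀ a, T (S a) = a) : P.cop.IsAntipode ε η T := by
  have hT : ∀ a a', T (a ⋆ a') = T a' ⋆ T a := fun a a' => by
    rw [← hTS (T a' ⋆ T a), hS, hST, hST]
  have T_b' : ∀ x, T (P.L.b' x) = P.L.b x := fun x => by rw [← h.apply_b hη, hTS]
  have T_c : ∀ y, T (P.R.b y) = P.R.b' y := fun y => by rw [← h.apply_c' hη, hTS]
  refine ⟨fun x a => (hT _ _).trans ?_, fun x a => (hT _ _).trans ?_, fun a => ?_, fun a => ?_⟩
  · exact congrArg (fun z => T a ⋆ z) (T_b' x)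
  · exact congrArg (fun z => z ⋆ T a) (T_c x)
  · refine (P.L.sw_cop_d a (φ := fun u v => T u ⋆ v) (by constructor <;> simp)).trans ?_
    refine Eq.trans ?_ (T_c _)
    simp only [← h.left, map_sw, hT, hTS]
  · refine (P.R.sw_cop_d a (φ := fun u v => u ⋆ T v) (by constructor <;> simp)).trans ?_
    refine Eq.trans ?_ (T_b' _)
    simp only [← h.right, map_sw, hT, hTS]

/-- In the presence of an antipode, the canonical map is bijective. -/
noncomputable def IsAntipode.translation (h : P.IsAntipode ε η S) (hε : P.L.IsCounit ε)
    (hη : P.R.IsCounit η) : Translation P.L where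
  -- The expected preimage `a₁ ⊗ S(a₂)`; the comultiplication of `a` used here is the right one, not
  -- the one being inverted.
  κ := TensorProduct.map LinearMap.id S ∘ₗ P.R.d
  right_inv {W} _ _ φ hφ a := by
    rw [LinearMap.comp_apply, (Comult.isBil_canonical hφ.toIsBil).sw_map]
    rw [P.mixed₁ (χ := fun u v w => φ u (v ⋆ S w)) ⟨fun w => hφ.mul_right (S w),
      fun u => ⟨by constructor <;> simp [hφ.add_right, hφ.smul_right], fun y v w => by
        simp only [P.R_m, h.map_c', P.L.assoc]⟩⟩]
    -- After mixed coassociativity the inner sum is `b'(ε(v))` in the second leg. It is moved to the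
    -- first leg as `b(ε(v))`, where the counit axiom applies.
    have h1 : ∀ u v, (sw (P.R.d v) fun v' v'' => φ u (v' ⋆ S v'')) =
        φ (P.L.b (ε v) ⋆ u) P.L.e := fun u v => by
      rw [hφ.bal, P.L.m_e, ← h.right]
      exact (map_sw (hφ.toLin u) _ _).symm
    simp only [h1]
    conv_rhs => rw [← hε.right a]
    exact (map_sw (hφ.flip.toLin P.L.e) _ _).symm
  left_inv {W} _ _ ψ hψ a := by
    have h1 := fun u v => ((Comult.MBal.mul_right hψ v).sw_map S (P.R.d u))
    simp only [LinearMap.comp_apply, h1]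
    rw [P.mixed₂ (χ := fun u v w => ψ u (S v ⋆ w)) ⟨fun w => ⟨by
      constructor <;> simp [hψ.add_right, hψ.smul_right, hψ.add_left, hψ.smul_left],
      fun y u v => ?_⟩, fun u => ⟨by
        constructor <;> simp [hψ.add_right, hψ.smul_right], fun x v w => by
        simp only [h.map_b, P.L.assoc]⟩⟩]
    · have h2 : ∀ u v, (sw (P.L.d v) fun v' v'' => ψ u (S v' ⋆ v'')) =
          ψ (u ⋆ P.R.b (η v)) P.L.e := fun u v => by
        obtain ⟨x, hx⟩ := P.exists_b (η v)
        rw [← hx, hψ.bal, P.L.m_e, hx, ← h.left]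
        exact (map_sw (hψ.toLin u) _ _).symm
      simp only [h2]
      conv_rhs => rw [← sw_counit hη a]
      exact (map_sw (hψ.flip.toLin P.L.e) _ _).symm
    · obtain ⟨x, hx⟩ := P.exists_b y
      simp only [P.R_m, h.map_c', P.L.assoc]
      rw [← hx]
      exact hψ.bal _ _ _
  κ_b {W} _ _ ψ hψ x a := by
    have h1 : P.R.LBal fun u v => ψ u (S v) := by
      refine ⟨by constructor <;> simp [hψ.add_right, hψ.smul_right, hψ.add_left, hψ.smul_left],
        fun y u v => ?_⟩
      obtain ⟨x, hx⟩ := P.exists_b y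
      simp only [P.R_m, h.map_c']
      rw [← hx]
      exact hψ.bal _ _ _
    rw [LinearMap.comp_apply, LinearMap.comp_apply, hψ.sw_map, (hψ.mul_right (P.L.b' x)).sw_map]
    obtain ⟨y, hy⟩ := P.exists_c x
    rw [← hy, ← P.R_m, P.R.d_br h1]
    simp only [P.R_m, hy, h.map_b]

end BiComult

end MultHopf

/-! ### Independence of the presentation of balanced tensor products -/

namespace MultHopf

section Presentation

variable {V : Type u} [AddCommGroup V] [Module ℂ V]
  {W : Type*} [AddCommGroup W] [Module ℂ W] {X Y ι κ : Type*}

/-- The families `f`, `g` define the same balancing conditions as `F`, `G`. -/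
structure Presents (F G : X → V → V) (f g : ι → Module.End ℂ V) : Prop where
  exists_left : ∀ i, ∃ x, (∀ u, f i u = F x u) ∧ ∀ u, g i u = G x u
  exists_right : ∀ x, ∃ i, (∀ u, f i u = F x u) ∧ ∀ u, g i u = G x u

theorem Presents.of_eq {F G : ι → V → V} {f g : ι → Module.End ℂ V} (hf : ∀ i u, f i u = F i u)
    (hg : ∀ i u, g i u = G i u) : Presents F G f g :=
  ⟨fun i => ⟨i, hf i, hg i⟩, fun i => ⟨i, hf i, hg i⟩⟩

theorem Bal.mk_eq_sw (f g : ι → Module.End ℂ V) (t : V ⊗[ℂ] V) :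
    Bal.mk f g t = sw t fun u v => Bal.tmul f g u v := by
  conv_lhs => rw [← sw_tmul_self t, map_sw]
  rfl

/-- Over a field the quotient map has a linear section, so representatives can be chosen linearly.
No further property of the section is used. -/
theorem Bal.exists_section (f g : ι → Module.End ℂ V) (D : V →ₗ[ℂ] Bal f g) :
    ∃ d : V →ₗ[ℂ] V ⊗[ℂ] V, ∀ a, Bal.mk f g (d a) = D a := by
  obtain ⟨l, hl⟩ := (Bal.mk f g).exists_rightInverse_of_surjective
    (LinearMap.range_eq_top.2 (Submodule.mkQ_surjective _))
  exact ⟨l ∘ₗ D, fun a => LinearMap.congr_fun hl (D a)⟩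

theorem Bal₃.inl_mk (f g : ι → Module.End ℂ V) (f' g' : κ → Module.End ℂ V) (t : V ⊗[ℂ] V)
    (c : V) : Bal₃.inl f g f' g' (Bal.mk f g t) c =
      sw t fun u v => Bal₃.tmul f g f' g' u v c := by
  rw [Bal.mk_eq_sw, ← LinearMap.flip_apply, map_sw]
  rfl

theorem Bal₃.inr_mk (f g : ι → Module.End ℂ V) (f' g' : κ → Module.End ℂ V) (t : V ⊗[ℂ] V)
    (a : V) : Bal₃.inr f g f' g' a (Bal.mk f' g' t) =
      sw t fun u v => Bal₃.tmul f g f' g' a u v := by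
  rw [Bal.mk_eq_sw, map_sw]
  rfl

theorem Bal₃.lift_inl {f g : ι → Module.End ℂ V} {f' g' : κ → Module.End ℂ V}
    (δ : V →ₗ[ℂ] Bal f g) (d : V →ₗ[ℂ] V ⊗[ℂ] V) (w : V ⊗[ℂ] V)
    (hd : ∀ a, Bal.mk f g (d a) = δ a) :
    TensorProduct.lift (Bal₃.inl f g f' g' ∘ₗ δ) w =
      sw w fun u v => sw (d u) fun u' u'' => Bal₃.tmul f g f' g' u' u'' v := by
  rw [← sw_lift]
  simp only [LinearMap.comp_apply, ← hd, Bal₃.inl_mk]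

theorem Bal₃.lift_inr {f g : ι → Module.End ℂ V} {f' g' : κ → Module.End ℂ V}
    (δ' : V →ₗ[ℂ] Bal f' g') (d' : V →ₗ[ℂ] V ⊗[ℂ] V) (w : V ⊗[ℂ] V)
    (hd' : ∀ a, Bal.mk f' g' (d' a) = δ' a) :
    TensorProduct.lift ((Bal₃.inr f g f' g').compl₂ δ') w =
      sw w fun u v => sw (d' v) fun v' v'' => Bal₃.tmul f g f' g' u v' v'' := by
  rw [← sw_lift]
  simp only [LinearMap.compl₂_apply, ← hd', Bal₃.inr_mk]

namespace Presents

variable {F G : X → V → V} {f g : ι → Module.End ℂ V} (h : Presents F G f g)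
include h

theorem flip : Presents G F g f :=
  ⟨fun i => (h.exists_left i).imp fun _ h => h.symm,
    fun x => (h.exists_right x).imp fun _ h => h.symm⟩

theorem isBal_tmul : IsBal F G fun u v => Bal.tmul f g u v := by
  refine ⟨by constructor <;> simp, fun x u v => ?_⟩
  obtain ⟨i, h1, h2⟩ := h.exists_right x
  rw [← h1, ← h2, Bal.tmul_balanced]

theorem exists_lift {φ : V → V → W} (hφ : IsBal F G φ) :
    ∃ l : Bal f g →ₗ[ℂ] W, (∀ u v, l (Bal.tmul f g u v) = φ u v) ∧
      ∀ t, l (Bal.mk f g t) = sw t φ := by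
  have h1 : ∀ i u v, hφ.toLin (f i u) v = hφ.toLin u (g i v) := fun i u v => by
    obtain ⟨x, h1, h2⟩ := h.exists_left i
    rw [h1, h2]
    exact hφ.bal x u v
  refine ⟨Bal.lift f g hφ.toLin h1, Bal.lift_tmul f g hφ.toLin h1, fun t => ?_⟩
  rw [Bal.mk_eq_sw, map_sw]
  rfl

theorem sw_eq_of_mk_eq {φ : V → V → W} (hφ : IsBal F G φ) {s t : V ⊗[ℂ] V}
    (hst : Bal.mk f g s = Bal.mk f g t) : sw s φ = sw t φ := by
  obtain ⟨l, -, hl⟩ := h.exists_lift hφ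
  rw [← hl, ← hl, hst]

/-- The map onto each quotient is a balanced function on representatives, hence factors through the
other quotient. This compares quotients that are indexed by different base algebras. -/
theorem mk_eq_iff {f' g' : κ → Module.End ℂ V} (h' : Presents F G f' g') (s t : V ⊗[ℂ] V) :
    Bal.mk f g s = Bal.mk f g t ↔ Bal.mk f' g' s = Bal.mk f' g' t := by
  constructor <;> intro hst
  · rw [Bal.mk_eq_sw f' g', Bal.mk_eq_sw f' g', h.sw_eq_of_mk_eq h'.isBal_tmul hst]
  · rw [Bal.mk_eq_sw f g, Bal.mk_eq_sw f g, h'.sw_eq_of_mk_eq h.isBal_tmul hst]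

variable {F' G' : Y → V → V} {f' g' : κ → Module.End ℂ V} (h' : Presents F' G' f' g')

include h' in
theorem isTri_tmul : IsTri F G F' G' fun u v w => Bal₃.tmul f g f' g' u v w := by
  refine ⟨fun w => ⟨by constructor <;> simp, fun x u v => ?_⟩,
    fun u => ⟨by constructor <;> simp, fun x v w => ?_⟩⟩
  · obtain ⟨i, h1, h2⟩ := h.exists_right x
    rw [← h1, ← h2]
    exact (Submodule.Quotient.eq _).2 (Submodule.subset_span (Or.inl ⟨i, u, v, w, rfl⟩))
  · obtain ⟨i, h1, h2⟩ := h'.exists_right x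
    rw [← h1, ← h2]
    exact (Submodule.Quotient.eq _).2 (Submodule.subset_span (Or.inr ⟨i, u, v, w, rfl⟩))

include h' in
theorem exists_lift₃ {χ : V → V → V → W} (hχ : IsTri F G F' G' χ) :
    ∃ l : Bal₃ f g f' g' →ₗ[ℂ] W, ∀ u v w, l (Bal₃.tmul f g f' g' u v w) = χ u v w := by
  let χ' : V →ₗ[ℂ] V ⊗[ℂ] V →ₗ[ℂ] W :=
    { toFun := fun u => TensorProduct.lift (hχ.snd u).toLin
      map_add' := fun u u' => TensorProduct.ext' fun v w => (hχ.fst w).add_left u u' v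
      map_smul' := fun r u => TensorProduct.ext' fun v w => (hχ.fst w).smul_left r u v }
  refine ⟨(balancedSub₃ f g f' g').liftQ (TensorProduct.lift χ') ?_, fun u v w => rfl⟩
  refine Submodule.span_le.2 ?_
  rintro _ (⟨i, u, v, w, rfl⟩ | ⟨i, u, v, w, rfl⟩)
  · obtain ⟨x, h1, h2⟩ := h.exists_left i
    rw [SetLike.mem_coe, LinearMap.mem_ker, map_sub, sub_eq_zero, h1, h2]
    exact (hχ.fst w).bal x u v
  · obtain ⟨x, h1, h2⟩ := h'.exists_left i
    rw [SetLike.mem_coe, LinearMap.mem_ker, map_sub, sub_eq_zero, h1, h2]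
    exact (hχ.snd u).bal x v w

include h' in
/-- Two linear maps into a threefold balanced tensor product, evaluated on the values of two
comultiplications, agree on all representatives if this holds for trilinear functions. -/
theorem sw_mixed (δ : V →ₗ[ℂ] Bal f g) (δ' : V →ₗ[ℂ] Bal f' g') (d d' : V →ₗ[ℂ] V ⊗[ℂ] V)
    (hd : ∀ a, Bal.mk f g (d a) = δ a) (hd' : ∀ a, Bal.mk f' g' (d' a) = δ' a) (a : V)
    (H : TensorProduct.lift (Bal₃.inl f g f' g' ∘ₗ δ) (d' a) =
      TensorProduct.lift ((Bal₃.inr f g f' g').compl₂ δ') (d a))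
    {χ : V → V → V → W} (hχ : IsTri F G F' G' χ) :
    (sw (d' a) fun u v => sw (d u) fun u' u'' => χ u' u'' v) =
      sw (d a) fun u v => sw (d' v) fun v' v'' => χ u v' v'' := by
  obtain ⟨l, hl⟩ := h.exists_lift₃ h' hχ
  rw [Bal₃.lift_inl δ d _ hd, Bal₃.lift_inr δ' d' _ hd'] at H
  have := congrArg l H
  simpa only [map_sw, hl] using this

end Presents

end Presentation

/-! ### Comultiplications from maps into a balanced tensor product -/

section Construction

variable {V : Type u} {X : Type v} [AddCommGroup V] [Module ℂ V] [AddCommGroup X] [Module ℂ X]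

/-- Functions balanced like the target of a comultiplication. -/
abbrev BasedAlgebra.LBal (Q : BasedAlgebra V X) {W : Type*} [AddCommGroup W] [Module ℂ W]
    (φ : V → V → W) : Prop :=
  IsBal (fun x u => Q.m (Q.b x) u) (fun x u => Q.m (Q.b' x) u) φ

/-- A comultiplication with values in a balanced tensor product. -/
def Comult.ofBal (Q : BasedAlgebra V X) {ι : Type*} {f g : ι → Module.End ℂ V}
    (P : Presents (fun x u => Q.m (Q.b x) u) (fun x u => Q.m (Q.b' x) u) f g)
    (d : V →ₗ[ℂ] V ⊗[ℂ] V)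
    (d_e : Bal.mk f g (d Q.e) = Bal.tmul f g Q.e Q.e)
    (d_m : ∀ a a', Bal.mk f g (d (Q.m a a')) =
      sw (d a) fun u v => sw (d a') fun u' v' => Bal.tmul f g (Q.m u u') (Q.m v v'))
    (takeuchi : ∀ a x, (sw (d a) fun u v => Bal.tmul f g (Q.m u (Q.b x)) v) =
      sw (d a) fun u v => Bal.tmul f g u (Q.m v (Q.b' x)))
    (d_bl : ∀ x a, Bal.mk f g (d (Q.m (Q.b x) a)) =
      sw (d a) fun u v => Bal.tmul f g u (Q.m (Q.b x) v))
    (d_b'l : ∀ x a, Bal.mk f g (d (Q.m (Q.b' x) a)) =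
      sw (d a) fun u v => Bal.tmul f g (Q.m (Q.b' x) u) v)
    (coassoc : Coassociative (Bal.mk f g ∘ₗ d) (Bal.mk f g ∘ₗ d)) : Comult V X :=
  have key : ∀ {W : Type u} [AddCommGroup W] [Module ℂ W] {φ : V → V → W}, Q.LBal φ →
    ∃ l : Bal f g →ₗ[ℂ] W, (∀ u v, l (Bal.tmul f g u v) = φ u v) ∧
      ∀ t, l (Bal.mk f g t) = sw t φ := P.exists_lift
  have tak : ∀ {W : Type u} [AddCommGroup W] [Module ℂ W] {φ : V → V → W}, Q.LBal φ → ∀ a x,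
      (sw (d a) fun u v => φ (Q.m u (Q.b x)) v) = sw (d a) fun u v => φ u (Q.m v (Q.b' x)) :=
    fun {W _ _ φ} hφ a x => by
      obtain ⟨l, hl, -⟩ := key hφ
      simpa only [map_sw, hl] using congrArg l (takeuchi a x)
  have dm : ∀ {W : Type u} [AddCommGroup W] [Module ℂ W] {φ : V → V → W}, Q.LBal φ → ∀ a a',
      sw (d (Q.m a a')) φ =
      sw (d a) fun u v => sw (d a') fun u' v' => φ (Q.m u u') (Q.m v v') :=
    fun {W _ _ φ} hφ a a' => by
      obtain ⟨l, hl, hl'⟩ := key hφ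
      simpa only [map_sw, hl, hl'] using congrArg l (d_m a a')
  have dbl : ∀ {W : Type u} [AddCommGroup W] [Module ℂ W] {φ : V → V → W}, Q.LBal φ → ∀ x a,
      sw (d (Q.m (Q.b x) a)) φ = sw (d a) fun u v => φ u (Q.m (Q.b x) v) :=
    fun {W _ _ φ} hφ x a => by
      obtain ⟨l, hl, hl'⟩ := key hφ
      simpa only [map_sw, hl, hl'] using congrArg l (d_bl x a)
  have db'l : ∀ {W : Type u} [AddCommGroup W] [Module ℂ W] {φ : V → V → W}, Q.LBal φ → ∀ x a,
      sw (d (Q.m (Q.b' x) a)) φ = sw (d a) fun u v => φ (Q.m (Q.b' x) u) v :=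
    fun {W _ _ φ} hφ x a => by
      obtain ⟨l, hl, hl'⟩ := key hφ
      simpa only [map_sw, hl, hl'] using congrArg l (d_b'l x a)
  have de : ∀ {W : Type u} [AddCommGroup W] [Module ℂ W] {φ : V → V → W}, Q.LBal φ →
      sw (d Q.e) φ = φ Q.e Q.e := fun {W _ _ φ} hφ => by
    obtain ⟨l, hl, hl'⟩ := key hφ
    simpa only [map_sw, hl, hl'] using congrArg l d_e
  -- By the Takeuchi condition, multiplication from the left by `d(a)` preserves balanced functions.
  have mul : ∀ {W : Type u} [AddCommGroup W] [Module ℂ W] {φ : V → V → W}, Q.LBal φ → ∀ a,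
      Q.LBal fun u' v' => sw (d a) fun u v => φ (Q.m u u') (Q.m v v') :=
    fun {W _ _ φ} hφ a => by
      refine ⟨by constructor <;> simp [hφ.add_left, hφ.add_right, hφ.smul_left, hφ.smul_right],
        fun x u' v' => ?_⟩
      have := tak (φ := fun u v => φ (Q.m u u') (Q.m v v'))
        ⟨hφ.toIsBil.comp (Q.m.flip u').isLinear (Q.m.flip v').isLinear,
          fun x u v => by simp only [Q.assoc]; exact hφ.bal _ _ _⟩ a x
      simpa only [Q.assoc] using this
  { Q with
    d := d
    d_e := de
    d_m := dm
    takeuchi := tak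
    d_bl := dbl
    d_b'l := db'l
    d_br := fun {W _ _ φ} hφ x a => by
      rw [dm hφ, sw_comm]
      -- Writing `b(x)` as `b(x) e` shows that `d(b(x))` is the class of `e ⊗ b(x)`. Right linearity
      -- therefore follows from left linearity and multiplicativity.
      conv_lhs => rw [← Q.m_e (Q.b x)]
      rw [dbl (mul hφ a)]
      have h1 : Q.LBal fun u' v' => sw (d a) fun u v => φ (Q.m u u') (Q.m v (Q.m (Q.b x) v')) := by
        have h2 := mul hφ a
        exact ⟨h2.toIsBil.comp (F := id) LinearMap.id.isLinear (Q.m (Q.b x)).isLinear,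
          fun y u v => by
            refine (h2.bal y u _).trans ?_
            simp only [← Q.assoc, Q.b_comm]⟩
      rw [de h1]
      simp only [Q.m_e]
    d_b'r := fun {W _ _ φ} hφ x a => by
      rw [dm hφ, sw_comm]
      conv_lhs => rw [← Q.m_e (Q.b' x)]
      rw [db'l (mul hφ a)]
      have h1 : Q.LBal fun u' v' => sw (d a) fun u v => φ (Q.m u (Q.m (Q.b' x) u')) (Q.m v v') := by
        have h2 := mul hφ a
        exact ⟨h2.toIsBil.comp (G := id) (Q.m (Q.b' x)).isLinear LinearMap.id.isLinear,
          fun y u v => by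
            refine Eq.trans ?_ (h2.bal y _ v)
            simp only [← Q.assoc, Q.b_comm]⟩
      rw [de h1]
      simp only [Q.m_e]
    coassoc := fun {W _ _ χ} hχ a => P.sw_mixed P (Bal.mk f g ∘ₗ d) (Bal.mk f g ∘ₗ d) d d
      (fun _ => rfl) (fun _ => rfl) a (coassoc a (d a) (d a) rfl rfl) hχ }

end Construction

end MultHopf

/-! ### Multipliers of a balanced tensor product over a unital algebra -/

namespace MultHopf

/-- Evaluating the two outer arguments at the unit turns the multiplier form of coassociativity into
the ordinary one. -/
theorem CommuteOnLegs.coassociative {V : Type*} [AddCommGroup V] [Module ℂ V] {ι κ : Type*}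
    {f g : ι → Module.End ℂ V} {f' g' : κ → Module.End ℂ V} {T : V →ₗ[ℂ] V →ₗ[ℂ] Bal f g}
    {T' : V →ₗ[ℂ] V →ₗ[ℂ] Bal f' g'} (h : CommuteOnLegs T T') (e : V) :
    Coassociative (T e) (T'.flip e) :=
  fun b v w hv hw => h e b e v w hv hw

section Multipliers

variable {V : Type u} {X : Type v} [AddCommGroup V] [Module ℂ V] [AddCommGroup X] [Module ℂ X]
  {Q : BasedAlgebra V X} {ι : Type*}

/-- The tensor system belongs to a based algebra. -/
structure TensorSystem.Belongs (sys : TensorSystem V ι) (Q : BasedAlgebra V X) : Prop extends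
    Presents (fun x u => Q.m (Q.b x) u) (fun x u => Q.m (Q.b' x) u) sys.f sys.g where
  ρ_apply : ∀ a u, sys.ρ a u = Q.m u a

namespace TensorSystem.Belongs

variable {sys : TensorSystem V ι} (P : sys.Belongs Q)
include P

theorem act₁_tmul (a u v : V) : sys.act₁ a (sys.tmul u v) = sys.tmul (Q.m u a) v :=
  congrArg (fun z => sys.tmul z v) (P.ρ_apply a u)

theorem act₂_tmul (a u v : V) : sys.act₂ a (sys.tmul u v) = sys.tmul u (Q.m v a) :=
  congrArg (fun z => sys.tmul u z) (P.ρ_apply a v)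

theorem act₁_e (w : sys.Tensor) : sys.act₁ Q.e w = w := by
  have : sys.act₁ Q.e = LinearMap.id := Bal.hom_ext fun a b => by
    rw [P.act₁_tmul, Q.m_e]; rfl
  rw [this]; rfl

theorem act₂_e (w : sys.Tensor) : sys.act₂ Q.e w = w := by
  have : sys.act₂ Q.e = LinearMap.id := Bal.hom_ext fun a b => by
    rw [P.act₂_tmul, Q.m_e]; rfl
  rw [this]; rfl

theorem nondegenerate : sys.Nondegenerate :=
  ⟨fun w h => by rw [← P.act₁_e w, h], fun w h => by rw [← P.act₂_e w, h]⟩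

theorem slice₁_eq (nd : sys.Nondegenerate) (T : sys.multipliers) (a : V) :
    TensorSystem.slice₁ nd T a = T.1 (sys.tmul a Q.e) := by
  rw [← TensorSystem.act₂_slice₁ nd, P.act₂_e]

theorem slice₂_eq (nd : sys.Nondegenerate) (T : sys.multipliers) (b : V) :
    TensorSystem.slice₂ nd T b = T.1 (sys.tmul Q.e b) := by
  rw [← TensorSystem.act₁_slice₂ nd, P.act₁_e]

/-- Because `T(u ⊗ v)` is obtained from `T(1 ⊗ 1)` by the actions of `u ⊗ 1` and `1 ⊗ v`, a
multiplier carries no more information than the single class `T(1 ⊗ 1)`. -/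
theorem multiplier_apply (T : sys.multipliers) {t : V ⊗[ℂ] V}
    (ht : Bal.mk _ _ t = T.1 (sys.tmul Q.e Q.e)) (u v : V) :
    T.1 (sys.tmul u v) = sw t fun p q => sys.tmul (Q.m p u) (Q.m q v) := by
  have nd := P.nondegenerate
  rw [← TensorSystem.act₂_slice₁ nd, P.slice₁_eq, ← TensorSystem.act₁_slice₂ nd, P.slice₂_eq, ← ht,
    Bal.mk_eq_sw, map_sw, map_sw]
  congr 1
  funext p q
  exact (congrArg _ (P.act₁_tmul _ _ _)).trans (P.act₂_tmul _ _ _)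

end TensorSystem.Belongs

/-- The comultiplication on a unital algebra given by a unital homomorphism into an algebra of
multipliers. -/
noncomputable def Comult.ofMultipliers {sys : TensorSystem V ι} (P : sys.Belongs Q)
    (Δ : V →ₗ[ℂ] sys.multipliers) (Δ_e : (Δ Q.e).1 = 1)
    (Δ_m : ∀ a a', (Δ (Q.m a a')).1 = (Δ a).1 * (Δ a').1)
    (Δ_b : ∀ x a, ∃ l : Module.End ℂ sys.Tensor,
      (∀ u v, l (sys.tmul u v) = sys.tmul u (Q.m (Q.b x) v)) ∧ (Δ (Q.m (Q.b x) a)).1 = l * (Δ a).1)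
    (Δ_b' : ∀ x a, ∃ l : Module.End ℂ sys.Tensor,
      (∀ u v, l (sys.tmul u v) = sys.tmul (Q.m (Q.b' x) u) v) ∧
        (Δ (Q.m (Q.b' x) a)).1 = l * (Δ a).1)
    (nd : sys.Nondegenerate)
    (coassoc : CommuteOnLegs (TensorSystem.slice₁ nd ∘ₗ Δ).flip (TensorSystem.slice₂ nd ∘ₗ Δ)) :
    Comult V X :=
  have h := Bal.exists_section _ _ ((LinearMap.applyₗ (sys.tmul Q.e Q.e)) ∘ₗ
    sys.multipliers.subtype ∘ₗ Δ)
  have hd : ∀ a, Bal.mk sys.f sys.g (h.choose a) = (Δ a).1 (sys.tmul Q.e Q.e) := h.choose_spec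
  have happ : ∀ a u v, (Δ a).1 (sys.tmul u v) = sw (h.choose a) fun p q =>
    sys.tmul (Q.m p u) (Q.m q v) := fun a => P.multiplier_apply _ (hd a)
  Comult.ofBal Q P.toPresents h.choose
    (by rw [hd, Δ_e]; rfl)
    (fun a a' => by
      rw [hd, Δ_m, Module.End.mul_apply, ← hd, Bal.mk_eq_sw, map_sw, sw_comm]
      exact congrArg _ (funext fun p => funext fun q => happ a p q))
    (fun a x => by
      -- The Takeuchi condition is automatic for a multiplier: apply `Δ(a)` to the two expressions
      -- `b(x) ⊗ 1 = 1 ⊗ b'(x)` of one element.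
      have h1 := P.toPresents.isBal_tmul.bal x Q.e Q.e
      have h2 := (happ a _ _).symm.trans ((congrArg (Δ a).1 h1).trans (happ a _ _))
      simpa only [Q.m_e] using h2)
    (fun x a => by
      obtain ⟨l, hl, hΔ⟩ := Δ_b x a
      rw [hd, hΔ, Module.End.mul_apply, ← hd, Bal.mk_eq_sw, map_sw]
      exact congrArg _ (funext fun p => funext fun q => hl p q))
    (fun x a => by
      obtain ⟨l, hl, hΔ⟩ := Δ_b' x a
      rw [hd, hΔ, Module.End.mul_apply, ← hd, Bal.mk_eq_sw, map_sw]
      exact congrArg _ (funext fun p => funext fun q => hl p q))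
    (by
      have h1 := coassoc.coassociative Q.e
      have h2 : (TensorSystem.slice₁ nd ∘ₗ Δ).flip Q.e = Bal.mk sys.f sys.g ∘ₗ h.choose := by
        ext a; exact (P.slice₁_eq nd (Δ a) _).trans (hd a).symm
      have h3 : (TensorSystem.slice₂ nd ∘ₗ Δ).flip Q.e = Bal.mk sys.f sys.g ∘ₗ h.choose := by
        ext a; exact (P.slice₂_eq nd (Δ a) _).trans (hd a).symm
      rw [h2, h3] at h1
      exact h1)

theorem Comult.mk_ofMultipliers_d {sys : TensorSystem V ι} (P : sys.Belongs Q)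
    (Δ : V →ₗ[ℂ] sys.multipliers) (Δ_e Δ_m Δ_b Δ_b' nd coassoc) (a : V) :
    Bal.mk sys.f sys.g ((Comult.ofMultipliers P Δ Δ_e Δ_m Δ_b Δ_b' nd coassoc).d a) =
      (Δ a).1 (sys.tmul Q.e Q.e) :=
  (Bal.exists_section _ _ ((LinearMap.applyₗ (sys.tmul Q.e Q.e)) ∘ₗ
    sys.multipliers.subtype ∘ₗ Δ)).choose_spec a

namespace Comult

variable (D : Comult V X) {sys : TensorSystem V ι} (P : sys.Belongs D.toBasedAlgebra)

/-- Functions balanced like the target of `d`, after multiplication by `d(a)`. -/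
theorem LBal.comul_mul {D : Comult V X} {W : Type u} [AddCommGroup W] [Module ℂ W]
    {φ : V → V → W} (hφ : D.LBal φ) (a : V) :
    D.LBal fun u v => sw (D.d a) fun p q => φ (D.m p u) (D.m q v) := by
  refine ⟨by constructor <;> simp [hφ.add_left, hφ.add_right, hφ.smul_left, hφ.smul_right],
    fun x u v => ?_⟩
  have := D.takeuchi (LBal.mul_right (LBal.mul_left hφ u) v) a x
  simpa only [D.assoc] using this

include P in
theorem lbal_tmul : D.LBal fun u v => sys.tmul u v := P.toPresents.isBal_tmul

-- Conversely, left multiplication by a representative of `d(a)` descends to the quotient because of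
-- the Takeuchi condition. The required elements `T(u ⊗ 1)` and `T(1 ⊗ v)` are obtained by
-- multiplying one leg only.
include P in
theorem exists_multiplier (a : V) : ∃ T : sys.multipliers, ∀ u v,
    T.1 (sys.tmul u v) = sw (D.d a) fun p q => sys.tmul (D.m p u) (D.m q v) := by
  obtain ⟨T, hT, -⟩ := P.toPresents.exists_lift (LBal.comul_mul (D.lbal_tmul P) a)
  refine ⟨⟨T, fun u => ⟨sw (D.d a) fun p q => sys.tmul (D.m p u) q, fun v => ?_⟩,
    fun v => ⟨sw (D.d a) fun p q => sys.tmul p (D.m q v), fun u => ?_⟩⟩, hT⟩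
  · rw [hT, map_sw]
    exact congrArg _ (funext fun p => funext fun q => (P.act₂_tmul _ _ _).symm)
  · rw [hT, map_sw]
    exact congrArg _ (funext fun p => funext fun q => (P.act₁_tmul _ _ _).symm)

/-- The multipliers given by the values of a comultiplication. -/
noncomputable def toMultipliers : V →ₗ[ℂ] sys.multipliers where
  toFun a := (D.exists_multiplier P a).choose
  map_add' a a' := by
    ext1
    refine Bal.hom_ext fun u v => ?_
    refine ((D.exists_multiplier P (a + a')).choose_spec u v).trans ?_
    refine Eq.trans ?_ (congrArg₂ (· + ·) ((D.exists_multiplier P a).choose_spec u v)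
      ((D.exists_multiplier P a').choose_spec u v)).symm
    have h : IsBil fun p q => sys.tmul (D.m p u) (D.m q v) := by constructor <;> simp
    rw [map_add, h.sw_add]
  map_smul' r a := by
    ext1
    refine Bal.hom_ext fun u v => ?_
    refine ((D.exists_multiplier P (r • a)).choose_spec u v).trans ?_
    refine Eq.trans ?_ (congrArg (r • ·) ((D.exists_multiplier P a).choose_spec u v)).symm
    have h : IsBil fun p q => sys.tmul (D.m p u) (D.m q v) := by constructor <;> simp
    rw [map_smul, h.sw_smul]

theorem toMultipliers_apply (a u v : V) : (D.toMultipliers P a).1 (sys.tmul u v) =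
    sw (D.d a) fun p q => sys.tmul (D.m p u) (D.m q v) :=
  (D.exists_multiplier P a).choose_spec u v

theorem toMultipliers_e : (D.toMultipliers P D.e).1 = 1 :=
  Bal.hom_ext fun u v => (D.toMultipliers_apply P _ u v).trans <| by
    rw [D.d_e (φ := fun p q => sys.tmul (D.m p u) (D.m q v))
      (LBal.mul_right (LBal.mul_left (D.lbal_tmul P) u) v), D.e_m, D.e_m]
    rfl

theorem toMultipliers_m (a a' : V) : (D.toMultipliers P (D.m a a')).1 =
    (D.toMultipliers P a).1 * (D.toMultipliers P a').1 :=
  Bal.hom_ext fun u v => (D.toMultipliers_apply P _ u v).trans <| by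
    rw [D.d_m (φ := fun p q => sys.tmul (D.m p u) (D.m q v))
      (LBal.mul_right (LBal.mul_left (D.lbal_tmul P) u) v), Module.End.mul_apply]
    refine Eq.trans ?_ (congrArg _ (D.toMultipliers_apply P _ u v)).symm
    rw [map_sw, sw_comm]
    refine congrArg _ (funext fun p => funext fun q => ?_)
    refine Eq.trans ?_ (D.toMultipliers_apply P _ _ _).symm
    simp only [D.assoc]

theorem toMultipliers_b_mul (x : X) (a : V) (l : Module.End ℂ sys.Tensor)
    (hl : ∀ u v, l (sys.tmul u v) = sys.tmul u (D.m (D.b x) v)) :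
    (D.toMultipliers P (D.m (D.b x) a)).1 = l * (D.toMultipliers P a).1 :=
  Bal.hom_ext fun u v => (D.toMultipliers_apply P _ u v).trans <| by
    rw [D.d_bl (φ := fun p q => sys.tmul (D.m p u) (D.m q v))
      (LBal.mul_right (LBal.mul_left (D.lbal_tmul P) u) v), Module.End.mul_apply]
    refine Eq.trans ?_ (congrArg _ (D.toMultipliers_apply P _ u v)).symm
    simp only [map_sw, hl, D.assoc]

theorem toMultipliers_b'_mul (x : X) (a : V) (l : Module.End ℂ sys.Tensor)
    (hl : ∀ u v, l (sys.tmul u v) = sys.tmul (D.m (D.b' x) u) v) :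
    (D.toMultipliers P (D.m (D.b' x) a)).1 = l * (D.toMultipliers P a).1 :=
  Bal.hom_ext fun u v => (D.toMultipliers_apply P _ u v).trans <| by
    rw [D.d_b'l (φ := fun p q => sys.tmul (D.m p u) (D.m q v))
      (LBal.mul_right (LBal.mul_left (D.lbal_tmul P) u) v), Module.End.mul_apply]
    refine Eq.trans ?_ (congrArg _ (D.toMultipliers_apply P _ u v)).symm
    simp only [map_sw, hl, D.assoc]

theorem toMultipliers_mul_b (x : X) (a : V) (l : Module.End ℂ sys.Tensor)
    (hl : ∀ u v, l (sys.tmul u v) = sys.tmul u (D.m (D.b x) v)) :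
    (D.toMultipliers P (D.m a (D.b x))).1 = (D.toMultipliers P a).1 * l :=
  Bal.hom_ext fun u v => (D.toMultipliers_apply P _ u v).trans <| by
    rw [D.d_br (φ := fun p q => sys.tmul (D.m p u) (D.m q v))
      (LBal.mul_right (LBal.mul_left (D.lbal_tmul P) u) v), Module.End.mul_apply]
    refine Eq.trans ?_ (congrArg _ (hl u v)).symm
    refine Eq.trans ?_ (D.toMultipliers_apply P _ _ _).symm
    simp only [D.assoc]

theorem toMultipliers_mul_b' (x : X) (a : V) (l : Module.End ℂ sys.Tensor)
    (hl : ∀ u v, l (sys.tmul u v) = sys.tmul (D.m (D.b' x) u) v) :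
    (D.toMultipliers P (D.m a (D.b' x))).1 = (D.toMultipliers P a).1 * l :=
  Bal.hom_ext fun u v => (D.toMultipliers_apply P _ u v).trans <| by
    rw [D.d_b'r (φ := fun p q => sys.tmul (D.m p u) (D.m q v))
      (LBal.mul_right (LBal.mul_left (D.lbal_tmul P) u) v), Module.End.mul_apply]
    refine Eq.trans ?_ (congrArg _ (hl u v)).symm
    refine Eq.trans ?_ (D.toMultipliers_apply P _ _ _).symm
    simp only [D.assoc]

end Comult

end Multipliers

end MultHopf

/-! ### Mixed coassociativity and canonical maps on quotients -/

namespace MultHopf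

namespace Comult

variable {V : Type u} {X : Type v} {Y : Type w} [AddCommGroup V] [Module ℂ V] [AddCommGroup X]
  [Module ℂ X] [AddCommGroup Y] [Module ℂ Y]

/-- `(d ⊗ id) d' = (id ⊗ d') d`, together with the relations between `d`, `d'` and the base algebras that
are needed for the two sides to be well-defined. -/
structure Compatible (D : Comult V X) (D' : Comult V Y) : Prop where
  mixed : ∀ {W : Type u} [AddCommGroup W] [Module ℂ W] {χ : V → V → V → W},
    IsTri (fun x u => D.m (D.b x) u) (fun x u => D.m (D.b' x) u) (fun x u => D'.m (D'.b x) u)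
      (fun x u => D'.m (D'.b' x) u) χ → ∀ a,
      (sw (D'.d a) fun u v => sw (D.d u) fun u' u'' => χ u' u'' v) =
        sw (D.d a) fun u v => sw (D'.d v) fun v' v'' => χ u v' v''
  left : ∀ {W : Type u} [AddCommGroup W] [Module ℂ W] {φ : V → V → W}, D.LBal φ → ∀ y a,
    sw (D.d (D'.m (D'.b y) a)) φ = sw (D.d a) fun u v => φ u (D'.m (D'.b y) v)
  right : ∀ {W : Type u} [AddCommGroup W] [Module ℂ W] {φ : V → V → W}, D'.LBal φ → ∀ x a,
    sw (D'.d (D.m (D.b' x) a)) φ = sw (D'.d a) fun u v => φ (D.m (D.b' x) u) v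

theorem compatible_self (D : Comult V X) : Compatible D D :=
  ⟨D.coassoc, D.d_bl, D.d_b'l⟩

/-- For the opposite multiplication, left multiplication by `P.R.b y` is right multiplication by an
element of the range of `P.L.b`. The linearity of one comultiplication along the base of the other
is therefore its own right linearity. -/
theorem _root_.MultHopf.BiComult.compatible₁ (P : BiComult V X Y) : Compatible P.L P.R := by
  refine ⟨P.mixed₁, fun {W _ _ φ} hφ y a => ?_, fun {W _ _ φ} hφ x a => ?_⟩
  · obtain ⟨x, hx⟩ := P.exists_b y
    simp only [P.R_m, ← hx]
    exact P.L.d_br hφ x a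
  · obtain ⟨y, hy⟩ := P.exists_c' x
    simp only [← P.R_m, ← hy]
    exact P.R.d_b'r hφ y a

theorem _root_.MultHopf.BiComult.compatible₂ (P : BiComult V X Y) : Compatible P.R P.L :=
  P.op.compatible₁

variable {D : Comult V X} {D' : Comult V Y} {ι κ : Type*}
  {f g : ι → Module.End ℂ V} {f' g' : κ → Module.End ℂ V}

/-- The elements `p` and `q` are the outer arguments of the multiplier form of coassociativity. The
linearity conditions in `Compatible` make both outer maps balanced, so that arbitrary
representatives may be replaced by Sweedler sums. The claim becomes `mixed` for a function
multiplied by `p` and `q` in its outer legs. -/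
theorem Compatible.lift_eq_lift (h : Compatible D D')
    (P : Presents (fun x u => D.m (D.b x) u) (fun x u => D.m (D.b' x) u) f g)
    (P' : Presents (fun x u => D'.m (D'.b x) u) (fun x u => D'.m (D'.b' x) u) f' g') (p q : V)
    {δ : V →ₗ[ℂ] Bal f g} (hδ : ∀ u, δ u = sw (D.d u) fun s t => Bal.tmul f g (D.m s p) t)
    {δ' : V →ₗ[ℂ] Bal f' g'} (hδ' : ∀ u, δ' u = sw (D'.d u) fun s t => Bal.tmul f' g' s (D'.m t q))
    (a : V) {v w : V ⊗[ℂ] V} (hv : Bal.mk f g v = δ a) (hw : Bal.mk f' g' w = δ' a) :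
    TensorProduct.lift (Bal₃.inl f g f' g' ∘ₗ δ) w =
      TensorProduct.lift ((Bal₃.inr f g f' g').compl₂ δ') v := by
  have ht := P.isTri_tmul P'
  have ht₁ : ∀ w, D.LBal fun u v => Bal₃.tmul f g f' g' u v w := ht.fst
  have ht₂ : ∀ u, D'.LBal fun v w => Bal₃.tmul f g f' g' u v w := ht.snd
  have h1 : ∀ u v, Bal₃.inl f g f' g' (δ u) v =
      sw (D.d u) fun s t => Bal₃.tmul f g f' g' (D.m s p) t v := fun u v => by
    rw [hδ, ← LinearMap.flip_apply, map_sw]; rfl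
  have h2 : ∀ u v, Bal₃.inr f g f' g' u (δ' v) =
      sw (D'.d v) fun s t => Bal₃.tmul f g f' g' u s (D'.m t q) := fun u v => by
    rw [hδ', map_sw]; rfl
  rw [← sw_lift, ← sw_lift]
  simp only [LinearMap.comp_apply, LinearMap.compl₂_apply, h1, h2]
  have hφ₁ : D'.LBal fun u v => sw (D.d u) fun s t => Bal₃.tmul f g f' g' (D.m s p) t v := by
    refine ⟨⟨fun u u' v => ?_, fun r u v => ?_, by simp, by simp⟩, fun y u v => ?_⟩
    · rw [map_add, ((ht₁ v).mul_left p).sw_add]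
    · rw [map_smul, ((ht₁ v).mul_left p).sw_smul]
    · rw [h.left ((ht₁ v).mul_left p)]
      exact congrArg _ (funext fun s => funext fun t => (ht₂ _).bal y t v)
  have hφ₂ : D.LBal fun u v => sw (D'.d v) fun s t => Bal₃.tmul f g f' g' u s (D'.m t q) := by
    refine ⟨⟨by simp, by simp, fun u v v' => ?_, fun r u v => ?_⟩, fun x u v => ?_⟩
    · rw [map_add, ((ht₂ u).mul_right q).sw_add]
    · rw [map_smul, ((ht₂ u).mul_right q).sw_smul]
    · rw [h.right ((ht₂ u).mul_right q)]
      exact congrArg _ (funext fun s => funext fun t => (ht₁ _).bal x u s)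
  have hw' : Bal.mk f' g' w = Bal.mk f' g' (sw (D'.d a) fun s t => s ⊗ₜ[ℂ] D'.m t q) := by
    rw [hw, hδ', map_sw]; rfl
  have hv' : Bal.mk f g v = Bal.mk f g (sw (D.d a) fun s t => D.m s p ⊗ₜ[ℂ] t) := by
    rw [hv, hδ, map_sw]; rfl
  rw [P'.sw_eq_of_mk_eq hφ₁ hw', P.sw_eq_of_mk_eq hφ₂ hv', hφ₁.sw_sw_tmul, hφ₂.sw_sw_tmul]
  exact h.mixed ⟨fun w => (ht₁ _).mul_left p, fun u => (ht₂ _).mul_right q⟩ a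

theorem Compatible.coassociative (h : Compatible D D')
    (P : Presents (fun x u => D.m (D.b x) u) (fun x u => D.m (D.b' x) u) f g)
    (P' : Presents (fun x u => D'.m (D'.b x) u) (fun x u => D'.m (D'.b' x) u) f' g') :
    Coassociative (Bal.mk f g ∘ₗ D.d) (Bal.mk f' g' ∘ₗ D'.d) := fun a v w hv hw =>
  h.lift_eq_lift P P' D.e D'.e (fun u => by
    simp only [D.m_e, LinearMap.comp_apply, Bal.mk_eq_sw]) (fun u => by
    simp only [D'.m_e, LinearMap.comp_apply, Bal.mk_eq_sw]) a hv hw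

theorem slice₁_toMultipliers {sys : TensorSystem V ι} (P : sys.Belongs D.toBasedAlgebra)
    (nd : sys.Nondegenerate) (a u : V) : TensorSystem.slice₁ nd (D.toMultipliers P a) u =
      sw (D.d a) fun s t => sys.tmul (D.m s u) t := by
  rw [P.slice₁_eq, toMultipliers_apply]
  simp only [D.m_e]

theorem slice₂_toMultipliers {sys : TensorSystem V ι} (P : sys.Belongs D.toBasedAlgebra)
    (nd : sys.Nondegenerate) (a u : V) : TensorSystem.slice₂ nd (D.toMultipliers P a) u =
      sw (D.d a) fun s t => sys.tmul s (D.m t u) := by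
  rw [P.slice₂_eq, toMultipliers_apply]
  simp only [D.m_e]

theorem Compatible.commuteOnLegs (h : Compatible D D')
    {sys : TensorSystem V ι} (P : sys.Belongs D.toBasedAlgebra) (nd : sys.Nondegenerate)
    {sys' : TensorSystem V κ} (P' : sys'.Belongs D'.toBasedAlgebra) (nd' : sys'.Nondegenerate) :
    CommuteOnLegs (TensorSystem.slice₁ nd ∘ₗ D.toMultipliers P).flip
      (TensorSystem.slice₂ nd' ∘ₗ D'.toMultipliers P') := fun a b c _ _ hv hw =>
  h.lift_eq_lift P.toPresents P'.toPresents a c (fun u => slice₁_toMultipliers P nd u a)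
    (fun u => slice₂_toMultipliers P' nd' u c) b hv hw

/-- The canonical map `p ⊗ q ↦ d(p) (1 ⊗ q)` between balanced tensor products. -/
structure IsCanonical (D : Comult V X) (Θ : Bal f' g' →ₗ[ℂ] Bal f g) : Prop where
  target : Presents (fun x u => D.m (D.b x) u) (fun x u => D.m (D.b' x) u) f g
  source : Presents (fun x u => D.m u (D.b x)) (fun x u => D.m (D.b x) u) f' g'
  apply : ∀ p q, Θ (Bal.tmul f' g' p q) = sw (D.d p) fun u v => Bal.tmul f g u (D.m v q)

variable {Θ : Bal f' g' →ₗ[ℂ] Bal f g}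

/-- The map induced by `u ⊗ v ↦ κ(u)(1 ⊗ v)` is a two-sided inverse; the fields `left_inv` and
`right_inv`, multiplied by an element in the second leg, say precisely this. -/
theorem IsCanonical.bijective (h : D.IsCanonical Θ) (K : Translation D) :
    Function.Bijective Θ := by
  have ht : D.LBal fun u v => Bal.tmul f g u v := h.target.isBal_tmul
  have ht' : D.MBal fun u v => Bal.tmul f' g' u v := h.source.isBal_tmul
  obtain ⟨l, hl, -⟩ := h.target.exists_lift (K.lbal_κ ht')
  have h1 : l ∘ₗ Θ = LinearMap.id := Bal.hom_ext fun p q => by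
    rw [LinearMap.comp_apply, h.apply, map_sw]
    simp only [hl]
    have := K.left_inv (ht'.mul_right q) p
    simpa only [D.assoc, D.e_m, LinearMap.id_apply] using this
  have h2 : Θ ∘ₗ l = LinearMap.id := Bal.hom_ext fun u v => by
    rw [LinearMap.comp_apply, hl, map_sw]
    simp only [h.apply]
    have := K.right_inv (ht.mul_right v) u
    simpa only [D.assoc, D.e_m, LinearMap.id_apply] using this
  exact Function.bijective_iff_has_inverse.2
    ⟨l, LinearMap.congr_fun h1, LinearMap.congr_fun h2⟩

theorem IsCanonical.exists_translation (h : D.IsCanonical Θ) (hΘ : Function.Bijective Θ) :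
    Nonempty (Translation D) := by
  have ht : D.LBal fun u v => Bal.tmul f g u v := h.target.isBal_tmul
  have ht' : D.MBal fun u v => Bal.tmul f' g' u v := h.source.isBal_tmul
  let E := LinearEquiv.ofBijective Θ hΘ
  obtain ⟨κ, hκ⟩ := Bal.exists_section f' g' (E.symm.toLinearMap ∘ₗ (Bal.tmul f g).flip D.e)
  have h1 : ∀ a, Θ (Bal.mk f' g' (κ a)) = Bal.tmul f g a D.e := fun a => by
    rw [hκ]; exact E.apply_symm_apply _
  have h2 : ∀ a, (sw (κ a) fun p q => sw (D.d p) fun u v => Bal.tmul f g u (D.m v q)) =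
      Bal.tmul f g a D.e := fun a => by
    rw [← h1, Bal.mk_eq_sw, map_sw]; simp only [h.apply]
  -- The canonical map commutes with right multiplication in the second leg. Its inverse is thus
  -- determined by the preimages of `u ⊗ 1`.
  have h3 : ∀ u v, E.symm (Bal.tmul f g u v) =
      sw (κ u) fun p q => Bal.tmul f' g' p (D.m q v) := fun u v => by
    rw [LinearEquiv.symm_apply_eq]
    refine Eq.trans ?_ (map_sw Θ _ _).symm
    simp only [h.apply]
    obtain ⟨l, hl, -⟩ := h.target.exists_lift (ht.mul_right v)
    have h4 := congrArg l (h2 u)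
    simp only [map_sw, hl, D.e_m, D.assoc] at h4
    exact h4.symm
  refine ⟨⟨κ, fun {W _ _ φ} hφ a => ?_, fun {W _ _ ψ} hψ a => ?_, fun {W _ _ ψ} hψ x a => ?_⟩⟩
  · obtain ⟨l, hl, -⟩ := h.target.exists_lift hφ
    simpa only [map_sw, hl] using congrArg l (h2 a)
  · obtain ⟨l, hl, -⟩ := h.source.exists_lift hψ
    have h4 := congrArg E.symm (h.apply a D.e)
    have h5 : E.symm (Θ (Bal.tmul f' g' a D.e)) = Bal.tmul f' g' a D.e := E.symm_apply_apply _
    rw [h5, ← LinearEquiv.coe_coe, map_sw] at h4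
    simp only [LinearEquiv.coe_coe, h3, D.m_e] at h4
    simpa only [map_sw, hl] using (congrArg l h4).symm
  · obtain ⟨l, hl, -⟩ := h.source.exists_lift hψ
    have h4 := congrArg E.symm (ht.bal x a D.e)
    simp only [h3, D.m_e] at h4
    simpa only [map_sw, hl] using congrArg l h4

/-- The exchange of the two factors of a balanced tensor product. -/
noncomputable def _root_.MultHopf.Bal.swap (f g : ι → Module.End ℂ V) : Bal f g →ₗ[ℂ] Bal g f :=
  Bal.lift f g (Bal.tmul g f).flip fun i u v => (Bal.tmul_balanced g f i v u).symm

theorem _root_.MultHopf.Bal.swap_tmul (f g : ι → Module.End ℂ V) (u v : V) :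
    Bal.swap f g (Bal.tmul f g u v) = Bal.tmul g f v u := rfl

theorem _root_.MultHopf.Bal.swap_swap (f g : ι → Module.End ℂ V) :
    Bal.swap g f ∘ₗ Bal.swap f g = LinearMap.id :=
  Bal.hom_ext fun _ _ => rfl

theorem _root_.MultHopf.Bal.swap_bijective (f g : ι → Module.End ℂ V) :
    Function.Bijective (Bal.swap f g) :=
  Function.bijective_iff_has_inverse.2 ⟨Bal.swap g f,
    LinearMap.congr_fun (Bal.swap_swap f g), LinearMap.congr_fun (Bal.swap_swap g f)⟩

/-- The canonical map `q ⊗ p ↦ d(p) (q ⊗ 1)` between balanced tensor products. -/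
structure IsCanonical' (D : Comult V X) (Θ : Bal f' g' →ₗ[ℂ] Bal f g) : Prop where
  target : Presents (fun x u => D.m (D.b x) u) (fun x u => D.m (D.b' x) u) f g
  source : Presents (fun x u => D.m (D.b' x) u) (fun x u => D.m u (D.b' x)) f' g'
  apply : ∀ q p, Θ (Bal.tmul f' g' q p) = sw (D.d p) fun u v => Bal.tmul f g (D.m u q) v

/-- Conjugation with flips turns `q ⊗ p ↦ d(p)(q ⊗ 1)` into the first canonical map of the
co-opposite, so the second canonical map needs no separate treatment. -/
theorem IsCanonical'.cop (h : D.IsCanonical' Θ) :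
    D.cop.IsCanonical (Bal.swap f g ∘ₗ Θ ∘ₗ Bal.swap g' f') where
  target := h.target.flip
  source := h.source.flip
  apply p q := by
    rw [LinearMap.comp_apply, LinearMap.comp_apply, Bal.swap_tmul, h.apply, map_sw,
      sw_cop_d _ _ (by constructor <;> simp)]
    rfl

theorem IsCanonical'.bijective_iff (_ : D.IsCanonical' Θ) : Function.Bijective Θ ↔
    Function.Bijective (Bal.swap f g ∘ₗ Θ ∘ₗ Bal.swap g' f') := by
  rw [LinearMap.coe_comp, LinearMap.coe_comp, (Bal.swap_bijective f g).of_comp_iff',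
    Function.Bijective.of_comp_iff _ (Bal.swap_bijective g' f')]

theorem IsCanonical'.bijective (h : D.IsCanonical' Θ) (K : Translation D.cop) :
    Function.Bijective Θ :=
  h.bijective_iff.2 (h.cop.bijective K)

theorem IsCanonical'.exists_translation (h : D.IsCanonical' Θ) (hΘ : Function.Bijective Θ) :
    Nonempty (Translation D.cop) :=
  h.cop.exists_translation (h.bijective_iff.1 hΘ)

end Comult

end MultHopf

/-! ### Comultiplications from unital multiplier bialgebroids -/

namespace MultHopf

namespace Multiplier

variable {A : Type*} [Ring A] [Algebra ℂ A]

/-- The element of a unital algebra that corresponds to a multiplier. -/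
def val : Multiplier A →ₗ[ℂ] A where
  toFun T := T.l 1
  map_add' _ _ := rfl
  map_smul' _ _ := rfl

theorem l_apply (T : Multiplier A) (a : A) : T.l a = val T * a := by
  conv_lhs => rw [← one_mul a]
  exact T.l_mul 1 a

theorem val_eq_r (T : Multiplier A) : val T = T.r 1 := by
  have h := T.2.2.2 1 1
  rwa [one_mul, mul_one] at h

theorem r_apply (T : Multiplier A) (a : A) : T.r a = a * val T := by
  rw [val_eq_r]
  conv_lhs => rw [← mul_one a]
  exact T.r_mul a 1

/-- In the presence of a unit both components of a double centralizer are multiplications by one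
element, which identifies `M(A)` with `A`. -/
theorem val_injective : Function.Injective (val : Multiplier A →ₗ[ℂ] A) := fun S T h => by
  have h1 : S.l = T.l := LinearMap.ext fun a => by rw [l_apply, l_apply, h]
  have h2 : S.r = T.r := LinearMap.ext fun a => by rw [r_apply, r_apply, h]
  exact Subtype.ext (Prod.ext h1 (MulOpposite.unop_injective h2))

theorem val_mul (S T : Multiplier A) : val (S * T) = val S * val T :=
  (l_apply S (T.l 1))

theorem val_one : val (1 : Multiplier A) = 1 := rfl

/-- The multiplier given by an element. -/
def ofElem (a : A) : Multiplier A :=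
  ⟨(LinearMap.mulLeft ℂ a, MulOpposite.op (LinearMap.mulRight ℂ a)),
    fun _ _ => (mul_assoc _ _ _).symm, fun _ _ => mul_assoc _ _ _, fun _ _ => (mul_assoc _ _ _).symm⟩

theorem val_ofElem (a : A) : val (ofElem a) = a := mul_one a

end Multiplier

section OneSided

variable {A : Type u} [Ring A] [Algebra ℂ A]

namespace LeftMultiplierBialgebroid

variable {B : Type v} [NonUnitalRing B] [Module ℂ B] (𝓛 : LeftMultiplierBialgebroid A B)
  {o : B} (hs : 𝓛.s o = 1) (ht : 𝓛.t o = 1)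

/-- The algebra `A` with the maps `s` and `t`. -/
def based : BasedAlgebra A B where
  m := LinearMap.mul ℂ A
  e := 1
  assoc := mul_assoc
  e_m := one_mul
  m_e := mul_one
  b := Multiplier.val ∘ₗ 𝓛.s
  b' := Multiplier.val ∘ₗ 𝓛.t
  μ x y := x * y
  o := o
  b_inj := (injective_iff_map_eq_zero _).2 fun x hx => 𝓛.s_faithful x fun a => by
    rw [Multiplier.l_apply]
    exact (congrArg (· * a) hx).trans (zero_mul a)
  b'_inj := (injective_iff_map_eq_zero _).2 fun x hx => 𝓛.t_faithful x fun a => by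
    rw [Multiplier.l_apply]
    exact (congrArg (· * a) hx).trans (zero_mul a)
  b_o := by rw [LinearMap.comp_apply, hs, Multiplier.val_one]
  b'_o := by rw [LinearMap.comp_apply, ht, Multiplier.val_one]
  b_μ x y := by
    simp only [LinearMap.comp_apply, 𝓛.s_mul, Multiplier.val_mul]; rfl
  b'_μ x y := by
    simp only [LinearMap.comp_apply, 𝓛.t_mul, Multiplier.val_mul]; rfl
  b_comm x y := by
    have h := congrArg Multiplier.val (𝓛.comm x y)
    rwa [Multiplier.val_mul, Multiplier.val_mul] at h

theorem belongs : 𝓛.sys.Belongs (𝓛.based hs ht) where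
  toPresents := .of_eq (fun _ _ => Multiplier.l_apply _ _) (fun _ _ => Multiplier.l_apply _ _)
  ρ_apply _ _ := rfl

variable (h1 : (𝓛.Δ 1).1 = 1)

/-- The comultiplication of a unital left multiplier bialgebroid. -/
noncomputable def toComult : Comult A B :=
  Comult.ofMultipliers (𝓛.belongs hs ht) 𝓛.Δ h1 𝓛.Δ_mul
    (fun x a => ⟨_, fun u v => congrArg (𝓛.sys.tmul u) (Multiplier.l_apply (𝓛.s x) v),
      (congrArg (fun z => (𝓛.Δ z).1) (Multiplier.l_apply (𝓛.s x) a).symm).trans (𝓛.Δ_s_left x a)⟩)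
    (fun x a => ⟨_, fun u v => congrArg (fun z => 𝓛.sys.tmul z v) (Multiplier.l_apply (𝓛.t x) u),
      (congrArg (fun z => (𝓛.Δ z).1) (Multiplier.l_apply (𝓛.t x) a).symm).trans (𝓛.Δ_t_left x a)⟩)
    𝓛.tensor_nondeg 𝓛.coassoc

theorem mk_d (a : A) : Bal.mk _ _ ((𝓛.toComult hs ht h1).d a) =
    (𝓛.Δ a).1 (𝓛.sys.tmul 1 1) :=
  Comult.mk_ofMultipliers_d (𝓛.belongs hs ht) 𝓛.Δ _ _ _ _ _ _ a

theorem preTrho_apply (a b : A) : 𝓛.preTrho a b =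
    sw ((𝓛.toComult hs ht h1).d a) fun u v => 𝓛.sys.tmul u (v * b) := by
  refine ((𝓛.belongs hs ht).slice₂_eq 𝓛.tensor_nondeg _ _).trans ?_
  refine ((𝓛.belongs hs ht).multiplier_apply _ (𝓛.mk_d hs ht h1 a) _ _).trans ?_
  exact congrArg _ (funext fun u => funext fun v => congrArg (fun z => 𝓛.sys.tmul z _) (mul_one u))

theorem preTlam_apply (a b : A) : 𝓛.preTlam a b =
    sw ((𝓛.toComult hs ht h1).d b) fun u v => 𝓛.sys.tmul (u * a) v := by
  refine ((𝓛.belongs hs ht).slice₁_eq 𝓛.tensor_nondeg _ _).trans ?_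
  refine ((𝓛.belongs hs ht).multiplier_apply _ (𝓛.mk_d hs ht h1 b) _ _).trans ?_
  exact congrArg _ (funext fun u => funext fun v => congrArg (fun z => 𝓛.sys.tmul _ z) (mul_one v))

end LeftMultiplierBialgebroid

namespace RightMultiplierBialgebroid

variable {C : Type v} [NonUnitalRing C] [Module ℂ C] (𝓡 : RightMultiplierBialgebroid A C)
  {o : C} (hs : 𝓡.s o = 1) (ht : 𝓡.t o = 1)

/-- The opposite of the algebra `A` with the maps `t` and `s`. -/
def based : BasedAlgebra A C where
  m := (LinearMap.mul ℂ A).flip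
  e := 1
  assoc _ _ _ := (mul_assoc _ _ _).symm
  e_m := mul_one
  m_e := one_mul
  b := Multiplier.val ∘ₗ 𝓡.t
  b' := Multiplier.val ∘ₗ 𝓡.s
  μ x y := x * y
  o := o
  b_inj := (injective_iff_map_eq_zero _).2 fun x hx => 𝓡.t_faithful x fun a => by
    rw [Multiplier.r_apply]
    exact (congrArg (a * ·) hx).trans (mul_zero a)
  b'_inj := (injective_iff_map_eq_zero _).2 fun x hx => 𝓡.s_faithful x fun a => by
    rw [Multiplier.r_apply]
    exact (congrArg (a * ·) hx).trans (mul_zero a)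
  b_o := by rw [LinearMap.comp_apply, ht, Multiplier.val_one]
  b'_o := by rw [LinearMap.comp_apply, hs, Multiplier.val_one]
  b_μ x y := by
    simp only [LinearMap.comp_apply, 𝓡.t_mul, Multiplier.val_mul]; rfl
  b'_μ x y := by
    simp only [LinearMap.comp_apply, 𝓡.s_mul, Multiplier.val_mul]; rfl
  b_comm x y := by
    have h := congrArg Multiplier.val (𝓡.comm y x)
    rwa [Multiplier.val_mul, Multiplier.val_mul] at h

theorem belongs : 𝓡.sys.Belongs (𝓡.based hs ht) where
  toPresents := .of_eq (fun _ _ => Multiplier.r_apply _ _) (fun _ _ => Multiplier.r_apply _ _)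
  ρ_apply _ _ := rfl

variable (h1 : (𝓡.Δ 1).1 = 1)

/-- The comultiplication of a unital right multiplier bialgebroid. -/
noncomputable def toComult : Comult A C :=
  Comult.ofMultipliers (𝓡.belongs hs ht) 𝓡.Δ h1 (fun a a' => 𝓡.Δ_mul a' a)
    (fun x a => ⟨_, fun u v => congrArg (𝓡.sys.tmul u) (Multiplier.r_apply (𝓡.t x) v),
      (congrArg (fun z => (𝓡.Δ z).1) (Multiplier.r_apply (𝓡.t x) a).symm).trans
        (𝓡.Δ_t_right x a)⟩)
    (fun x a => ⟨_, fun u v => congrArg (fun z => 𝓡.sys.tmul z v) (Multiplier.r_apply (𝓡.s x) u),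
      (congrArg (fun z => (𝓡.Δ z).1) (Multiplier.r_apply (𝓡.s x) a).symm).trans
        (𝓡.Δ_s_right x a)⟩)
    𝓡.tensor_nondeg 𝓡.coassoc

theorem mk_d (a : A) : Bal.mk _ _ ((𝓡.toComult hs ht h1).d a) =
    (𝓡.Δ a).1 (𝓡.sys.tmul 1 1) :=
  Comult.mk_ofMultipliers_d (𝓡.belongs hs ht) 𝓡.Δ _ _ _ _ _ _ a

theorem preTrho_apply (a b : A) : 𝓡.preTrho a b =
    sw ((𝓡.toComult hs ht h1).d a) fun u v => 𝓡.sys.tmul u (b * v) := by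
  refine ((𝓡.belongs hs ht).slice₂_eq 𝓡.tensor_nondeg _ _).trans ?_
  refine ((𝓡.belongs hs ht).multiplier_apply _ (𝓡.mk_d hs ht h1 a) _ _).trans ?_
  exact congrArg _ (funext fun u => funext fun v => congrArg (fun z => 𝓡.sys.tmul z _) (one_mul u))

theorem preTlam_apply (a b : A) : 𝓡.preTlam a b =
    sw ((𝓡.toComult hs ht h1).d b) fun u v => 𝓡.sys.tmul (a * u) v := by
  refine ((𝓡.belongs hs ht).slice₁_eq 𝓡.tensor_nondeg _ _).trans ?_
  refine ((𝓡.belongs hs ht).multiplier_apply _ (𝓡.mk_d hs ht h1 b) _ _).trans ?_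
  exact congrArg _ (funext fun u => funext fun v => congrArg (fun z => 𝓡.sys.tmul _ z) (one_mul v))

end RightMultiplierBialgebroid

end OneSided

end MultHopf

/-! ### Counit conditions in terms of Sweedler sums -/

namespace MultHopf

/-- A linear map on the quotient gives the same value on all finite representations, and at least
one representation exists. This reduces every condition stated for all representatives to an
evaluation. -/
theorem Bal.forall_sum_iff {V W : Type*} [AddCommGroup V] [Module ℂ V] [AddCommGroup W]
    [Module ℂ W] {ι : Type*} {f g : ι → Module.End ℂ V} {φ : V → V → W} (l : Bal f g →ₗ[ℂ] W)
    (hl : ∀ u v, l (Bal.tmul f g u v) = φ u v) (w : Bal f g) (z : W) :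
    (∀ (n : ℕ) (c d : Fin n → V), w = ∑ i, Bal.tmul f g (c i) (d i) → ∑ i, φ (c i) (d i) = z) ↔
      l w = z := by
  constructor
  · intro h
    obtain ⟨t, rfl⟩ := Submodule.mkQ_surjective _ w
    obtain ⟨s, hs⟩ := TensorProduct.exists_finset t
    have h1 : t = ∑ i : Fin s.card, (s.equivFin.symm i).1.1 ⊗ₜ[ℂ] (s.equivFin.symm i).1.2 := by
      rw [hs, ← Finset.sum_coe_sort s, ← Equiv.sum_comp s.equivFin.symm]
    have h2 : (balancedSub f g).mkQ t = ∑ i : Fin s.card,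
        Bal.tmul f g (s.equivFin.symm i).1.1 (s.equivFin.symm i).1.2 := by
      conv_lhs => rw [h1, map_sum]
      rfl
    rw [← h _ _ _ h2, h2, map_sum]
    simp only [hl]
  · rintro rfl n c d rfl
    simp only [map_sum, hl]

variable {A : Type u} [Ring A] [Algebra ℂ A]

namespace LeftMultiplierBialgebroid

variable {B : Type v} [NonUnitalRing B] [Module ℂ B]

/-- The comultiplication of the left multiplier bialgebroid on a unital algebra is given by `D`. -/
structure Realizes (𝓛 : LeftMultiplierBialgebroid A B) (D : Comult A B) : Prop where
  m_apply : ∀ u v, D.m u v = u * v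
  e_eq : D.e = 1
  b_apply : ∀ x, D.b x = Multiplier.val (𝓛.s x)
  b'_apply : ∀ x, D.b' x = Multiplier.val (𝓛.t x)
  μ_apply : ∀ x y, D.μ x y = x * y
  preTrho_apply : ∀ a b, 𝓛.preTrho a b = sw (D.d a) fun u v => 𝓛.sys.tmul u (v * b)
  preTlam_apply : ∀ a b, 𝓛.preTlam a b = sw (D.d b) fun u v => 𝓛.sys.tmul (u * a) v

theorem realizes_toComult (𝓛 : LeftMultiplierBialgebroid A B) {o : B} (hs : 𝓛.s o = 1)
    (ht : 𝓛.t o = 1) (h1 : (𝓛.Δ 1).1 = 1) : 𝓛.Realizes (𝓛.toComult hs ht h1) where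
  m_apply _ _ := rfl
  e_eq := rfl
  b_apply _ := rfl
  b'_apply _ := rfl
  μ_apply _ _ := rfl
  preTrho_apply := 𝓛.preTrho_apply hs ht h1
  preTlam_apply := 𝓛.preTlam_apply hs ht h1

namespace Realizes

variable {𝓛 : LeftMultiplierBialgebroid A B} {D : Comult A B} (h : 𝓛.Realizes D)
include h

theorem presents : Presents (fun x u => D.m (D.b x) u) (fun x u => D.m (D.b' x) u) 𝓛.sys.f
    𝓛.sys.g :=
  .of_eq (fun x u => by rw [h.m_apply, h.b_apply]; exact Multiplier.l_apply _ _)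
    (fun x u => by rw [h.m_apply, h.b'_apply]; exact Multiplier.l_apply _ _)

theorem mk_d (a : A) : Bal.mk _ _ (D.d a) = (𝓛.Δ a).1 (𝓛.sys.tmul 1 1) := by
  have P : 𝓛.sys.Belongs D.toBasedAlgebra := ⟨h.presents, fun _ _ => (h.m_apply _ _).symm⟩
  have h₁ := P.slice₂_eq 𝓛.tensor_nondeg (𝓛.Δ a) 1
  rw [h.e_eq] at h₁
  rw [← h₁, Bal.mk_eq_sw]
  have h₂ := h.preTrho_apply a 1
  simp only [mul_one] at h₂
  exact h₂.symm

theorem isCanonical_Trho : D.IsCanonical 𝓛.Trho where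
  target := h.presents
  source := .of_eq (fun x u => by rw [h.m_apply, h.b_apply]; exact Multiplier.r_apply _ _)
    (fun x u => by rw [h.m_apply, h.b_apply]; exact Multiplier.l_apply _ _)
  apply p q := by simp only [h.m_apply]; exact h.preTrho_apply p q

theorem isCanonical'_Tlam : D.IsCanonical' 𝓛.Tlam where
  target := h.presents
  source := .of_eq (fun x u => by rw [h.m_apply, h.b'_apply]; exact Multiplier.l_apply _ _)
    (fun x u => by rw [h.m_apply, h.b'_apply]; exact Multiplier.r_apply _ _)
  apply p q := by simp only [h.m_apply]; exact h.preTlam_apply p q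

variable {W : Type u} [AddCommGroup W] [Module ℂ W] {φ : A → A → W}

theorem forall_preTrho_iff (hφ : D.LBal φ) (a b : A) (z : W) :
    (∀ (n : ℕ) (c d : Fin n → A), 𝓛.preTrho a b = ∑ i, 𝓛.sys.tmul (c i) (d i) →
      ∑ i, φ (c i) (d i) = z) ↔ (sw (D.d a) fun u v => φ u (v * b)) = z := by
  obtain ⟨l, hl, -⟩ := h.presents.exists_lift hφ
  refine (Bal.forall_sum_iff l hl _ z).trans ?_
  rw [h.preTrho_apply, map_sw]
  exact Eq.congr_left (congrArg _ (funext fun u => funext fun v => hl _ _))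

theorem forall_preTlam_iff (hφ : D.LBal φ) (a b : A) (z : W) :
    (∀ (n : ℕ) (c d : Fin n → A), 𝓛.preTlam a b = ∑ i, 𝓛.sys.tmul (c i) (d i) →
      ∑ i, φ (c i) (d i) = z) ↔ (sw (D.d b) fun u v => φ (u * a) v) = z := by
  obtain ⟨l, hl, -⟩ := h.presents.exists_lift hφ
  refine (Bal.forall_sum_iff l hl _ z).trans ?_
  rw [h.preTlam_apply, map_sw]
  exact Eq.congr_left (congrArg _ (funext fun u => funext fun v => hl _ _))

/-- The slice conditions at the unit are the counit axioms. Conversely, right multiplication of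
those axioms by an arbitrary element recovers the slice conditions. -/
theorem isCounit_iff (ε : A →ₗ[ℂ] B) : 𝓛.IsCounit ε ↔ D.IsCounit ε := by
  have hb : ∀ x a, (𝓛.s x).l a = D.m (D.b x) a := fun x a => by
    rw [Multiplier.l_apply, h.m_apply, h.b_apply]
  have hb' : ∀ x a, (𝓛.t x).l a = D.m (D.b' x) a := fun x a => by
    rw [Multiplier.l_apply, h.m_apply, h.b'_apply]
  have bal (h₁ : ∀ x a, ε (D.m (D.b x) a) = D.μ x (ε a)) :
      D.LBal fun u v => D.m (D.b' (ε u)) v :=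
    ⟨by constructor <;> simp, fun x u v => by simp only [h₁, D.b'_μ, D.assoc]⟩
  have bal' (h₁ : ∀ x a, ε (D.m (D.b' x) a) = D.μ (ε a) x) :
      D.LBal fun u v => D.m (D.b (ε v)) u :=
    ⟨by constructor <;> simp, fun x u v => by simp only [h₁, D.b_μ, D.assoc]⟩
  constructor
  · intro k
    have h₁ : ∀ x a, ε (D.m (D.b x) a) = D.μ x (ε a) := fun x a => by
      rw [← hb, k.map_s, h.μ_apply]
    have h₂ : ∀ x a, ε (D.m (D.b' x) a) = D.μ (ε a) x := fun x a => by
      rw [← hb', k.map_t, h.μ_apply]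
    refine ⟨h₁, h₂, fun a => ?_, fun a => ?_⟩
    · have := k.slice_rho a 1
      simp only [hb'] at this
      simpa only [mul_one] using (h.forall_preTrho_iff (bal h₁) _ _ _).1 this
    · have := k.slice_lam 1 a
      simp only [hb] at this
      simpa only [mul_one] using (h.forall_preTlam_iff (bal' h₂) _ _ _).1 this
  · intro k
    refine ⟨fun x a => by rw [hb, k.map_b, h.μ_apply], fun x a => by rw [hb', k.map_b', h.μ_apply],
      fun a b => ?_, fun a b => ?_⟩
    · simp only [hb']
      refine (h.forall_preTrho_iff (bal k.map_b) _ _ _).2 ?_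
      conv_rhs => rw [← k.left a, ← h.m_apply, D.sw_m]
      simp only [← h.m_apply, D.assoc]
    · simp only [hb]
      refine (h.forall_preTlam_iff (bal' k.map_b') _ _ _).2 ?_
      conv_rhs => rw [← k.right b, ← h.m_apply, D.sw_m]
      simp only [← h.m_apply, D.assoc]

end Realizes

end LeftMultiplierBialgebroid

namespace RightMultiplierBialgebroid

variable {C : Type v} [NonUnitalRing C] [Module ℂ C]

/-- The comultiplication of the right multiplier bialgebroid on a unital algebra is given by `D`. -/
structure Realizes (𝓡 : RightMultiplierBialgebroid A C) (D : Comult A C) : Prop where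
  m_apply : ∀ u v, D.m u v = v * u
  e_eq : D.e = 1
  b_apply : ∀ x, D.b x = Multiplier.val (𝓡.t x)
  b'_apply : ∀ x, D.b' x = Multiplier.val (𝓡.s x)
  μ_apply : ∀ x y, D.μ x y = x * y
  preTrho_apply : ∀ a b, 𝓡.preTrho a b = sw (D.d a) fun u v => 𝓡.sys.tmul u (b * v)
  preTlam_apply : ∀ a b, 𝓡.preTlam a b = sw (D.d b) fun u v => 𝓡.sys.tmul (a * u) v

theorem realizes_toComult (𝓡 : RightMultiplierBialgebroid A C) {o : C} (hs : 𝓡.s o = 1)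
    (ht : 𝓡.t o = 1) (h1 : (𝓡.Δ 1).1 = 1) : 𝓡.Realizes (𝓡.toComult hs ht h1) where
  m_apply _ _ := rfl
  e_eq := rfl
  b_apply _ := rfl
  b'_apply _ := rfl
  μ_apply _ _ := rfl
  preTrho_apply := 𝓡.preTrho_apply hs ht h1
  preTlam_apply := 𝓡.preTlam_apply hs ht h1

namespace Realizes

variable {𝓡 : RightMultiplierBialgebroid A C} {D : Comult A C} (h : 𝓡.Realizes D)
include h

theorem presents : Presents (fun x u => D.m (D.b x) u) (fun x u => D.m (D.b' x) u) 𝓡.sys.f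
    𝓡.sys.g :=
  .of_eq (fun x u => by rw [h.m_apply, h.b_apply]; exact Multiplier.r_apply _ _)
    (fun x u => by rw [h.m_apply, h.b'_apply]; exact Multiplier.r_apply _ _)

theorem mk_d (a : A) : Bal.mk _ _ (D.d a) = (𝓡.Δ a).1 (𝓡.sys.tmul 1 1) := by
  have P : 𝓡.sys.Belongs D.toBasedAlgebra := ⟨h.presents, fun _ _ => (h.m_apply _ _).symm⟩
  have h₁ := P.slice₂_eq 𝓡.tensor_nondeg (𝓡.Δ a) 1
  rw [h.e_eq] at h₁
  rw [← h₁, Bal.mk_eq_sw]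
  have h₂ := h.preTrho_apply a 1
  simp only [one_mul] at h₂
  exact h₂.symm

theorem isCanonical_Trho : D.IsCanonical 𝓡.Trho where
  target := h.presents
  source := .of_eq (fun x u => by rw [h.m_apply, h.b_apply]; exact Multiplier.l_apply _ _)
    (fun x u => by rw [h.m_apply, h.b_apply]; exact Multiplier.r_apply _ _)
  apply p q := by simp only [h.m_apply]; exact h.preTrho_apply p q

theorem isCanonical'_Tlam : D.IsCanonical' 𝓡.Tlam where
  target := h.presents
  source := .of_eq (fun x u => by rw [h.m_apply, h.b'_apply]; exact Multiplier.r_apply _ _)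
    (fun x u => by rw [h.m_apply, h.b'_apply]; exact Multiplier.l_apply _ _)
  apply p q := by simp only [h.m_apply]; exact h.preTlam_apply p q

variable {W : Type u} [AddCommGroup W] [Module ℂ W] {φ : A → A → W}

theorem forall_preTrho_iff (hφ : D.LBal φ) (a b : A) (z : W) :
    (∀ (n : ℕ) (c d : Fin n → A), 𝓡.preTrho a b = ∑ i, 𝓡.sys.tmul (c i) (d i) →
      ∑ i, φ (c i) (d i) = z) ↔ (sw (D.d a) fun u v => φ u (b * v)) = z := by
  obtain ⟨l, hl, -⟩ := h.presents.exists_lift hφ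
  refine (Bal.forall_sum_iff l hl _ z).trans ?_
  rw [h.preTrho_apply, map_sw]
  exact Eq.congr_left (congrArg _ (funext fun u => funext fun v => hl _ _))

theorem forall_preTlam_iff (hφ : D.LBal φ) (a b : A) (z : W) :
    (∀ (n : ℕ) (c d : Fin n → A), 𝓡.preTlam a b = ∑ i, 𝓡.sys.tmul (c i) (d i) →
      ∑ i, φ (c i) (d i) = z) ↔ (sw (D.d b) fun u v => φ (a * u) v) = z := by
  obtain ⟨l, hl, -⟩ := h.presents.exists_lift hφ
  refine (Bal.forall_sum_iff l hl _ z).trans ?_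
  rw [h.preTlam_apply, map_sw]
  exact Eq.congr_left (congrArg _ (funext fun u => funext fun v => hl _ _))

theorem isCounit_iff (ε : A →ₗ[ℂ] C) : 𝓡.IsCounit ε ↔ D.IsCounit ε := by
  have hb : ∀ x a, (𝓡.t x).r a = D.m (D.b x) a := fun x a => by
    rw [Multiplier.r_apply, h.m_apply, h.b_apply]
  have hb' : ∀ x a, (𝓡.s x).r a = D.m (D.b' x) a := fun x a => by
    rw [Multiplier.r_apply, h.m_apply, h.b'_apply]
  have bal (h₁ : ∀ x a, ε (D.m (D.b x) a) = D.μ x (ε a)) :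
      D.LBal fun u v => D.m (D.b' (ε u)) v :=
    ⟨by constructor <;> simp, fun x u v => by simp only [h₁, D.b'_μ, D.assoc]⟩
  have bal' (h₁ : ∀ x a, ε (D.m (D.b' x) a) = D.μ (ε a) x) :
      D.LBal fun u v => D.m (D.b (ε v)) u :=
    ⟨by constructor <;> simp, fun x u v => by simp only [h₁, D.b_μ, D.assoc]⟩
  constructor
  · intro k
    have h₁ : ∀ x a, ε (D.m (D.b x) a) = D.μ x (ε a) := fun x a => by
      rw [← hb, k.map_t, h.μ_apply]
    have h₂ : ∀ x a, ε (D.m (D.b' x) a) = D.μ (ε a) x := fun x a => by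
      rw [← hb', k.map_s, h.μ_apply]
    refine ⟨h₁, h₂, fun a => ?_, fun a => ?_⟩
    · have := k.slice_rho a 1
      simp only [hb'] at this
      simpa only [one_mul] using (h.forall_preTrho_iff (bal h₁) _ _ _).1 this
    · have := k.slice_lam 1 a
      simp only [hb] at this
      simpa only [one_mul] using (h.forall_preTlam_iff (bal' h₂) _ _ _).1 this
  · intro k
    refine ⟨fun x a => by rw [hb', k.map_b', h.μ_apply], fun x a => by rw [hb, k.map_b, h.μ_apply],
      fun a b => ?_, fun a b => ?_⟩
    · simp only [hb']
      refine (h.forall_preTrho_iff (bal k.map_b) _ _ _).2 ?_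
      conv_rhs => rw [← k.left a, ← h.m_apply, D.sw_m]
      simp only [← h.m_apply, D.assoc]
    · simp only [hb]
      refine (h.forall_preTlam_iff (bal' k.map_b') _ _ _).2 ?_
      conv_rhs => rw [← k.right b, ← h.m_apply, D.sw_m]
      simp only [← h.m_apply, D.assoc]

end Realizes

end RightMultiplierBialgebroid

end MultHopf

/-! ### Counits and antipode of a unital regular multiplier Hopf algebroid -/

namespace MultHopf

namespace MultiplierBialgebroid

variable {A : Type u} [Ring A] [Algebra ℂ A] {𝒜 : MultiplierBialgebroid A}

/-- The comultiplications of a multiplier bialgebroid over a unital algebra are given by `P`. -/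
structure Realizes (𝒜 : MultiplierBialgebroid A) (P : BiComult A 𝒜.B 𝒜.C) : Prop where
  left : 𝒜.left.Realizes P.L
  right : 𝒜.right.Realizes P.R

namespace IsUnital

variable (hu : 𝒜.IsUnital)
include hu

/-- An anti-multiplicative bijection preserves units: if `S_B(x) = 1`, then `1 = S_B(x 1) = S_B(1)
S_B(x) = S_B(1)`. -/
theorem SB_one : 𝒜.SB ⟨1, hu.one_mem_B⟩ = ⟨1, hu.one_mem_C⟩ := by
  obtain ⟨x, hx⟩ := 𝒜.SB.surjective ⟨1, hu.one_mem_C⟩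
  have h := 𝒜.SB_mul x ⟨1, hu.one_mem_B⟩
  rw [show x * ⟨1, hu.one_mem_B⟩ = x from Subtype.ext (mul_one _), hx] at h
  exact h.symm ▸ Subtype.ext (mul_one _).symm

theorem SC_one : 𝒜.SC ⟨1, hu.one_mem_C⟩ = ⟨1, hu.one_mem_B⟩ := by
  obtain ⟨x, hx⟩ := 𝒜.SC.surjective ⟨1, hu.one_mem_B⟩
  have h := 𝒜.SC_mul x ⟨1, hu.one_mem_C⟩
  rw [show x * ⟨1, hu.one_mem_C⟩ = x from Subtype.ext (mul_one _), hx] at h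
  exact h.symm ▸ Subtype.ext (mul_one _).symm

theorem left_t_one : 𝒜.left.t ⟨1, hu.one_mem_B⟩ = 1 := by rw [𝒜.left_t, hu.SB_one]

theorem right_t_one : 𝒜.right.t ⟨1, hu.one_mem_C⟩ = 1 := by rw [𝒜.right_t, hu.SC_one]

/-- The left comultiplication of a unital multiplier bialgebroid. -/
noncomputable def comultL : Comult A 𝒜.B :=
  𝒜.left.toComult (𝒜.left_s ⟨1, hu.one_mem_B⟩) hu.left_t_one hu.Δ_left_one

/-- The right comultiplication of a unital multiplier bialgebroid. -/
noncomputable def comultR : Comult A 𝒜.C :=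
  𝒜.right.toComult (𝒜.right_s ⟨1, hu.one_mem_C⟩) hu.right_t_one hu.Δ_right_one

theorem realizes_comultL : 𝒜.left.Realizes hu.comultL :=
  𝒜.left.realizes_toComult _ _ _

theorem realizes_comultR : 𝒜.right.Realizes hu.comultR :=
  𝒜.right.realizes_toComult _ _ _

/-- The two comultiplications of a unital multiplier bialgebroid. -/
noncomputable def biComult : BiComult A 𝒜.B 𝒜.C where
  L := hu.comultL
  R := hu.comultR
  R_m _ _ := rfl
  R_e := rfl
  -- Both ranges are `B`, viewed inside `A`, since `S_C` maps `C` onto `B`.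
  range_b := by
    ext a
    simp only [LinearMap.mem_range, hu.realizes_comultL.b_apply, hu.realizes_comultR.b_apply,
      𝒜.left_s, 𝒜.right_t]
    exact (𝒜.SC.surjective.exists (p := fun x : 𝒜.B => Multiplier.val (x : Multiplier A) = a))
  range_b' := by
    ext a
    simp only [LinearMap.mem_range, hu.realizes_comultL.b'_apply, hu.realizes_comultR.b'_apply,
      𝒜.left_t, 𝒜.right_s]
    exact (𝒜.SB.surjective.exists
      (p := fun x : 𝒜.C => Multiplier.val (x : Multiplier A) = a)).symm
  mixed₁ hχ a := by
    have h := 𝒜.mixed₁.coassociative 1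
    have hL : ∀ a, Bal.mk _ _ (hu.comultL.d a) = 𝒜.left.preTlam 1 a := fun a => by
      rw [hu.realizes_comultL.preTlam_apply, Bal.mk_eq_sw]; simp only [mul_one]
    have hR : ∀ a, Bal.mk _ _ (hu.comultR.d a) = 𝒜.right.preTrho.flip 1 a := fun a => by
      rw [LinearMap.flip_apply, hu.realizes_comultR.preTrho_apply, Bal.mk_eq_sw]
      simp only [one_mul]
    exact hu.realizes_comultL.presents.sw_mixed hu.realizes_comultR.presents _ _ _ _ hL hR a
      (h a _ _ (hL a) (hR a)) hχ
  mixed₂ hχ a := by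
    have h := 𝒜.mixed₂.coassociative 1
    have hL : ∀ a, Bal.mk _ _ (hu.comultL.d a) = 𝒜.left.preTrho.flip 1 a := fun a => by
      rw [LinearMap.flip_apply, hu.realizes_comultL.preTrho_apply, Bal.mk_eq_sw]
      simp only [mul_one]
    have hR : ∀ a, Bal.mk _ _ (hu.comultR.d a) = 𝒜.right.preTlam 1 a := fun a => by
      rw [hu.realizes_comultR.preTlam_apply, Bal.mk_eq_sw]; simp only [one_mul]
    exact hu.realizes_comultR.presents.sw_mixed hu.realizes_comultL.presents _ _ _ _ hR hL a
      (h a _ _ (hR a) (hL a)) hχ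

theorem realizes : 𝒜.Realizes hu.biComult :=
  ⟨hu.realizes_comultL, hu.realizes_comultR⟩

end IsUnital

namespace Realizes

variable {P : BiComult A 𝒜.B 𝒜.C} (h : 𝒜.Realizes P)
include h

theorem L_b (x : 𝒜.B) : P.L.b x = Multiplier.val (x : Multiplier A) := by
  rw [h.left.b_apply, 𝒜.left_s]

theorem L_b' (x : 𝒜.B) : P.L.b' x = Multiplier.val (𝒜.SB x : Multiplier A) := by
  rw [h.left.b'_apply, 𝒜.left_t]

theorem R_b (y : 𝒜.C) : P.R.b y = Multiplier.val (𝒜.SC y : Multiplier A) := by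
  rw [h.right.b_apply, 𝒜.right_t]

theorem R_b' (y : 𝒜.C) : P.R.b' y = Multiplier.val (y : Multiplier A) := by
  rw [h.right.b'_apply, 𝒜.right_s]

theorem exists_counit_left (hA : 𝒜.IsRegularHopf) : ∃ ε, P.L.IsCounit ε := by
  obtain ⟨K⟩ := h.left.isCanonical_Trho.exists_translation hA.left_Trho
  obtain ⟨K'⟩ := h.left.isCanonical'_Tlam.exists_translation hA.left_Tlam
  refine K.exists_counit K' ?_ ?_
  · simpa only [h.left.m_apply, h.L_b, h.L_b', h.left.μ_apply, Multiplier.l_apply] using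
      hA.full_B_left
  · simpa only [h.left.m_apply, h.L_b, h.L_b', h.left.μ_apply, Multiplier.l_apply] using
      hA.full_B_right

theorem exists_counit_right (hA : 𝒜.IsRegularHopf) : ∃ η, P.R.IsCounit η := by
  obtain ⟨K⟩ := h.right.isCanonical_Trho.exists_translation hA.right_Trho
  obtain ⟨K'⟩ := h.right.isCanonical'_Tlam.exists_translation hA.right_Tlam
  refine K.exists_counit K' ?_ ?_
  · simpa only [h.right.m_apply, h.R_b, h.R_b', h.right.μ_apply, Multiplier.r_apply] using
      hA.full_C_left
  · simpa only [h.right.m_apply, h.R_b, h.R_b', h.right.μ_apply, Multiplier.r_apply] using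
      hA.full_C_right

variable {ε : A →ₗ[ℂ] 𝒜.B} {η : A →ₗ[ℂ] 𝒜.C}

/-- Setting all but one of the four base elements in the bimodule condition equal to `1`, and the
free argument in the antipode identities equal to `1`, gives the conditions on a pair of
comultiplications. -/
theorem isAntipode (hu : 𝒜.IsUnital) {S : A ≃ₗ[ℂ] A} (hS : 𝒜.IsInvertibleAntipode S) :
    ∃ (ε : A →ₗ[ℂ] 𝒜.B) (η : A →ₗ[ℂ] 𝒜.C), P.L.IsCounit ε ∧ P.R.IsCounit η ∧
      P.IsAntipode ε η S.toLinearMap := by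
  obtain ⟨ε, η, hε, hη, h₁, h₂⟩ := hS.counits
  have S_b : ∀ x a, S (P.L.m (P.L.b x) a) = P.L.m (S a) (P.L.b' x) := fun x a => by
    have := hS.bimodule x ⟨1, hu.one_mem_B⟩ ⟨1, hu.one_mem_C⟩ ⟨1, hu.one_mem_C⟩ a
    simpa only [hu.SB_one, hu.SC_one, Multiplier.l_apply, Multiplier.r_apply, Multiplier.val_one,
      one_mul, mul_one, h.left.m_apply, h.L_b, h.L_b'] using this
  have S_c' : ∀ y a, S (P.L.m a (P.R.b' y)) = P.L.m (P.R.b y) (S a) := fun y a => by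
    have := hS.bimodule ⟨1, hu.one_mem_B⟩ ⟨1, hu.one_mem_B⟩ ⟨1, hu.one_mem_C⟩ y a
    simpa only [hu.SB_one, hu.SC_one, Multiplier.l_apply, Multiplier.r_apply, Multiplier.val_one,
      one_mul, mul_one, h.left.m_apply, h.R_b, h.R_b'] using this
  have hL : P.L.LBal fun u v => S u * v :=
    ⟨by constructor <;> simp [add_mul, mul_add], fun x u v => by
      simp only [S_b]
      simp only [h.left.m_apply, mul_assoc]⟩
  have hR : P.R.LBal fun u v => u * S v :=
    ⟨by constructor <;> simp [add_mul, mul_add], fun x u v => by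
      simp only [P.R_m, S_c']
      simp only [h.left.m_apply, mul_assoc]⟩
  refine ⟨ε, η, (h.left.isCounit_iff ε).1 hε, (h.right.isCounit_iff η).1 hη, S_b, S_c',
    fun a => ?_, fun a => ?_⟩
  · have := (h.left.forall_preTrho_iff hL _ _ _).1 (h₁ a 1)
    simpa only [mul_one, Multiplier.l_apply, h.R_b, h.left.m_apply, LinearEquiv.coe_coe] using this
  · have := (h.right.forall_preTlam_iff hR _ _ _).1 (h₂ 1 a)
    simpa only [one_mul, Multiplier.r_apply, h.L_b', h.left.m_apply, LinearEquiv.coe_coe] using this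

/-- The four-fold bimodule condition follows from anti-multiplicativity and the values of `S` on `B`
and `C`. -/
theorem isInvertibleAntipode (hε : P.L.IsCounit ε) (hη : P.R.IsCounit η) {S : A ≃ₗ[ℂ] A}
    (hS : P.IsAntipode ε η S.toLinearMap) (hm : ∀ a a', S (a * a') = S a' * S a) :
    𝒜.IsInvertibleAntipode S where
  map_mul := hm
  bimodule x x' y y' a := by
    have h₁ : ∀ x : 𝒜.B, S (Multiplier.val (x : Multiplier A)) =
        Multiplier.val (𝒜.SB x : Multiplier A) := fun x => by
      rw [← h.L_b, ← h.L_b']; exact hS.apply_b hη x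
    have h₂ : ∀ y : 𝒜.C, S (Multiplier.val (y : Multiplier A)) =
        Multiplier.val (𝒜.SC y : Multiplier A) := fun x => by
      rw [← h.R_b, ← h.R_b']; exact hS.apply_c' hη x
    simp only [Multiplier.l_apply, Multiplier.r_apply, hm, h₁, h₂, mul_assoc]
  counits := by
    refine ⟨ε, η, (h.left.isCounit_iff ε).2 hε, (h.right.isCounit_iff η).2 hη,
      fun a b => ?_, fun a b => ?_⟩
    · have hL := hS.lbal_left
      simp only [h.left.m_apply] at hL
      refine (h.left.forall_preTrho_iff hL _ _ _).2 ?_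
      rw [Multiplier.l_apply, ← h.R_b, ← hS.left, ← h.left.m_apply, P.L.sw_m]
      simp only [h.left.m_apply, mul_assoc]
    · have hR := hS.lbal_right
      simp only [h.left.m_apply] at hR
      refine (h.right.forall_preTlam_iff hR _ _ _).2 ?_
      rw [Multiplier.r_apply, ← h.L_b', ← hS.right, ← h.left.m_apply, P.L.m_sw]
      simp only [h.left.m_apply, mul_assoc]

end Realizes

end MultiplierBialgebroid

namespace BiComult

variable {V : Type u} {X : Type v} {Y : Type w} [AddCommGroup V] [Module ℂ V] [AddCommGroup X]
  [Module ℂ X] [AddCommGroup Y] [Module ℂ Y] {P : BiComult V X Y}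
  {ε : V →ₗ[ℂ] X} {η : V →ₗ[ℂ] Y}

/-- Existence of a bijective antipode if all canonical maps are bijective. -/
theorem exists_invertible_antipode (K : Translation P.L) (K' : Translation P.L.cop)
    (T : Translation P.R) (hε : P.L.IsCounit ε) (hη : P.R.IsCounit η) :
    ∃ S : V ≃ₗ[ℂ] V, P.IsAntipode ε η S.toLinearMap ∧
      ∀ a a', S (P.L.m a a') = P.L.m (S a') (S a) := by
  have h₂ : ∀ a a', η (P.R.m a (P.R.b' (η a'))) = η (P.R.m a a') := T.counit_mul_b'_counit hη
  have h₁ : ∀ a a', η (P.R.m a (P.R.b (η a'))) = η (P.R.m a a') := fun a a' => by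
    rw [T.counit_mul_b hη, h₂]
  obtain ⟨S, hS⟩ := exists_antipode K hε hη
  obtain ⟨S', hS'⟩ := exists_antipode (P := P.cop) K' hε.cop hη.cop
  have m : ∀ a a', S (P.L.m a a') = P.L.m (S a') (S a) := hS.map_m K hη h₁ h₂
  have m' : ∀ a a', S' (P.L.m a a') = P.L.m (S' a') (S' a) :=
    -- The co-opposite exchanges `b` and `b'`, hence the two identities for `η` change places.
    hS'.map_m (P := P.cop) K' hη.cop h₂ h₁
  have l : ∀ a, S' (S a) = a := hS.leftInverse hS' hε hη m m'
  have r : ∀ a, S (S' a) = a :=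
    hS'.leftInverse (P := P.cop) (P.cop_cop.symm ▸ hS) hε.cop hη.cop m' m
  exact ⟨{ S with invFun := S', left_inv := l, right_inv := r }, hS, m⟩

end BiComult

namespace MultiplierBialgebroid

variable {A : Type u} [Ring A] [Algebra ℂ A] {𝒜 : MultiplierBialgebroid A}

namespace Realizes

variable {P : BiComult A 𝒜.B 𝒜.C} (h : 𝒜.Realizes P) (hA : 𝒜.IsRegularHopf)
include h hA

theorem existsUnique_counit_left : ∃! ε : A →ₗ[ℂ] 𝒜.B, 𝒜.left.IsCounit ε := by
  obtain ⟨K⟩ := h.left.isCanonical_Trho.exists_translation hA.left_Trho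
  obtain ⟨ε, hε⟩ := h.exists_counit_left hA
  exact ⟨ε, (h.left.isCounit_iff ε).2 hε, fun ε' hε' =>
    K.counit_unique ((h.left.isCounit_iff ε').1 hε') hε⟩

theorem existsUnique_counit_right : ∃! η : A →ₗ[ℂ] 𝒜.C, 𝒜.right.IsCounit η := by
  obtain ⟨K⟩ := h.right.isCanonical_Trho.exists_translation hA.right_Trho
  obtain ⟨η, hη⟩ := h.exists_counit_right hA
  exact ⟨η, (h.right.isCounit_iff η).2 hη, fun η' hη' =>
    K.counit_unique ((h.right.isCounit_iff η').1 hη') hη⟩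

/-- The definition of an antipode only asserts that suitable counits exist. Uniqueness of counits
identifies them with any given ones. -/
theorem isAntipode_of_isCounit (hu : 𝒜.IsUnital) {S : A ≃ₗ[ℂ] A} (hS : 𝒜.IsInvertibleAntipode S)
    {ε : A →ₗ[ℂ] 𝒜.B} {η : A →ₗ[ℂ] 𝒜.C} (hε : P.L.IsCounit ε) (hη : P.R.IsCounit η) :
    P.IsAntipode ε η S.toLinearMap := by
  obtain ⟨K⟩ := h.left.isCanonical_Trho.exists_translation hA.left_Trho
  obtain ⟨T⟩ := h.right.isCanonical_Trho.exists_translation hA.right_Trho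
  obtain ⟨ε', η', hε', hη', h'⟩ := h.isAntipode hu hS
  rwa [K.counit_unique hε hε', T.counit_unique hη hη']

theorem existsUnique_antipode (hu : 𝒜.IsUnital) :
    ∃! S : A ≃ₗ[ℂ] A, 𝒜.IsInvertibleAntipode S := by
  obtain ⟨K⟩ := h.left.isCanonical_Trho.exists_translation hA.left_Trho
  obtain ⟨K'⟩ := h.left.isCanonical'_Tlam.exists_translation hA.left_Tlam
  obtain ⟨T⟩ := h.right.isCanonical_Trho.exists_translation hA.right_Trho
  obtain ⟨ε, hε⟩ := h.exists_counit_left hA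
  obtain ⟨η, hη⟩ := h.exists_counit_right hA
  obtain ⟨S, hS, m⟩ := BiComult.exists_invertible_antipode K K' T hε hη
  simp only [h.left.m_apply] at m
  refine ⟨S, h.isInvertibleAntipode hε hη hS m, fun S' hS' => LinearEquiv.ext fun a => ?_⟩
  -- Both antipodes are given by the formula `c(η(p)) q`, which does not involve them.
  exact ((h.isAntipode_of_isCounit hA hu hS' hε hη).eq_sw K a).trans (hS.eq_sw K a).symm

end Realizes

end MultiplierBialgebroid

end MultHopf

/-! ### Bialgebroids from comultiplications -/

namespace MultHopf

section TensorMultiplication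

variable {A : Type u} [Ring A] [Algebra ℂ A] {ι : Type*} (f g : ι → Module.End ℂ A)

theorem Bal.mk_tmul_mul (p q : A) (t : A ⊗[ℂ] A) :
    Bal.mk f g ((p ⊗ₜ[ℂ] q) * t) = sw t fun u v => Bal.tmul f g (p * u) (q * v) := by
  conv_lhs => rw [← sw_tmul_self t, ← LinearMap.mulLeft_apply (R := ℂ), map_sw, map_sw]
  simp only [LinearMap.mulLeft_apply, Algebra.TensorProduct.tmul_mul_tmul]
  rfl

theorem Bal.mk_mul_tmul (p q : A) (t : A ⊗[ℂ] A) :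
    Bal.mk f g (t * (p ⊗ₜ[ℂ] q)) = sw t fun u v => Bal.tmul f g (u * p) (v * q) := by
  conv_lhs => rw [← sw_tmul_self t, ← LinearMap.mulRight_apply (R := ℂ), map_sw, map_sw]
  simp only [LinearMap.mulRight_apply, Algebra.TensorProduct.tmul_mul_tmul]
  rfl

theorem Bal.mk_mul (s t : A ⊗[ℂ] A) :
    Bal.mk f g (s * t) = sw s fun u v => sw t fun u' v' => Bal.tmul f g (u * u') (v * v') := by
  simp only [← Bal.mk_tmul_mul, ← map_sw]
  conv_lhs => rw [← sw_tmul_self s, ← LinearMap.mulRight_apply (R := ℂ), map_sw]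
  simp only [LinearMap.mulRight_apply]

end TensorMultiplication

namespace Comult

section

variable {V : Type u} {X : Type v} [AddCommGroup V] [Module ℂ V] [AddCommGroup X] [Module ℂ X]
  {D : Comult V X} {W : Type u} [AddCommGroup W] [Module ℂ W] {ι : Type*}
  {f g : ι → Module.End ℂ V}

/-- The product of representatives of `d(a)` and `d(a')` represents `d(a a')`. -/
theorem sw_sw_eq (P : Presents (fun x u => D.m (D.b x) u) (fun x u => D.m (D.b' x) u) f g)
    {φ : V → V → W} (hφ : D.LBal φ) {a a' : V} {s t : V ⊗[ℂ] V}
    (hs : Bal.mk f g s = Bal.mk f g (D.d a)) (ht : Bal.mk f g t = Bal.mk f g (D.d a')) :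
    (sw s fun u v => sw t fun u' v' => φ (D.m u u') (D.m v v')) = sw (D.d (D.m a a')) φ := by
  rw [sw_comm, D.d_m hφ]
  have h1 : ∀ u' v', (sw s fun u v => φ (D.m u u') (D.m v v')) =
      sw (D.d a) fun u v => φ (D.m u u') (D.m v v') := fun u' v' =>
    P.sw_eq_of_mk_eq (LBal.mul_right (LBal.mul_left hφ u') v') hs
  simp only [h1]
  rw [P.sw_eq_of_mk_eq (LBal.comul_mul hφ a) ht, sw_comm]

variable {L : Type w} [Ring L] [Algebra ℂ L]

/-- The unital algebra `L` is the opposite of the base algebra of `D`. -/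
structure IsBase (D : Comult V X) (e : L ≃ₗ[ℂ] X) : Prop where
  map_mul : ∀ l l', e (l * l') = D.μ (e l') (e l)
  map_one : e 1 = D.o

end

variable {A : Type u} {X : Type v} {L : Type w} [Ring A] [Algebra ℂ A] [AddCommGroup X]
  [Module ℂ X] [Ring L] [Algebra ℂ L] {D : Comult A X} {e : L ≃ₗ[ℂ] X} {ε : A →ₗ[ℂ] X}

theorem IsBase.symm_mul_mul (h : D.IsBase e) (hε : D.IsCounit ε) (l l' : L) (a : A) :
    e.symm (ε (D.m (D.b' (e l)) (D.m (D.b (e l')) a))) = l * e.symm (ε a) * l' := by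
  rw [LinearEquiv.symm_apply_eq, h.map_mul, h.map_mul, LinearEquiv.apply_symm_apply]
  refine D.b_inj ?_
  rw [hε.map_b', hε.map_b, D.b_μ, D.b_μ, D.b_μ, D.b_μ, D.assoc]

/-- The left bialgebroid given by a comultiplication. -/
noncomputable def toLeftBialgebroid (hm : ∀ u v, D.m u v = u * v) (he : D.e = 1) (h : D.IsBase e)
    (hε : D.IsCounit ε) (h₁ : ∀ a a', ε (D.m a (D.b (ε a'))) = ε (D.m a a'))
    (h₂ : ∀ a a', ε (D.m a (D.b' (ε a'))) = ε (D.m a a')) : LeftBialgebroid A L :=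
  let s : L →ₐ[ℂ] A := AlgHom.ofLinearMap (D.b' ∘ₗ e.toLinearMap)
    (by simp [h.map_one, D.b'_o, he]) (fun l l' => by simp [h.map_mul, D.b'_μ, hm])
  let t : Lᵐᵒᵖ →ₐ[ℂ] A := AlgHom.ofLinearMap
    (D.b ∘ₗ e.toLinearMap ∘ₗ (MulOpposite.opLinearEquiv ℂ).symm.toLinearMap)
    (by simp [h.map_one, D.b_o, he]) (fun l l' => by simp [h.map_mul, D.b_μ, hm])
  have hs : ∀ l, s l = D.b' (e l) := fun _ => rfl
  have ht : ∀ l, t (.op l) = D.b (e l) := fun _ => rfl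
  have P : Presents (fun x u => D.m (D.b x) u) (fun x u => D.m (D.b' x) u)
      (fun l : L => LinearMap.mulLeft ℂ (t (.op l))) (fun l : L => LinearMap.mulLeft ℂ (s l)) :=
    ⟨fun l => ⟨e l, fun _ => (hm _ _).symm, fun _ => (hm _ _).symm⟩, fun x => ⟨e.symm x,
      fun u => by rw [LinearMap.mulLeft_apply, ht, e.apply_symm_apply, hm],
      fun u => by rw [LinearMap.mulLeft_apply, hs, e.apply_symm_apply, hm]⟩⟩
  have hb : D.LBal fun u v => Bal.tmul (fun l : L => LinearMap.mulLeft ℂ (t (.op l)))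
      (fun l : L => LinearMap.mulLeft ℂ (s l)) u v := P.isBal_tmul
  have hc : ∀ l, e (e.symm l) = l := e.apply_symm_apply
  { s := s
    t := t
    comm := fun l l' => by
      have := D.b_comm (e l'.unop) (e l)
      rw [hm, hm] at this
      exact this.symm
    Δ := Bal.mk _ _ ∘ₗ D.d
    ε := e.symm.toLinearMap ∘ₗ ε
    Δ_bimod := fun l l' a w hw => by
      have k := (hb.b'_mul (e l)).b_mul (e l')
      have k' := P.sw_eq_of_mk_eq k hw
      have k₁ := D.d_b'l hb (e l) (D.m (D.b (e l')) a)
      rw [D.d_bl (hb.b'_mul (e l))] at k₁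
      rw [← k₁] at k'
      simp only [hm] at k'
      rw [Bal.mk_tmul_mul, LinearMap.comp_apply, Bal.mk_eq_sw, mul_assoc]
      exact k'
    ε_bimod := fun l l' a => by
      have := h.symm_mul_mul hε l l' a
      rw [hm, hm, ← mul_assoc] at this
      exact this
    coassoc := (compatible_self D).coassociative P P
    counit_left := fun a => by
      obtain ⟨l, hl, hl'⟩ := P.exists_lift hε.lbal_left
      have k : ∀ u v, l (Bal.tmul _ _ u v) = s (e.symm (ε u)) * v := fun u v => by
        rw [hl, hs, hc, hm]
      refine (Bal.forall_sum_iff l k _ a).2 ?_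
      rw [LinearMap.comp_apply, hl', hε.left]
    counit_right := fun a => by
      obtain ⟨l, hl, hl'⟩ := P.exists_lift hε.lbal_right
      have k : ∀ u v, l (Bal.tmul _ _ u v) = t (.op (e.symm (ε v))) * u := fun u v => by
        rw [hl, ht, hc, hm]
      refine (Bal.forall_sum_iff l k _ a).2 ?_
      rw [LinearMap.comp_apply, hl', hε.right]
    takeuchi := fun l a w hw => by
      have k := D.takeuchi hb a (e l)
      rw [← P.sw_eq_of_mk_eq (LBal.mul_left hb _) hw,
        ← P.sw_eq_of_mk_eq (LBal.mul_right hb _) hw] at k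
      simp only [hm] at k
      rw [Bal.mk_mul_tmul, Bal.mk_mul_tmul]
      simp only [mul_one]
      exact k
    Δ_one := by
      rw [LinearMap.comp_apply, Bal.mk_eq_sw, ← he, D.d_e hb]
    Δ_mul := fun a a' v w hv hw => by
      have k := sw_sw_eq P hb hv hw
      rw [Bal.mk_mul, LinearMap.comp_apply, Bal.mk_eq_sw, ← hm, ← k]
      simp only [hm]
    ε_one := by
      rw [LinearMap.comp_apply, ← he, hε.map_e, ← h.map_one]
      exact e.symm_apply_apply 1
    ε_mul_s := fun a a' => by
      have := h₂ a a'
      rw [hm, hm] at this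
      simp only [LinearMap.comp_apply, LinearEquiv.coe_coe, hs, hc, this]
    ε_mul_t := fun a a' => by
      have := h₁ a a'
      rw [hm, hm] at this
      simp only [LinearMap.comp_apply, LinearEquiv.coe_coe, ht, hc, this] }

/-- The right bialgebroid given by a comultiplication on the opposite algebra. -/
noncomputable def toRightBialgebroid (hm : ∀ u v, D.m u v = v * u) (he : D.e = 1)
    (h : D.IsBase e) (hε : D.IsCounit ε) (h₁ : ∀ a a', ε (D.m a (D.b (ε a'))) = ε (D.m a a'))
    (h₂ : ∀ a a', ε (D.m a (D.b' (ε a'))) = ε (D.m a a')) : RightBialgebroid A L :=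
  let s : L →ₐ[ℂ] A := AlgHom.ofLinearMap (D.b ∘ₗ e.toLinearMap)
    (by simp [h.map_one, D.b_o, he]) (fun l l' => by simp [h.map_mul, D.b_μ, hm])
  let t : Lᵐᵒᵖ →ₐ[ℂ] A := AlgHom.ofLinearMap
    (D.b' ∘ₗ e.toLinearMap ∘ₗ (MulOpposite.opLinearEquiv ℂ).symm.toLinearMap)
    (by simp [h.map_one, D.b'_o, he]) (fun l l' => by simp [h.map_mul, D.b'_μ, hm])
  have hs : ∀ l, s l = D.b (e l) := fun _ => rfl
  have ht : ∀ l, t (.op l) = D.b' (e l) := fun _ => rfl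
  have P : Presents (fun x u => D.m (D.b x) u) (fun x u => D.m (D.b' x) u)
      (fun l : L => LinearMap.mulRight ℂ (s l)) (fun l : L => LinearMap.mulRight ℂ (t (.op l))) :=
    ⟨fun l => ⟨e l, fun _ => (hm _ _).symm, fun _ => (hm _ _).symm⟩, fun x => ⟨e.symm x,
      fun u => by rw [LinearMap.mulRight_apply, hs, e.apply_symm_apply, hm],
      fun u => by rw [LinearMap.mulRight_apply, ht, e.apply_symm_apply, hm]⟩⟩
  have hb : D.LBal fun u v => Bal.tmul (fun l : L => LinearMap.mulRight ℂ (s l))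
      (fun l : L => LinearMap.mulRight ℂ (t (.op l))) u v := P.isBal_tmul
  have hc : ∀ l, e (e.symm l) = l := e.apply_symm_apply
  { s := s
    t := t
    comm := fun l l' => by
      have := D.b_comm (e l) (e l'.unop)
      rw [hm, hm] at this
      exact this.symm
    Δ := Bal.mk _ _ ∘ₗ D.d
    ε := e.symm.toLinearMap ∘ₗ ε
    Δ_bimod := fun l l' a w hw => by
      have k := (hb.b'_mul (e l)).b_mul (e l')
      have k' := P.sw_eq_of_mk_eq k hw
      have k₁ := D.d_b'l hb (e l) (D.m (D.b (e l')) a)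
      rw [D.d_bl (hb.b'_mul (e l))] at k₁
      rw [← k₁] at k'
      simp only [hm] at k'
      rw [Bal.mk_mul_tmul, LinearMap.comp_apply, Bal.mk_eq_sw]
      exact k'
    ε_bimod := fun l l' a => by
      have := h.symm_mul_mul hε l l' a
      rw [hm, hm] at this
      exact this
    coassoc := (compatible_self D).coassociative P P
    counit_left := fun a => by
      obtain ⟨l, hl, hl'⟩ := P.exists_lift hε.lbal_left
      have k : ∀ u v, l (Bal.tmul _ _ u v) = v * t (.op (e.symm (ε u))) := fun u v => by
        rw [hl, ht, hc, hm]
      refine (Bal.forall_sum_iff l k _ a).2 ?_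
      rw [LinearMap.comp_apply, hl', hε.left]
    counit_right := fun a => by
      obtain ⟨l, hl, hl'⟩ := P.exists_lift hε.lbal_right
      have k : ∀ u v, l (Bal.tmul _ _ u v) = u * s (e.symm (ε v)) := fun u v => by
        rw [hl, hs, hc, hm]
      refine (Bal.forall_sum_iff l k _ a).2 ?_
      rw [LinearMap.comp_apply, hl', hε.right]
    takeuchi := fun l a w hw => by
      have k := D.takeuchi hb a (e l)
      rw [← P.sw_eq_of_mk_eq (LBal.mul_left hb _) hw,
        ← P.sw_eq_of_mk_eq (LBal.mul_right hb _) hw] at k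
      simp only [hm] at k
      rw [Bal.mk_tmul_mul, Bal.mk_tmul_mul]
      simp only [one_mul]
      exact k
    Δ_one := by
      rw [LinearMap.comp_apply, Bal.mk_eq_sw, ← he, D.d_e hb]
    Δ_mul := fun a a' v w hv hw => by
      -- The multiplication of `D` is the opposite one, so the two representatives enter in reversed
      -- order.
      have k := sw_sw_eq P hb hw hv
      rw [Bal.mk_mul, LinearMap.comp_apply, Bal.mk_eq_sw, ← hm, ← k, sw_comm]
      simp only [hm]
    ε_one := by
      rw [LinearMap.comp_apply, ← he, hε.map_e, ← h.map_one]
      exact e.symm_apply_apply 1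
    ε_mul_s := fun a a' => by
      have := h₁ a' a
      rw [hm, hm] at this
      simp only [LinearMap.comp_apply, LinearEquiv.coe_coe, hs, hc, this]
    ε_mul_t := fun a a' => by
      have := h₂ a' a
      rw [hm, hm] at this
      simp only [LinearMap.comp_apply, LinearEquiv.coe_coe, ht, hc, this] }

end Comult

end MultHopf

/-! ### The Hopf algebroid of part (1) -/

namespace MultHopf

namespace BiComult

variable {A : Type u} {X Y : Type u} [Ring A] [Algebra ℂ A] [AddCommGroup X] [Module ℂ X]
  [AddCommGroup Y] [Module ℂ Y] {P : BiComult A X Y} {L : Type v} {R : Type w} [Ring L]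
  [Algebra ℂ L] [Ring R] [Algebra ℂ R] {e : L ≃ₗ[ℂ] X} {e' : R ≃ₗ[ℂ] Y} {ε : A →ₗ[ℂ] X}
  {η : A →ₗ[ℂ] Y} {S : A →ₗ[ℂ] A}

/-- The Hopf algebroid given by two comultiplications and an antipode. -/
noncomputable def toHopfAlgebroid (hm : ∀ u v, P.L.m u v = u * v) (he : P.L.e = 1)
    (h : P.L.IsBase e) (h' : P.R.IsBase e') (hε : P.L.IsCounit ε) (hη : P.R.IsCounit η)
    (hε₁ : ∀ a a', ε (P.L.m a (P.L.b (ε a'))) = ε (P.L.m a a'))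
    (hε₂ : ∀ a a', ε (P.L.m a (P.L.b' (ε a'))) = ε (P.L.m a a'))
    (hη₁ : ∀ a a', η (P.R.m a (P.R.b (η a'))) = η (P.R.m a a'))
    (hη₂ : ∀ a a', η (P.R.m a (P.R.b' (η a'))) = η (P.R.m a a')) (hS : P.IsAntipode ε η S) :
    HopfAlgebroid A L R :=
  have hm' : ∀ u v, P.R.m u v = v * u := fun u v => by rw [P.R_m, hm]
  let 𝓛 : LeftBialgebroid A L := P.L.toLeftBialgebroid hm he h hε hε₁ hε₂
  let 𝓡 : RightBialgebroid A R := P.R.toRightBialgebroid hm' (P.R_e.trans he) h' hη hη₁ hη₂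
  have Ls : ∀ l, 𝓛.s l = P.L.b' (e l) := fun _ => rfl
  have Lt : ∀ l, 𝓛.t (.op l) = P.L.b (e l) := fun _ => rfl
  have Lε : ∀ a, e (𝓛.ε a) = ε a := fun a => e.apply_symm_apply _
  have Rs : ∀ r, 𝓡.s r = P.R.b (e' r) := fun _ => rfl
  have Rt : ∀ r, 𝓡.t (.op r) = P.R.b' (e' r) := fun _ => rfl
  have Rε : ∀ a, e' (𝓡.ε a) = η a := fun a => e'.apply_symm_apply _
  have PL : Presents (fun x u => P.L.m (P.L.b x) u) (fun x u => P.L.m (P.L.b' x) u)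
      (fun l : L => LinearMap.mulLeft ℂ (𝓛.t (.op l))) (fun l : L => LinearMap.mulLeft ℂ (𝓛.s l)) :=
    ⟨fun l => ⟨e l, fun _ => (hm _ _).symm, fun _ => (hm _ _).symm⟩, fun x => ⟨e.symm x,
      fun u => by rw [LinearMap.mulLeft_apply, Lt, e.apply_symm_apply, hm],
      fun u => by rw [LinearMap.mulLeft_apply, Ls, e.apply_symm_apply, hm]⟩⟩
  have PR : Presents (fun x u => P.R.m (P.R.b x) u) (fun x u => P.R.m (P.R.b' x) u)
      (fun r : R => LinearMap.mulRight ℂ (𝓡.s r))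
      (fun r : R => LinearMap.mulRight ℂ (𝓡.t (.op r))) :=
    ⟨fun l => ⟨e' l, fun _ => (hm' _ _).symm, fun _ => (hm' _ _).symm⟩, fun x => ⟨e'.symm x,
      fun u => by rw [LinearMap.mulRight_apply, Rs, e'.apply_symm_apply, hm'],
      fun u => by rw [LinearMap.mulRight_apply, Rt, e'.apply_symm_apply, hm']⟩⟩
  { left := 𝓛
    right := 𝓡
    S := S
    -- This and the next three fields hold because corresponding base maps of the two
    -- comultiplications have equal ranges, and a counit sends both `b(x)` and `b'(x)` to `x`.
    sL_εL_tR := fun r => by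
      obtain ⟨x, hx⟩ := P.exists_b' (e' r)
      rw [Rt, Ls, Lε, ← hx, hε.map_b'_apply]
    tL_εL_sR := fun r => by
      obtain ⟨x, hx⟩ := P.exists_b (e' r)
      rw [Rs, Lt, Lε, ← hx, hε.map_b_apply]
    sR_εR_tL := fun l => by
      obtain ⟨y, hy⟩ := P.exists_c (e l)
      rw [Lt, Rs, Rε, ← hy, hη.map_b_apply]
    tR_εR_sL := fun l => by
      obtain ⟨y, hy⟩ := P.exists_c' (e l)
      rw [Ls, Rt, Rε, ← hy, hη.map_b'_apply]
    mixed₁ := P.compatible₁.coassociative PL PR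
    mixed₂ := P.compatible₂.coassociative PR PL
    S_bimod := fun l r a => by
      rw [Ls, Lt, Rs, Rt, ← hm, ← hm, hS.map_c', hS.map_b, ← hm, ← hm, P.L.assoc]
    antipode_left := fun a => by
      obtain ⟨l, hl, hl'⟩ := PL.exists_lift hS.lbal_left
      refine (Bal.forall_sum_iff l (fun u v => (hl u v).trans (hm _ _)) _ _).2 ?_
      exact ((hl' _).trans (hS.left a)).trans (congrArg P.R.b (Rε a).symm)
    antipode_right := fun a => by
      obtain ⟨l, hl, hl'⟩ := PR.exists_lift hS.lbal_right
      refine (Bal.forall_sum_iff l (fun u v => (hl u v).trans (hm _ _)) _ _).2 ?_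
      exact ((hl' _).trans (hS.right a)).trans (congrArg P.L.b' (Lε a).symm) }

end BiComult

namespace MultiplierBialgebroid

variable {A : Type u} [Ring A] [Algebra ℂ A] {𝒜 : MultiplierBialgebroid A}

/-- The identification of `B` with the opposite of `L`. -/
def IsUnital.equivL (hu : 𝒜.IsUnital) : hu.L ≃ₗ[ℂ] 𝒜.B where
  toFun l := ⟨l.unop.1, l.unop.2⟩
  invFun x := .op ⟨x.1, x.2⟩
  map_add' _ _ := rfl
  map_smul' _ _ := rfl
  left_inv _ := rfl
  right_inv _ := rfl

/-- The identification of `C` with the opposite of `R`. -/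
def IsUnital.equivR (hu : 𝒜.IsUnital) : hu.R ≃ₗ[ℂ] 𝒜.C where
  toFun l := ⟨l.unop.1, l.unop.2⟩
  invFun x := .op ⟨x.1, x.2⟩
  map_add' _ _ := rfl
  map_smul' _ _ := rfl
  left_inv _ := rfl
  right_inv _ := rfl

/-- Regularity enters twice: bijectivity of the canonical maps supplies the counit identities for
products, and uniqueness of counits makes the given counits the ones belonging to the given
antipode. -/
theorem IsUnital.exists_hopfAlgebroid (hu : 𝒜.IsUnital) (hA : 𝒜.IsRegularHopf) {S : A ≃ₗ[ℂ] A}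
    {ε : A →ₗ[ℂ] 𝒜.B} {η : A →ₗ[ℂ] 𝒜.C} (hS : 𝒜.IsInvertibleAntipode S) (hε : 𝒜.left.IsCounit ε)
    (hη : 𝒜.right.IsCounit η) : ∃ ℋ : HopfAlgebroid A hu.L hu.R,
      hu.IsAssociatedLeft ε AlgEquiv.refl ℋ.left ∧ hu.IsAssociatedRight η AlgEquiv.refl ℋ.right ∧
        ℋ.S = S := by
  have h := hu.realizes
  obtain ⟨K⟩ := h.left.isCanonical_Trho.exists_translation hA.left_Trho
  obtain ⟨T⟩ := h.right.isCanonical_Trho.exists_translation hA.right_Trho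
  have kε := (h.left.isCounit_iff ε).1 hε
  have kη := (h.right.isCounit_iff η).1 hη
  have eL : hu.biComult.L.IsBase hu.equivL := ⟨fun _ _ => rfl, rfl⟩
  have eR : hu.biComult.R.IsBase hu.equivR := ⟨fun _ _ => rfl, rfl⟩
  have hε₂ := K.counit_mul_b'_counit kε
  have hη₂ := T.counit_mul_b'_counit kη
  have hε₁ : ∀ a a', ε (hu.biComult.L.m a (hu.biComult.L.b (ε a'))) =
      ε (hu.biComult.L.m a a') := fun a a' => (K.counit_mul_b kε _ _).trans (hε₂ a a')
  have hη₁ : ∀ a a', η (hu.biComult.R.m a (hu.biComult.R.b (η a'))) =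
      η (hu.biComult.R.m a a') := fun a a' => (T.counit_mul_b kη _ _).trans (hη₂ a a')
  refine ⟨BiComult.toHopfAlgebroid (fun _ _ => rfl) rfl eL eR kε kη hε₁ hε₂ hη₁ hη₂
    (h.isAntipode_of_isCounit hA hu hS kε kη), ⟨fun l => ?_, fun l x hx => ?_, fun a => rfl,
    fun a w => ?_⟩, ⟨fun r => ?_, fun r y hy => ?_, fun a => rfl, fun a w => ?_⟩, rfl⟩
  · exact h.L_b (hu.equivL l)
  · exact (h.L_b' (hu.equivL l)).trans
      (congrArg (fun z => Multiplier.val (𝒜.SB z : Multiplier A)) (Subtype.ext hx.symm))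
  · rw [← h.left.mk_d a]
    -- The two quotients are indexed by `L` and by `B`, but both are presented by the base maps of
    -- the left comultiplication.
    refine Presents.mk_eq_iff (F := fun x u => hu.comultL.m (hu.comultL.b x) u)
      (G := fun x u => hu.comultL.m (hu.comultL.b' x) u) ?_ h.left.presents w _
    exact ⟨fun l => ⟨hu.equivL l, fun _ => rfl, fun _ => rfl⟩,
      fun x => ⟨hu.equivL.symm x, fun _ => rfl, fun _ => rfl⟩⟩
  · exact (h.R_b' (hu.equivR r)).trans (Multiplier.val_eq_r _)
  · exact ((h.R_b (hu.equivR r)).trans (congrArg (fun z => Multiplier.val (𝒜.SC z : Multiplier A))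
      (Subtype.ext hy.symm))).trans (Multiplier.val_eq_r _)
  · rw [← h.right.mk_d a]
    refine Presents.mk_eq_iff (F := fun x u => hu.comultR.m (hu.comultR.b x) u)
      (G := fun x u => hu.comultR.m (hu.comultR.b' x) u) ?_ h.right.presents w _
    exact ⟨fun l => ⟨hu.equivR l, fun _ => rfl, fun _ => rfl⟩,
      fun x => ⟨hu.equivR.symm x, fun _ => rfl, fun _ => rfl⟩⟩

end MultiplierBialgebroid

end MultHopf

/-! ### Multiplier bialgebroids from comultiplications -/

namespace MultHopf

variable {A : Type u} [Ring A] [Algebra ℂ A]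

section OneSided

variable {B : Type v} [NonUnitalRing B] [Module ℂ B] {D : Comult A B}

theorem leftSystem_belongs {s t : B →ₗ[ℂ] Multiplier A} (hm : ∀ u v, D.m u v = u * v)
    (hs : ∀ x, D.b x = Multiplier.val (s x)) (ht : ∀ x, D.b' x = Multiplier.val (t x)) :
    (leftSystem s t).Belongs D.toBasedAlgebra where
  toPresents := .of_eq (fun x u => by rw [hm, hs]; exact Multiplier.l_apply _ _)
    (fun x u => by rw [hm, ht]; exact Multiplier.l_apply _ _)
  ρ_apply a u := (hm u a).symm

theorem rightSystem_belongs {s t : B →ₗ[ℂ] Multiplier A} (hm : ∀ u v, D.m u v = v * u)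
    (ht : ∀ x, D.b x = Multiplier.val (t x)) (hs : ∀ x, D.b' x = Multiplier.val (s x)) :
    (rightSystem s t).Belongs D.toBasedAlgebra where
  toPresents := .of_eq (fun x u => by rw [hm, ht]; exact Multiplier.r_apply _ _)
    (fun x u => by rw [hm, hs]; exact Multiplier.r_apply _ _)
  ρ_apply a u := (hm u a).symm

/-- The left multiplier bialgebroid given by a comultiplication. -/
noncomputable def LeftMultiplierBialgebroid.ofComult (s t : B →ₗ[ℂ] Multiplier A)
    (hm : ∀ u v, D.m u v = u * v) (hs : ∀ x, D.b x = Multiplier.val (s x))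
    (ht : ∀ x, D.b' x = Multiplier.val (t x)) (hμ : ∀ x y, D.μ x y = x * y) :
    LeftMultiplierBialgebroid A B :=
  have P := leftSystem_belongs hm hs ht
  have hsl : ∀ x a, (s x).l a = D.m (D.b x) a := fun x a => by
    rw [hm, hs, Multiplier.l_apply]
  have htl : ∀ x a, (t x).l a = D.m (D.b' x) a := fun x a => by
    rw [hm, ht, Multiplier.l_apply]
  have hsr : ∀ x a, (s x).r a = D.m a (D.b x) := fun x a => by
    rw [hm, hs, Multiplier.r_apply]
  have htr : ∀ x a, (t x).r a = D.m a (D.b' x) := fun x a => by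
    rw [hm, ht, Multiplier.r_apply]
  { s := s
    t := t
    s_mul := fun x y => Multiplier.val_injective <| by
      rw [Multiplier.val_mul, ← hs, ← hs, ← hs, ← hm, ← D.b_μ, hμ]
    t_mul := fun x y => Multiplier.val_injective <| by
      rw [Multiplier.val_mul, ← ht, ← ht, ← ht, ← hm, ← D.b'_μ, hμ]
    comm := fun x y => Multiplier.val_injective <| by
      rw [Multiplier.val_mul, Multiplier.val_mul, ← hs, ← ht, ← hm, ← hm, D.b_comm]
    nondeg := fun a h => by rw [← mul_one a, h]
    idem := Submodule.eq_top_iff'.2 fun a => Submodule.subset_span ⟨a, 1, (mul_one a).symm⟩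
    s_faithful := fun x h => D.b_inj (by rw [map_zero, ← D.m_e (D.b x), ← hsl, h])
    t_faithful := fun x h => D.b'_inj (by rw [map_zero, ← D.m_e (D.b' x), ← htl, h])
    s_idem := Submodule.eq_top_iff'.2 fun a => Submodule.subset_span
      ⟨D.o, a, by rw [hsl, D.b_o, D.e_m]⟩
    t_idem := Submodule.eq_top_iff'.2 fun a => Submodule.subset_span
      ⟨D.o, a, by rw [htl, D.b'_o, D.e_m]⟩
    tensor_nondeg := P.nondegenerate
    Δ := D.toMultipliers P
    Δ_mul := fun a a' => by rw [← hm, D.toMultipliers_m]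
    Δ_s_left := fun x a => by
      rw [hsl]
      exact D.toMultipliers_b_mul P x a _ fun u v =>
        congrArg (fun z => (leftSystem s t).tmul u z) (hsl x v)
    Δ_t_left := fun x a => by
      rw [htl]
      exact D.toMultipliers_b'_mul P x a _ fun u v =>
        congrArg (fun z => (leftSystem s t).tmul z v) (htl x u)
    Δ_s_right := fun x a => by
      rw [hsr]
      exact D.toMultipliers_mul_b P x a _ fun u v =>
        congrArg (fun z => (leftSystem s t).tmul u z) (hsl x v)
    Δ_t_right := fun x a => by
      rw [htr]
      exact D.toMultipliers_mul_b' P x a _ fun u v =>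
        congrArg (fun z => (leftSystem s t).tmul z v) (htl x u)
    coassoc := (Comult.compatible_self D).commuteOnLegs P _ P _ }

theorem LeftMultiplierBialgebroid.realizes_ofComult (s t : B →ₗ[ℂ] Multiplier A)
    (hm : ∀ u v, D.m u v = u * v) (he : D.e = 1) (hs : ∀ x, D.b x = Multiplier.val (s x))
    (ht : ∀ x, D.b' x = Multiplier.val (t x)) (hμ : ∀ x y, D.μ x y = x * y) :
    (LeftMultiplierBialgebroid.ofComult s t hm hs ht hμ).Realizes D where
  m_apply := hm
  e_eq := he
  b_apply := hs
  b'_apply := ht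
  μ_apply := hμ
  preTrho_apply a b := by
    simp only [← hm]
    exact Comult.slice₂_toMultipliers (leftSystem_belongs hm hs ht)
      (leftSystem_belongs hm hs ht).nondegenerate a b
  preTlam_apply a b := by
    simp only [← hm]
    exact Comult.slice₁_toMultipliers (leftSystem_belongs hm hs ht)
      (leftSystem_belongs hm hs ht).nondegenerate b a

/-- The right multiplier bialgebroid given by a comultiplication on the opposite algebra. -/
noncomputable def RightMultiplierBialgebroid.ofComult (s t : B →ₗ[ℂ] Multiplier A)
    (hm : ∀ u v, D.m u v = v * u) (ht : ∀ x, D.b x = Multiplier.val (t x))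
    (hs : ∀ x, D.b' x = Multiplier.val (s x)) (hμ : ∀ x y, D.μ x y = x * y) :
    RightMultiplierBialgebroid A B :=
  have P := rightSystem_belongs hm ht hs
  have hsl : ∀ x a, (s x).l a = D.m a (D.b' x) := fun x a => by
    rw [hm, hs, Multiplier.l_apply]
  have htl : ∀ x a, (t x).l a = D.m a (D.b x) := fun x a => by
    rw [hm, ht, Multiplier.l_apply]
  have hsr : ∀ x a, (s x).r a = D.m (D.b' x) a := fun x a => by
    rw [hm, hs, Multiplier.r_apply]
  have htr : ∀ x a, (t x).r a = D.m (D.b x) a := fun x a => by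
    rw [hm, ht, Multiplier.r_apply]
  { s := s
    t := t
    s_mul := fun x y => Multiplier.val_injective <| by
      rw [Multiplier.val_mul, ← hs, ← hs, ← hs, ← hm, ← D.b'_μ, hμ]
    t_mul := fun x y => Multiplier.val_injective <| by
      rw [Multiplier.val_mul, ← ht, ← ht, ← ht, ← hm, ← D.b_μ, hμ]
    comm := fun x y => Multiplier.val_injective <| by
      rw [Multiplier.val_mul, Multiplier.val_mul, ← hs, ← ht, ← hm, ← hm, D.b_comm]
    nondeg := fun a h => by rw [← one_mul a, h]
    idem := Submodule.eq_top_iff'.2 fun a => Submodule.subset_span ⟨a, 1, (mul_one a).symm⟩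
    s_faithful := fun x h => D.b'_inj (by rw [map_zero, ← D.m_e (D.b' x), ← hsr, h])
    t_faithful := fun x h => D.b_inj (by rw [map_zero, ← D.m_e (D.b x), ← htr, h])
    s_idem := Submodule.eq_top_iff'.2 fun a => Submodule.subset_span
      ⟨D.o, a, by rw [hsr, D.b'_o, D.e_m]⟩
    t_idem := Submodule.eq_top_iff'.2 fun a => Submodule.subset_span
      ⟨D.o, a, by rw [htr, D.b_o, D.e_m]⟩
    tensor_nondeg := P.nondegenerate
    Δ := D.toMultipliers P
    Δ_mul := fun a a' => by rw [← hm, D.toMultipliers_m]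
    Δ_s_left := fun x a => by
      rw [hsl]
      exact D.toMultipliers_mul_b' P x a _ fun u v =>
        congrArg (fun z => (rightSystem s t).tmul z v) (hsr x u)
    Δ_t_left := fun x a => by
      rw [htl]
      exact D.toMultipliers_mul_b P x a _ fun u v =>
        congrArg (fun z => (rightSystem s t).tmul u z) (htr x v)
    Δ_s_right := fun x a => by
      rw [hsr]
      exact D.toMultipliers_b'_mul P x a _ fun u v =>
        congrArg (fun z => (rightSystem s t).tmul z v) (hsr x u)
    Δ_t_right := fun x a => by
      rw [htr]
      exact D.toMultipliers_b_mul P x a _ fun u v =>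
        congrArg (fun z => (rightSystem s t).tmul u z) (htr x v)
    coassoc := (Comult.compatible_self D).commuteOnLegs P _ P _ }

theorem RightMultiplierBialgebroid.realizes_ofComult (s t : B →ₗ[ℂ] Multiplier A)
    (hm : ∀ u v, D.m u v = v * u) (he : D.e = 1) (ht : ∀ x, D.b x = Multiplier.val (t x))
    (hs : ∀ x, D.b' x = Multiplier.val (s x)) (hμ : ∀ x y, D.μ x y = x * y) :
    (RightMultiplierBialgebroid.ofComult s t hm ht hs hμ).Realizes D where
  m_apply := hm
  e_eq := he
  b_apply := ht
  b'_apply := hs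
  μ_apply := hμ
  preTrho_apply a b := by
    simp only [← hm]
    exact Comult.slice₂_toMultipliers (rightSystem_belongs hm ht hs)
      (rightSystem_belongs hm ht hs).nondegenerate a b
  preTlam_apply a b := by
    simp only [← hm]
    exact Comult.slice₁_toMultipliers (rightSystem_belongs hm ht hs)
      (rightSystem_belongs hm ht hs).nondegenerate b a

end OneSided

namespace MultiplierBialgebroid

variable {B C : NonUnitalSubalgebra ℂ (Multiplier A)}

/-- The base maps of `P` are those of a multiplier bialgebroid `(A, B, C, S_B, S_C)`. -/
structure IsBase (P : BiComult A B C) (SB : B ≃ₗ[ℂ] C) (SC : C ≃ₗ[ℂ] B) : Prop where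
  m_apply : ∀ u v, P.L.m u v = u * v
  e_eq : P.L.e = 1
  L_b : ∀ x, P.L.b x = Multiplier.val (x : Multiplier A)
  L_b' : ∀ x, P.L.b' x = Multiplier.val (SB x : Multiplier A)
  L_μ : ∀ x y, P.L.μ x y = x * y
  R_b : ∀ y, P.R.b y = Multiplier.val (SC y : Multiplier A)
  R_b' : ∀ y, P.R.b' y = Multiplier.val (y : Multiplier A)
  R_μ : ∀ x y, P.R.μ x y = x * y

namespace IsBase

variable {P : BiComult A B C} {SB : B ≃ₗ[ℂ] C} {SC : C ≃ₗ[ℂ] B} (h : IsBase P SB SC)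
include h

theorem R_m_apply (u v : A) : P.R.m u v = v * u := by rw [P.R_m, h.m_apply]

theorem R_e_eq : P.R.e = 1 := by rw [P.R_e, h.e_eq]

theorem belongs_L : (leftSystem B.toSubmodule.subtype
    (C.toSubmodule.subtype ∘ₗ SB.toLinearMap)).Belongs P.L.toBasedAlgebra :=
  leftSystem_belongs h.m_apply h.L_b h.L_b'

theorem belongs_R : (rightSystem C.toSubmodule.subtype
    (B.toSubmodule.subtype ∘ₗ SC.toLinearMap)).Belongs P.R.toBasedAlgebra :=
  rightSystem_belongs h.R_m_apply h.R_b h.R_b'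

/-- The left multiplier bialgebroid given by `P`. -/
noncomputable def left : LeftMultiplierBialgebroid A B :=
  LeftMultiplierBialgebroid.ofComult (D := P.L) B.toSubmodule.subtype
    (C.toSubmodule.subtype ∘ₗ SB.toLinearMap) h.m_apply h.L_b h.L_b' h.L_μ

/-- The right multiplier bialgebroid given by `P`. -/
noncomputable def right : RightMultiplierBialgebroid A C :=
  RightMultiplierBialgebroid.ofComult (D := P.R) C.toSubmodule.subtype
    (B.toSubmodule.subtype ∘ₗ SC.toLinearMap) h.R_m_apply h.R_b h.R_b' h.R_μ

/-- The multiplier bialgebroid given by `P`. -/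
noncomputable def toMultiplierBialgebroid : MultiplierBialgebroid A where
  B := B
  C := C
  SB := SB
  SC := SC
  SB_mul x y := Subtype.ext <| Multiplier.val_injective <| by
    rw [← h.L_b', ← h.L_μ, P.L.b'_μ, h.m_apply, h.L_b', h.L_b', ← Multiplier.val_mul]; rfl
  SC_mul x y := Subtype.ext <| Multiplier.val_injective <| by
    rw [← h.R_b, ← h.R_μ, P.R.b_μ, h.R_m_apply, h.R_b, h.R_b, ← Multiplier.val_mul]; rfl
  left := h.left
  right := h.right
  left_s _ := rfl
  left_t _ := rfl
  right_s _ := rfl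
  right_t _ := rfl
  mixed₁ := P.compatible₁.commuteOnLegs h.belongs_L h.left.tensor_nondeg h.belongs_R
    h.right.tensor_nondeg
  mixed₂ := P.compatible₂.commuteOnLegs h.belongs_R h.right.tensor_nondeg h.belongs_L
    h.left.tensor_nondeg

theorem realizes : h.toMultiplierBialgebroid.Realizes P where
  left := LeftMultiplierBialgebroid.realizes_ofComult _ _ h.m_apply h.e_eq h.L_b h.L_b' h.L_μ
  right := RightMultiplierBialgebroid.realizes_ofComult _ _ h.R_m_apply h.R_e_eq h.R_b h.R_b' h.R_μ

theorem isUnital : h.toMultiplierBialgebroid.IsUnital where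
  one_mem_B := by
    have : ((P.L.o : B) : Multiplier A) = 1 := Multiplier.val_injective <| by
      rw [← h.L_b, P.L.b_o, h.e_eq, Multiplier.val_one]
    exact this ▸ P.L.o.2
  one_mem_C := by
    have : ((P.R.o : C) : Multiplier A) = 1 := Multiplier.val_injective <| by
      rw [← h.R_b', P.R.b'_o, h.R_e_eq, Multiplier.val_one]
    exact this ▸ P.R.o.2
  Δ_left_one := by
    rw [← h.e_eq]; exact P.L.toMultipliers_e h.belongs_L
  Δ_right_one := by
    rw [← h.R_e_eq]; exact P.R.toMultipliers_e h.belongs_R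

/-- In the fullness conditions the counits serve as the module maps `ω`. Their value at `1` is the
unit of the base, so every element of `A` is already a single product of the required form. -/
theorem isRegularHopf {ε : A →ₗ[ℂ] B} {η : A →ₗ[ℂ] C} (hε : P.L.IsCounit ε)
    (hη : P.R.IsCounit η) (K : Translation P.L) (K' : Translation P.L.cop) (T : Translation P.R)
    (T' : Translation P.R.cop) : h.toMultiplierBialgebroid.IsRegularHopf where
  full_B_left := Submodule.eq_top_iff'.2 fun a => Submodule.subset_span ⟨ε, 1, a, fun x b => by
    rw [Multiplier.l_apply, ← h.m_apply]
    exact (congrArg (fun z => ε (P.L.m z b)) (h.L_b x).symm).trans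
      ((hε.map_b x b).trans (h.L_μ _ _)), by
    refine Eq.trans ?_ (Multiplier.l_apply _ _).symm
    refine Eq.trans ?_ (congrArg (· * a) (h.L_b' (ε 1)))
    rw [← h.e_eq, hε.b'_e, h.e_eq, one_mul]⟩
  full_B_right := Submodule.eq_top_iff'.2 fun a => Submodule.subset_span ⟨ε, 1, a, fun x b => by
    rw [Multiplier.l_apply, ← h.m_apply]
    exact (congrArg (fun z => ε (P.L.m z b)) (h.L_b' x).symm).trans
      ((hε.map_b' x b).trans (h.L_μ _ _)), by
    refine Eq.trans ?_ (Multiplier.l_apply _ _).symm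
    refine Eq.trans ?_ (congrArg (· * a) (h.L_b (ε 1)))
    rw [← h.e_eq, hε.map_e, P.L.b_o, h.e_eq, one_mul]⟩
  full_C_right := Submodule.eq_top_iff'.2 fun a => Submodule.subset_span ⟨η, 1, a, fun x b => by
    rw [Multiplier.r_apply, ← h.R_m_apply]
    exact (congrArg (fun z => η (P.R.m z b)) (h.R_b' x).symm).trans
      ((hη.map_b' x b).trans (h.R_μ _ _)), by
    refine Eq.trans ?_ (Multiplier.r_apply _ _).symm
    refine Eq.trans ?_ (congrArg (a * ·) (h.R_b (η 1)))
    rw [← h.R_e_eq, hη.map_e, P.R.b_o, h.R_e_eq, mul_one]⟩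
  full_C_left := Submodule.eq_top_iff'.2 fun a => Submodule.subset_span ⟨η, 1, a, fun x b => by
    rw [Multiplier.r_apply, ← h.R_m_apply]
    exact (congrArg (fun z => η (P.R.m z b)) (h.R_b x).symm).trans
      ((hη.map_b x b).trans (h.R_μ _ _)), by
    refine Eq.trans ?_ (Multiplier.r_apply _ _).symm
    refine Eq.trans ?_ (congrArg (a * ·) (h.R_b' (η 1)))
    rw [← h.R_e_eq, hη.b'_e, h.R_e_eq, mul_one]⟩
  left_Tlam := h.realizes.left.isCanonical'_Tlam.bijective K'
  left_Trho := h.realizes.left.isCanonical_Trho.bijective K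
  right_Tlam := h.realizes.right.isCanonical'_Tlam.bijective T'
  right_Trho := h.realizes.right.isCanonical_Trho.bijective T

end IsBase

end MultiplierBialgebroid

end MultHopf

/-! ### Comultiplications and antipodes from Hopf algebroids -/

namespace MultHopf

section OneSided

variable {A : Type u} {X : Type v} {L : Type w} [Ring A] [Algebra ℂ A] [AddCommGroup X]
  [Module ℂ X] [Ring L] [Algebra ℂ L]

/-- The algebra and base maps of a left bialgebroid, after identification of the opposite of the base
algebra with `X`. -/
structure LeftBialgebroid.Over (𝓛 : LeftBialgebroid A L) (Q : BasedAlgebra A X) (e : L ≃ₗ[ℂ] X) :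
    Prop where
  m_apply : ∀ u v, Q.m u v = u * v
  e_eq : Q.e = 1
  b_apply : ∀ l, Q.b (e l) = 𝓛.t (.op l)
  b'_apply : ∀ l, Q.b' (e l) = 𝓛.s l

/-- The algebra and base maps of a right bialgebroid, after identification of the opposite of the base
algebra with `X`. -/
structure RightBialgebroid.Over (𝓡 : RightBialgebroid A L) (Q : BasedAlgebra A X) (e : L ≃ₗ[ℂ] X) :
    Prop where
  m_apply : ∀ u v, Q.m u v = v * u
  e_eq : Q.e = 1
  b_apply : ∀ l, Q.b (e l) = 𝓡.s l
  b'_apply : ∀ l, Q.b' (e l) = 𝓡.t (.op l)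

namespace LeftBialgebroid.Over

variable {𝓛 : LeftBialgebroid A L} {Q : BasedAlgebra A X} {e : L ≃ₗ[ℂ] X} (h : 𝓛.Over Q e)
include h

theorem presents : Presents (fun x u => Q.m (Q.b x) u) (fun x u => Q.m (Q.b' x) u)
    (fun l : L => LinearMap.mulLeft ℂ (𝓛.t (.op l))) (fun l : L => LinearMap.mulLeft ℂ (𝓛.s l)) :=
  ⟨fun l => ⟨e l, fun u => by rw [h.m_apply, h.b_apply]; rfl,
    fun u => by rw [h.m_apply, h.b'_apply]; rfl⟩, fun x => ⟨e.symm x,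
      fun u => by rw [h.m_apply, ← e.apply_symm_apply x, h.b_apply]; simp,
      fun u => by rw [h.m_apply, ← e.apply_symm_apply x, h.b'_apply]; simp⟩⟩

theorem isBase (l l' : L) : e (l * l') = Q.μ (e l') (e l) := Q.b_inj <| by
  rw [Q.b_μ, h.m_apply, h.b_apply, h.b_apply, h.b_apply, ← map_mul]; rfl

/-- The comultiplication of a left bialgebroid. -/
noncomputable def toComult : Comult A X :=
  have hs := Bal.exists_section _ _ 𝓛.Δ
  have hd : ∀ a, Bal.mk _ _ (hs.choose a) = 𝓛.Δ a := hs.choose_spec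
  Comult.ofBal Q h.presents hs.choose
    (by rw [hd, h.e_eq, 𝓛.Δ_one])
    (fun a a' => by
      rw [hd, h.m_apply, 𝓛.Δ_mul a a' _ _ (hd a) (hd a'), Bal.mk_mul]
      simp only [h.m_apply])
    (fun a x => by
      have := 𝓛.takeuchi (e.symm x) a _ (hd a)
      rw [Bal.mk_mul_tmul, Bal.mk_mul_tmul, ← h.b_apply, ← h.b'_apply, e.apply_symm_apply] at this
      simpa only [h.m_apply, mul_one] using this)
    (fun x a => by
      have := 𝓛.Δ_bimod 1 (e.symm x) a _ (hd a)
      rw [Bal.mk_tmul_mul, ← h.b_apply, e.apply_symm_apply, map_one, one_mul, ← hd] at this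
      simpa only [h.m_apply, one_mul] using this.symm)
    (fun x a => by
      have := 𝓛.Δ_bimod (e.symm x) 1 a _ (hd a)
      rw [Bal.mk_tmul_mul, ← h.b'_apply, e.apply_symm_apply, MulOpposite.op_one, map_one, mul_one,
        ← hd] at this
      simpa only [h.m_apply, one_mul] using this.symm)
    (by
      rw [show Bal.mk _ _ ∘ₗ hs.choose = 𝓛.Δ from LinearMap.ext hd]
      exact 𝓛.coassoc)

theorem mk_d (a : A) : Bal.mk _ _ (h.toComult.d a) = 𝓛.Δ a :=
  (Bal.exists_section _ _ 𝓛.Δ).choose_spec a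

theorem isCounit : h.toComult.IsCounit (e.toLinearMap ∘ₗ 𝓛.ε) := by
  have map_b : ∀ x a, e (𝓛.ε (Q.m (Q.b x) a)) = Q.μ x (e (𝓛.ε a)) := fun x a => by
    have := 𝓛.ε_bimod 1 (e.symm x) a
    rw [← h.b_apply, e.apply_symm_apply, map_one, one_mul, one_mul] at this
    rw [h.m_apply, this, h.isBase, e.apply_symm_apply]
  have map_b' : ∀ x a, e (𝓛.ε (Q.m (Q.b' x) a)) = Q.μ (e (𝓛.ε a)) x := fun x a => by
    have := 𝓛.ε_bimod (e.symm x) 1 a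
    rw [← h.b'_apply, e.apply_symm_apply, MulOpposite.op_one, map_one, mul_one, mul_one] at this
    rw [h.m_apply, this, h.isBase, e.apply_symm_apply]
  refine ⟨map_b, map_b', fun a => ?_, fun a => ?_⟩
  · have bal : Q.LBal fun u v => Q.m (Q.b' (e (𝓛.ε u))) v :=
      ⟨by constructor <;> simp, fun x u v => by simp only [map_b, Q.b'_μ, Q.assoc]⟩
    obtain ⟨l, hl, hl'⟩ := h.presents.exists_lift bal
    refine (hl' _).symm.trans ((congrArg l (h.mk_d a)).trans ?_)
    refine (Bal.forall_sum_iff (φ := fun u v => 𝓛.s (𝓛.ε u) * v) l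
      (fun u v => (hl u v).trans ?_) _ _).1 (𝓛.counit_left a)
    rw [h.m_apply, h.b'_apply]
  · have bal : Q.LBal fun u v => Q.m (Q.b (e (𝓛.ε v))) u :=
      ⟨by constructor <;> simp, fun x u v => by simp only [map_b', Q.b_μ, Q.assoc]⟩
    obtain ⟨l, hl, hl'⟩ := h.presents.exists_lift bal
    refine (hl' _).symm.trans ((congrArg l (h.mk_d a)).trans ?_)
    refine (Bal.forall_sum_iff (φ := fun u v => 𝓛.t (.op (𝓛.ε v)) * u) l
      (fun u v => (hl u v).trans ?_) _ _).1 (𝓛.counit_right a)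
    rw [h.m_apply, h.b_apply]

end LeftBialgebroid.Over

namespace RightBialgebroid.Over

variable {𝓡 : RightBialgebroid A L} {Q : BasedAlgebra A X} {e : L ≃ₗ[ℂ] X} (h : 𝓡.Over Q e)
include h

theorem presents : Presents (fun x u => Q.m (Q.b x) u) (fun x u => Q.m (Q.b' x) u)
    (fun l : L => LinearMap.mulRight ℂ (𝓡.s l)) (fun l : L => LinearMap.mulRight ℂ (𝓡.t (.op l))) :=
  ⟨fun l => ⟨e l, fun u => by rw [h.m_apply, h.b_apply]; rfl,
    fun u => by rw [h.m_apply, h.b'_apply]; rfl⟩, fun x => ⟨e.symm x,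
      fun u => by rw [h.m_apply, ← e.apply_symm_apply x, h.b_apply]; simp,
      fun u => by rw [h.m_apply, ← e.apply_symm_apply x, h.b'_apply]; simp⟩⟩

theorem isBase (l l' : L) : e (l * l') = Q.μ (e l') (e l) := Q.b_inj <| by
  rw [Q.b_μ, h.m_apply, h.b_apply, h.b_apply, h.b_apply, ← map_mul]

/-- The comultiplication of a right bialgebroid. -/
noncomputable def toComult : Comult A X :=
  have hs := Bal.exists_section _ _ 𝓡.Δ
  have hd : ∀ a, Bal.mk _ _ (hs.choose a) = 𝓡.Δ a := hs.choose_spec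
  Comult.ofBal Q h.presents hs.choose
    (by rw [hd, h.e_eq, 𝓡.Δ_one])
    (fun a a' => by
      rw [hd, h.m_apply, 𝓡.Δ_mul a' a _ _ (hd a') (hd a), Bal.mk_mul, sw_comm]
      simp only [h.m_apply])
    (fun a x => by
      have := 𝓡.takeuchi (e.symm x) a _ (hd a)
      rw [Bal.mk_tmul_mul, Bal.mk_tmul_mul, ← h.b_apply, ← h.b'_apply, e.apply_symm_apply] at this
      simpa only [h.m_apply, one_mul] using this)
    (fun x a => by
      have := 𝓡.Δ_bimod 1 (e.symm x) a _ (hd a)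
      rw [Bal.mk_mul_tmul, ← h.b_apply, e.apply_symm_apply, MulOpposite.op_one, map_one, mul_one,
        ← hd] at this
      simpa only [h.m_apply, mul_one] using this.symm)
    (fun x a => by
      have := 𝓡.Δ_bimod (e.symm x) 1 a _ (hd a)
      rw [Bal.mk_mul_tmul, ← h.b'_apply, e.apply_symm_apply, map_one, mul_one, ← hd] at this
      simpa only [h.m_apply, mul_one] using this.symm)
    (by
      rw [show Bal.mk _ _ ∘ₗ hs.choose = 𝓡.Δ from LinearMap.ext hd]
      exact 𝓡.coassoc)

theorem mk_d (a : A) : Bal.mk _ _ (h.toComult.d a) = 𝓡.Δ a :=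
  (Bal.exists_section _ _ 𝓡.Δ).choose_spec a

theorem isCounit : h.toComult.IsCounit (e.toLinearMap ∘ₗ 𝓡.ε) := by
  have map_b : ∀ x a, e (𝓡.ε (Q.m (Q.b x) a)) = Q.μ x (e (𝓡.ε a)) := fun x a => by
    have := 𝓡.ε_bimod 1 (e.symm x) a
    rw [← h.b_apply, e.apply_symm_apply, MulOpposite.op_one, map_one, mul_one, one_mul] at this
    rw [h.m_apply, this, h.isBase, e.apply_symm_apply]
  have map_b' : ∀ x a, e (𝓡.ε (Q.m (Q.b' x) a)) = Q.μ (e (𝓡.ε a)) x := fun x a => by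
    have := 𝓡.ε_bimod (e.symm x) 1 a
    rw [← h.b'_apply, e.apply_symm_apply, map_one, mul_one, mul_one] at this
    rw [h.m_apply, this, h.isBase, e.apply_symm_apply]
  refine ⟨map_b, map_b', fun a => ?_, fun a => ?_⟩
  · have bal : Q.LBal fun u v => Q.m (Q.b' (e (𝓡.ε u))) v :=
      ⟨by constructor <;> simp, fun x u v => by simp only [map_b, Q.b'_μ, Q.assoc]⟩
    obtain ⟨l, hl, hl'⟩ := h.presents.exists_lift bal
    refine (hl' _).symm.trans ((congrArg l (h.mk_d a)).trans ?_)
    refine (Bal.forall_sum_iff (φ := fun u v => v * 𝓡.t (.op (𝓡.ε u))) l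
      (fun u v => (hl u v).trans ?_) _ _).1 (𝓡.counit_left a)
    rw [h.m_apply, h.b'_apply]
  · have bal : Q.LBal fun u v => Q.m (Q.b (e (𝓡.ε v))) u :=
      ⟨by constructor <;> simp, fun x u v => by simp only [map_b', Q.b_μ, Q.assoc]⟩
    obtain ⟨l, hl, hl'⟩ := h.presents.exists_lift bal
    refine (hl' _).symm.trans ((congrArg l (h.mk_d a)).trans ?_)
    refine (Bal.forall_sum_iff (φ := fun u v => u * 𝓡.s (𝓡.ε v)) l
      (fun u v => (hl u v).trans ?_) _ _).1 (𝓡.counit_right a)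
    rw [h.m_apply, h.b_apply]

end RightBialgebroid.Over

end OneSided

namespace HopfAlgebroid

variable {H : Type u} {L : Type v} {R : Type w} [Ring H] [Algebra ℂ H] [Ring L] [Algebra ℂ L]
  [Ring R] [Algebra ℂ R] {ℋ : HopfAlgebroid H L R} {X Y : Type u} [AddCommGroup X] [Module ℂ X]
  [AddCommGroup Y] [Module ℂ Y] {QL : BasedAlgebra H X} {QR : BasedAlgebra H Y} {e : L ≃ₗ[ℂ] X}
  {e' : R ≃ₗ[ℂ] Y} (h : ℋ.left.Over QL e) (h' : ℋ.right.Over QR e')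

/-- The two comultiplications of a Hopf algebroid. -/
noncomputable def toBiComult : BiComult H X Y where
  L := h.toComult
  R := h'.toComult
  R_m u v := (h'.m_apply u v).trans (h.m_apply v u).symm
  R_e := h'.e_eq.trans h.e_eq.symm
  -- The relations between source, target and counit maps of the two bialgebroids give explicit
  -- preimages: `t_L(l) = s_R(ε_R(t_L(l)))` and `s_R(r) = t_L(ε_L(s_R(r)))`.
  range_b := by
    refine le_antisymm ?_ ?_
    · rintro _ ⟨x, rfl⟩
      refine ⟨e' (ℋ.right.ε (ℋ.left.t (.op (e.symm x)))), (h'.b_apply _).trans ?_⟩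
      rw [ℋ.sR_εR_tL, ← h.b_apply, e.apply_symm_apply]; rfl
    · rintro _ ⟨y, rfl⟩
      refine ⟨e (ℋ.left.ε (ℋ.right.s (e'.symm y))), (h.b_apply _).trans ?_⟩
      rw [ℋ.tL_εL_sR, ← h'.b_apply, e'.apply_symm_apply]; rfl
  range_b' := by
    refine le_antisymm ?_ ?_
    · rintro _ ⟨x, rfl⟩
      refine ⟨e' (ℋ.right.ε (ℋ.left.s (e.symm x))), (h'.b'_apply _).trans ?_⟩
      rw [ℋ.tR_εR_sL, ← h.b'_apply, e.apply_symm_apply]; rfl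
    · rintro _ ⟨y, rfl⟩
      refine ⟨e (ℋ.left.ε (ℋ.right.t (.op (e'.symm y)))), (h.b'_apply _).trans ?_⟩
      rw [ℋ.sL_εL_tR, ← h'.b'_apply, e'.apply_symm_apply]; rfl
  mixed₁ hχ a := h.presents.sw_mixed h'.presents _ _ _ _ h.mk_d h'.mk_d a
    (ℋ.mixed₁ a _ _ (h.mk_d a) (h'.mk_d a)) hχ
  mixed₂ hχ a := h'.presents.sw_mixed h.presents _ _ _ _ h'.mk_d h.mk_d a
    (ℋ.mixed₂ a _ _ (h'.mk_d a) (h.mk_d a)) hχ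

theorem isAntipode : (toBiComult h h').IsAntipode (e.toLinearMap ∘ₗ ℋ.left.ε)
    (e'.toLinearMap ∘ₗ ℋ.right.ε) ℋ.S := by
  have map_b : ∀ x a, ℋ.S (QL.m (QL.b x) a) = QL.m (ℋ.S a) (QL.b' x) := fun x a => by
    have := ℋ.S_bimod (e.symm x) 1 a
    rw [← h.b_apply, ← h.b'_apply, e.apply_symm_apply, MulOpposite.op_one, map_one, map_one,
      mul_one, one_mul] at this
    rw [h.m_apply, h.m_apply, this]
  have map_c' : ∀ y a, ℋ.S (QL.m a (QR.b' y)) = QL.m (QR.b y) (ℋ.S a) := fun y a => by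
    have := ℋ.S_bimod 1 (e'.symm y) a
    rw [← h'.b_apply, ← h'.b'_apply, e'.apply_symm_apply, MulOpposite.op_one, map_one, map_one,
      mul_one, one_mul] at this
    rw [h.m_apply, h.m_apply, this]
  have hm : ∀ u v, QR.m u v = QL.m v u := fun u v => (h'.m_apply u v).trans (h.m_apply v u).symm
  refine ⟨map_b, map_c', fun a => ?_, fun a => ?_⟩
  · have bal : QL.LBal fun u v => QL.m (ℋ.S u) v :=
      ⟨by constructor <;> simp, fun x u v => by simp only [map_b, QL.assoc]⟩
    obtain ⟨l, hl, hl'⟩ := h.presents.exists_lift bal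
    refine (hl' _).symm.trans ((congrArg l (h.mk_d a)).trans (Eq.trans ?_ (h'.b_apply _).symm))
    exact (Bal.forall_sum_iff l (fun u v => (hl u v).trans (h.m_apply _ _)) _ _).1
      (ℋ.antipode_left a)
  · have bal : QR.LBal fun u v => QL.m u (ℋ.S v) :=
      ⟨by constructor <;> simp, fun x u v => by simp only [hm, map_c', QL.assoc]⟩
    obtain ⟨l, hl, hl'⟩ := h'.presents.exists_lift bal
    refine (hl' _).symm.trans ((congrArg l (h'.mk_d a)).trans (Eq.trans ?_ (h.b'_apply _).symm))
    exact (Bal.forall_sum_iff l (fun u v => (hl u v).trans (h.m_apply _ _)) _ _).1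
      (ℋ.antipode_right a)

-- Anti-multiplicativity is not an axiom. The antipode itself provides the inverse of a canonical
-- map, and the multiplicativity axioms for `ε_R` are the remaining input of `map_m`.
include h h' in
theorem antipode_mul (g k : H) : ℋ.S (g * k) = ℋ.S k * ℋ.S g := by
  have hS := isAntipode h h'
  have hη : (toBiComult h h').R.IsCounit _ := h'.isCounit
  have := hS.map_m (hS.translation h.isCounit hη) hη (fun a a' => ?_) (fun a a' => ?_) g k
  · exact (congrArg ℋ.S (h.m_apply g k)).symm.trans (this.trans (h.m_apply _ _))
  · refine congrArg e' (Eq.trans ?_ ((ℋ.right.ε_mul_s a' a).trans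
      (congrArg ℋ.right.ε (h'.m_apply a a').symm)))
    refine congrArg ℋ.right.ε ((h'.m_apply _ _).trans ?_)
    exact congrArg (· * a) (h'.b_apply _)
  · refine congrArg e' (Eq.trans ?_ ((ℋ.right.ε_mul_t a' a).trans
      (congrArg ℋ.right.ε (h'.m_apply a a').symm)))
    refine congrArg ℋ.right.ε ((h'.m_apply _ _).trans ?_)
    exact congrArg (· * a) (h'.b'_apply _)

end HopfAlgebroid

namespace BiComult

variable {V : Type u} {X : Type v} {Y : Type w} [AddCommGroup V] [Module ℂ V] [AddCommGroup X]
  [Module ℂ X] [AddCommGroup Y] [Module ℂ Y] {P : BiComult V X Y}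
  {ε : V →ₗ[ℂ] X} {η : V →ₗ[ℂ] Y}

/-- In the presence of a bijective antipode, all four canonical maps are bijective. -/
theorem IsAntipode.nonempty_translations {S : V ≃ₗ[ℂ] V} (hS : P.IsAntipode ε η S.toLinearMap)
    (hε : P.L.IsCounit ε) (hη : P.R.IsCounit η)
    (m : ∀ a a', S (P.L.m a a') = P.L.m (S a') (S a)) :
    Nonempty (Translation P.L) ∧ Nonempty (Translation P.L.cop) ∧ Nonempty (Translation P.R) ∧
      Nonempty (Translation P.R.cop) := by
  -- The maps `S` and `S⁻¹` give inverses of canonical maps for `P.L` and its co-opposite. Applying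
  -- `op_cop` to each of these antipodes covers the two canonical maps of `P.R`.
  have hT : P.cop.IsAntipode ε η S.symm.toLinearMap :=
    hS.symm hη m S.apply_symm_apply S.symm_apply_apply
  have k : Translation P.R.cop.cop := hT.op_cop.translation hη.cop.cop hε.cop.cop
  exact ⟨⟨hS.translation hε hη⟩, ⟨hT.translation hε.cop hη.cop⟩, ⟨P.R.cop_cop ▸ k⟩,
    ⟨hS.op_cop.translation hη.cop hε.cop⟩⟩

end BiComult

end MultHopf

/-! ### Base algebras as algebras of multipliers, and part (2) -/

namespace MultHopf

section Base

variable {H : Type u} [Ring H] [Algebra ℂ H] {L : Type v} [Ring L] [Algebra ℂ L]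

/-- The image of an algebra homomorphism, as an algebra of multipliers. -/
def multiplierRange (t : L →ₐ[ℂ] H) : NonUnitalSubalgebra ℂ (Multiplier H) where
  carrier := {T | ∃ l, t l = Multiplier.val T}
  add_mem' := by
    rintro S T ⟨l, hl⟩ ⟨l', hl'⟩
    exact ⟨l + l', by rw [map_add, map_add, hl, hl']⟩
  zero_mem' := ⟨0, by rw [map_zero, map_zero]⟩
  smul_mem' := by
    rintro r T ⟨l, hl⟩
    exact ⟨r • l, by rw [map_smul, map_smul, hl]⟩
  mul_mem' := by
    rintro S T ⟨l, hl⟩ ⟨l', hl'⟩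
    exact ⟨l * l', by rw [map_mul, Multiplier.val_mul, hl, hl']⟩

theorem exists_equiv_multiplierRange {t : L →ₐ[ℂ] H} (ht : Function.Injective t) :
    ∃ e : L ≃ₗ[ℂ] multiplierRange t, ∀ l, Multiplier.val (e l : Multiplier H) = t l := by
  have inj : ∀ x y : multiplierRange t, Multiplier.val (x : Multiplier H) =
      Multiplier.val (y : Multiplier H) → x = y := fun x y h =>
    Subtype.ext (Multiplier.val_injective h)
  let f : L → multiplierRange t := fun l =>
    ⟨Multiplier.ofElem (t l), l, (Multiplier.val_ofElem _).symm⟩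
  have hf : ∀ l, Multiplier.val (f l : Multiplier H) = t l := fun l => Multiplier.val_ofElem _
  let F : L →ₗ[ℂ] multiplierRange t := ⟨⟨f, fun l l' => inj _ _ <| by
    rw [hf, map_add, ← hf, ← hf, ← map_add]; rfl⟩, fun r l => inj _ _ <| by
    rw [hf, map_smul, ← hf, ← map_smul]; rfl⟩
  refine ⟨LinearEquiv.ofBijective F ⟨fun l l' h => ht ?_, fun x => ?_⟩, hf⟩
  · rw [← hf, ← hf]; exact congrArg (fun x : multiplierRange t => Multiplier.val x.1) h
  · obtain ⟨l, hl⟩ := x.2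
    exact ⟨l, inj _ _ ((hf l).trans hl)⟩

variable {B : NonUnitalSubalgebra ℂ (Multiplier H)}

/-- The counit is a retraction of the target map, as it is of the source map. Both are therefore
injective, and the base algebra can be recovered from its image in `H`. -/
theorem LeftBialgebroid.ε_t (𝓛 : LeftBialgebroid H L) (l : L) : 𝓛.ε (𝓛.t (.op l)) = l := by
  simpa [𝓛.ε_one] using 𝓛.ε_bimod 1 l 1

theorem LeftBialgebroid.ε_s (𝓛 : LeftBialgebroid H L) (l : L) : 𝓛.ε (𝓛.s l) = l := by
  simpa [𝓛.ε_one] using 𝓛.ε_bimod l 1 1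

theorem RightBialgebroid.ε_t (𝓡 : RightBialgebroid H L) (l : L) : 𝓡.ε (𝓡.t (.op l)) = l := by
  simpa [𝓡.ε_one] using 𝓡.ε_bimod l 1 1

theorem RightBialgebroid.ε_s (𝓡 : RightBialgebroid H L) (l : L) : 𝓡.ε (𝓡.s l) = l := by
  simpa [𝓡.ε_one] using 𝓡.ε_bimod 1 l 1

theorem LeftBialgebroid.exists_equiv (𝓛 : LeftBialgebroid H L) :
    ∃ e : L ≃ₗ[ℂ] multiplierRange 𝓛.t, ∀ l, Multiplier.val (e l : Multiplier H) = 𝓛.t (.op l) := by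
  obtain ⟨e, he⟩ := exists_equiv_multiplierRange (t := 𝓛.t) fun l l' h =>
    MulOpposite.unop_injective (by rw [← 𝓛.ε_t l.unop, ← 𝓛.ε_t l'.unop]; exact congrArg 𝓛.ε h)
  exact ⟨(MulOpposite.opLinearEquiv ℂ).trans e, fun l => he _⟩

theorem RightBialgebroid.exists_equiv (𝓡 : RightBialgebroid H L) :
    ∃ e : L ≃ₗ[ℂ] multiplierRange 𝓡.t, ∀ l, Multiplier.val (e l : Multiplier H) = 𝓡.t (.op l) := by
  obtain ⟨e, he⟩ := exists_equiv_multiplierRange (t := 𝓡.t) fun l l' h =>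
    MulOpposite.unop_injective (by rw [← 𝓡.ε_t l.unop, ← 𝓡.ε_t l'.unop]; exact congrArg 𝓡.ε h)
  exact ⟨(MulOpposite.opLinearEquiv ℂ).trans e, fun l => he _⟩

theorem equiv_mul {t : Lᵐᵒᵖ →ₐ[ℂ] H} {e : L ≃ₗ[ℂ] B}
    (he : ∀ l, Multiplier.val (e l : Multiplier H) = t (.op l)) (l l' : L) :
    e (l * l') = e l' * e l := Subtype.ext <| Multiplier.val_injective <| by
  rw [he, MulOpposite.op_mul, map_mul, ← he, ← he, ← Multiplier.val_mul]; rfl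

theorem symm_equiv_mul {t : Lᵐᵒᵖ →ₐ[ℂ] H} {e : L ≃ₗ[ℂ] B}
    (he : ∀ l, Multiplier.val (e l : Multiplier H) = t (.op l)) (x y : B) :
    e.symm (x * y) = e.symm y * e.symm x := by
  rw [LinearEquiv.symm_apply_eq, equiv_mul he, e.apply_symm_apply, e.apply_symm_apply]

/-- The algebra and base maps of a left bialgebroid, over an algebra of multipliers. -/
def LeftBialgebroid.based (𝓛 : LeftBialgebroid H L) (e : L ≃ₗ[ℂ] B)
    (he : ∀ l, Multiplier.val (e l : Multiplier H) = 𝓛.t (.op l)) : BasedAlgebra H B where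
  m := LinearMap.mul ℂ H
  e := 1
  assoc := mul_assoc
  e_m := one_mul
  m_e := mul_one
  b := Multiplier.val ∘ₗ B.toSubmodule.subtype
  b' := 𝓛.s.toLinearMap ∘ₗ e.symm.toLinearMap
  μ x y := x * y
  o := e 1
  b_inj := Multiplier.val_injective.comp Subtype.val_injective
  b'_inj := (Function.LeftInverse.injective 𝓛.ε_s).comp e.symm.injective
  b_o := (he 1).trans (map_one 𝓛.t)
  b'_o := by
    rw [LinearMap.comp_apply, LinearEquiv.coe_coe, e.symm_apply_apply]; exact map_one 𝓛.s
  b_μ x y := Multiplier.val_mul _ _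
  b'_μ x y := (congrArg 𝓛.s (symm_equiv_mul he x y)).trans (map_mul 𝓛.s _ _)
  b_comm x y := by
    have := 𝓛.comm (e.symm y) (.op (e.symm x))
    rw [← he, e.apply_symm_apply] at this
    exact this.symm

theorem LeftBialgebroid.over_based (𝓛 : LeftBialgebroid H L) (e : L ≃ₗ[ℂ] B)
    (he : ∀ l, Multiplier.val (e l : Multiplier H) = 𝓛.t (.op l)) : 𝓛.Over (𝓛.based e he) e where
  m_apply _ _ := rfl
  e_eq := rfl
  b_apply := he
  b'_apply l := congrArg 𝓛.s (e.symm_apply_apply l)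

/-- The opposite algebra and base maps of a right bialgebroid, over an algebra of multipliers. -/
def RightBialgebroid.based (𝓡 : RightBialgebroid H L) (e : L ≃ₗ[ℂ] B)
    (he : ∀ l, Multiplier.val (e l : Multiplier H) = 𝓡.t (.op l)) : BasedAlgebra H B where
  m := (LinearMap.mul ℂ H).flip
  e := 1
  assoc _ _ _ := (mul_assoc _ _ _).symm
  e_m := mul_one
  m_e := one_mul
  b := 𝓡.s.toLinearMap ∘ₗ e.symm.toLinearMap
  b' := Multiplier.val ∘ₗ B.toSubmodule.subtype
  μ x y := x * y
  o := e 1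
  b_inj := (Function.LeftInverse.injective 𝓡.ε_s).comp e.symm.injective
  b'_inj := Multiplier.val_injective.comp Subtype.val_injective
  b_o := by
    rw [LinearMap.comp_apply, LinearEquiv.coe_coe, e.symm_apply_apply]; exact map_one 𝓡.s
  b'_o := (he 1).trans (map_one 𝓡.t)
  b_μ x y := (congrArg 𝓡.s (symm_equiv_mul he x y)).trans (map_mul 𝓡.s _ _)
  b'_μ x y := Multiplier.val_mul _ _
  b_comm x y := by
    have := 𝓡.comm (e.symm x) (.op (e.symm y))
    rw [← he, e.apply_symm_apply] at this
    exact this.symm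

theorem RightBialgebroid.over_based (𝓡 : RightBialgebroid H L) (e : L ≃ₗ[ℂ] B)
    (he : ∀ l, Multiplier.val (e l : Multiplier H) = 𝓡.t (.op l)) : 𝓡.Over (𝓡.based e he) e where
  m_apply _ _ := rfl
  e_eq := rfl
  b_apply l := congrArg 𝓡.s (e.symm_apply_apply l)
  b'_apply := he

end Base

section Realizes

variable {A : Type u} {X : Type v} {L : Type w} [Ring A] [Algebra ℂ A] [NonUnitalRing X]
  [Module ℂ X] [Ring L] [Algebra ℂ L] {Q : BasedAlgebra A X} {e : L ≃ₗ[ℂ] X}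

theorem LeftBialgebroid.Over.mk_eq_iff {𝓛 : LeftBialgebroid A L} (h : 𝓛.Over Q e)
    {𝓜 : LeftMultiplierBialgebroid A X} (k : 𝓜.Realizes h.toComult) (a : A) (w : A ⊗[ℂ] A) :
    Bal.mk _ _ w = 𝓛.Δ a ↔ Bal.mk _ _ w = (𝓜.Δ a).1 (𝓜.sys.tmul 1 1) := by
  have p : Presents (fun x u => h.toComult.m (h.toComult.b x) u)
    (fun x u => h.toComult.m (h.toComult.b' x) u) _ _ := h.presents
  rw [← h.mk_d a, ← k.mk_d a]
  exact p.mk_eq_iff k.presents w _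

theorem RightBialgebroid.Over.mk_eq_iff {𝓡 : RightBialgebroid A L} (h : 𝓡.Over Q e)
    {𝓜 : RightMultiplierBialgebroid A X} (k : 𝓜.Realizes h.toComult) (a : A) (w : A ⊗[ℂ] A) :
    Bal.mk _ _ w = 𝓡.Δ a ↔ Bal.mk _ _ w = (𝓜.Δ a).1 (𝓜.sys.tmul 1 1) := by
  have p : Presents (fun x u => h.toComult.m (h.toComult.b x) u)
    (fun x u => h.toComult.m (h.toComult.b' x) u) _ _ := h.presents
  rw [← h.mk_d a, ← k.mk_d a]
  exact p.mk_eq_iff k.presents w _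

end Realizes

namespace HopfAlgebroid

variable {H : Type u} {L : Type v} {R : Type w} [Ring H] [Algebra ℂ H] [Ring L] [Algebra ℂ L]
  [Ring R] [Algebra ℂ R] (ℋ : HopfAlgebroid H L R)

/-- The anti-isomorphism of the base algebras with `t_R(θ(l)) = s_L(l)`. -/
def baseEquiv₁ : L ≃ₗ[ℂ] R :=
  LinearEquiv.ofLinearMap (ℋ.right.ε ∘ₗ ℋ.left.s.toLinearMap)
    (ℋ.left.ε ∘ₗ ℋ.right.t.toLinearMap ∘ₗ (MulOpposite.opLinearEquiv ℂ).toLinearMap)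
    (LinearMap.ext fun r =>
      (congrArg ℋ.right.ε (ℋ.sL_εL_tR r)).trans (ℋ.right.ε_t r))
    (LinearMap.ext fun l =>
      (congrArg ℋ.left.ε (ℋ.tR_εR_sL l)).trans (ℋ.left.ε_s l))

/-- The anti-isomorphism of the base algebras with `t_L(θ(r)) = s_R(r)`. -/
def baseEquiv₂ : R ≃ₗ[ℂ] L :=
  LinearEquiv.ofLinearMap (ℋ.left.ε ∘ₗ ℋ.right.s.toLinearMap)
    (ℋ.right.ε ∘ₗ ℋ.left.t.toLinearMap ∘ₗ (MulOpposite.opLinearEquiv ℂ).toLinearMap)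
    (LinearMap.ext fun l =>
      (congrArg ℋ.left.ε (ℋ.sR_εR_tL l)).trans (ℋ.left.ε_t l))
    (LinearMap.ext fun r =>
      (congrArg ℋ.right.ε (ℋ.tL_εL_sR r)).trans (ℋ.right.ε_s r))

theorem right_t_baseEquiv₁ (l : L) : ℋ.right.t (.op (ℋ.baseEquiv₁ l)) = ℋ.left.s l :=
  ℋ.tR_εR_sL l

theorem left_t_baseEquiv₂ (r : R) : ℋ.left.t (.op (ℋ.baseEquiv₂ r)) = ℋ.right.s r :=
  ℋ.tL_εL_sR r

/-- One takes `B = t_L(L)` and `C = t_R(R)` inside `M(H) = H`. The target maps are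
anti-homomorphisms on `L` and `R`, which accounts for `L ≅ Bᵒᵖ` and `R ≅ Cᵒᵖ`. -/
theorem exists_multiplierBialgebroid (hS : Function.Bijective ℋ.S) :
    ∃ (𝒜 : MultiplierBialgebroid H) (hu : 𝒜.IsUnital) (S : H ≃ₗ[ℂ] H)
      (εB : H →ₗ[ℂ] 𝒜.B) (εC : H →ₗ[ℂ] 𝒜.C) (φ : L ≃ₐ[ℂ] hu.L) (ψ : R ≃ₐ[ℂ] hu.R),
      𝒜.IsRegularHopf ∧ 𝒜.IsInvertibleAntipode S ∧
      𝒜.left.IsCounit εB ∧ 𝒜.right.IsCounit εC ∧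
      hu.IsAssociatedLeft εB φ ℋ.left ∧
      hu.IsAssociatedRight εC ψ ℋ.right ∧
      ℋ.S = S := by
  obtain ⟨e, he⟩ := ℋ.left.exists_equiv
  obtain ⟨e', he'⟩ := ℋ.right.exists_equiv
  have h := ℋ.left.over_based e he
  have h' := ℋ.right.over_based e' he'
  -- Here `S_B` sends `t_L(l)` to `s_L(l)`, written as `t_R` of an element of `R`, and `S_C` sends
  -- `t_R(r)` to `s_R(r)`, written as `t_L` of an element of `L`.
  have hb : MultiplierBialgebroid.IsBase (toBiComult h h')
      (e.symm.trans (ℋ.baseEquiv₁.trans e')) (e'.symm.trans (ℋ.baseEquiv₂.trans e)) :=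
    { m_apply := fun _ _ => rfl
      e_eq := rfl
      L_b := fun _ => rfl
      L_b' := fun x => ((he' _).trans (ℋ.right_t_baseEquiv₁ _)).symm
      L_μ := fun _ _ => rfl
      R_b := fun y => ((he _).trans (ℋ.left_t_baseEquiv₂ _)).symm
      R_b' := fun _ => rfl
      R_μ := fun _ _ => rfl }
  let S : H ≃ₗ[ℂ] H := LinearEquiv.ofBijective ℋ.S hS
  have hε : (toBiComult h h').L.IsCounit _ := h.isCounit
  have hη : (toBiComult h h').R.IsCounit _ := h'.isCounit
  have anti : (toBiComult h h').IsAntipode _ _ S.toLinearMap := isAntipode h h'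
  obtain ⟨⟨K⟩, ⟨K'⟩, ⟨T⟩, ⟨T'⟩⟩ := anti.nonempty_translations hε hη (antipode_mul h h')
  let φ : L ≃ₐ[ℂ] hb.isUnital.L := AlgEquiv.ofLinearEquiv
    (e.trans hb.isUnital.equivL.symm)
    (MulOpposite.unop_injective <| Subtype.ext <| Multiplier.val_injective <|
      (he 1).trans ((map_one ℋ.left.t).trans Multiplier.val_one.symm))
    (fun l l' => congrArg hb.isUnital.equivL.symm (equiv_mul he l l'))
  let ψ : R ≃ₐ[ℂ] hb.isUnital.R := AlgEquiv.ofLinearEquiv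
    (e'.trans hb.isUnital.equivR.symm)
    (MulOpposite.unop_injective <| Subtype.ext <| Multiplier.val_injective <|
      (he' 1).trans ((map_one ℋ.right.t).trans Multiplier.val_one.symm))
    (fun r r' => congrArg hb.isUnital.equivR.symm (equiv_mul he' r r'))
  refine ⟨hb.toMultiplierBialgebroid, hb.isUnital, S, e.toLinearMap ∘ₗ ℋ.left.ε,
    e'.toLinearMap ∘ₗ ℋ.right.ε, φ, ψ, hb.isRegularHopf hε hη K K' T T',
    hb.realizes.isInvertibleAntipode hε hη anti (antipode_mul h h'),
    (hb.realizes.left.isCounit_iff _).2 hε, (hb.realizes.right.isCounit_iff _).2 hη,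
    ⟨fun l => (he l).symm, fun l x hx => ?_, fun a => rfl, fun a w => ?_⟩,
    ⟨fun r => ?_, fun r y hy => ?_, fun a => rfl, fun a w => ?_⟩, rfl⟩
  · obtain rfl : x = e l := Subtype.ext hx
    exact (h.b'_apply l).symm.trans (hb.L_b' (e l))
  · exact h.mk_eq_iff hb.realizes.left a w
  · exact (he' r).symm.trans (Multiplier.val_eq_r _)
  · obtain rfl : y = e' r := Subtype.ext hy
    exact (h'.b_apply r).symm.trans ((hb.R_b (e' r)).trans (Multiplier.val_eq_r _))
  · exact h'.mk_eq_iff hb.realizes.right a w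

end HopfAlgebroid

end MultHopf

theorem mainTheorem8 :
    (∀ (A : Type u) [Ring A] [Algebra ℂ A] (𝒜 : MultiplierBialgebroid A),
      𝒜.IsRegularHopf → ∀ hu : 𝒜.IsUnital,
        (∃! S : A ≃ₗ[ℂ] A, 𝒜.IsInvertibleAntipode S) ∧
        (∃! εB : A →ₗ[ℂ] 𝒜.B, 𝒜.left.IsCounit εB) ∧
        (∃! εC : A →ₗ[ℂ] 𝒜.C, 𝒜.right.IsCounit εC) ∧
        ∀ (S : A ≃ₗ[ℂ] A) (εB : A →ₗ[ℂ] 𝒜.B) (εC : A →ₗ[ℂ] 𝒜.C),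
          𝒜.IsInvertibleAntipode S → 𝒜.left.IsCounit εB → 𝒜.right.IsCounit εC →
            ∃ ℋ : HopfAlgebroid A hu.L hu.R,
              hu.IsAssociatedLeft εB AlgEquiv.refl ℋ.left ∧
              hu.IsAssociatedRight εC AlgEquiv.refl ℋ.right ∧
              ℋ.S = S) ∧
    (∀ (H : Type u) [Ring H] [Algebra ℂ H] (L : Type v) [Ring L] [Algebra ℂ L]
      (R : Type w) [Ring R] [Algebra ℂ R] (ℋ : HopfAlgebroid H L R),
      Function.Bijective ℋ.S →
        ∃ (𝒜 : MultiplierBialgebroid H) (hu : 𝒜.IsUnital) (S : H ≃ₗ[ℂ] H)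
          (εB : H →ₗ[ℂ] 𝒜.B) (εC : H →ₗ[ℂ] 𝒜.C) (φ : L ≃ₐ[ℂ] hu.L) (ψ : R ≃ₐ[ℂ] hu.R),
          𝒜.IsRegularHopf ∧ 𝒜.IsInvertibleAntipode S ∧
          𝒜.left.IsCounit εB ∧ 𝒜.right.IsCounit εC ∧
          hu.IsAssociatedLeft εB φ ℋ.left ∧
          hu.IsAssociatedRight εC ψ ℋ.right ∧
          ℋ.S = S) :=
  ⟨fun _ _ _ _ hA hu => ⟨hu.realizes.existsUnique_antipode hA hu,
    hu.realizes.existsUnique_counit_left hA, hu.realizes.existsUnique_counit_right hA,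
    fun _ _ _ hS hε hη => hu.exists_hopfAlgebroid hA hS hε hη⟩,
    fun _ _ _ _ _ _ _ _ _ ℋ hS => ℋ.exists_multiplierBialgebroid hS⟩
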